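/- **Setting.** Let $G$ be a finite plane graph with non-negative edge lengths and external face $f^\infty$. A *set of non-crossing shortest paths* (NCS) in $G$ is a finite set $P$ of paths of $G$, each $p\in P$ having two distinct extremal vertices, such that: the pairs of extremal vertices are pairwise distinct; all extremal vertices lie on $f^\infty$; each $p$ is a shortest path of $G$ between its extremal vertices; the paths are *single-touch* (the intersection of any two is empty or a path); no two of them cross in $G$; and the terminal pairs are *well-formed*: the boundary of $f^\infty$ can be cut open at an edge (on each closed boundary walk carrying terminals), and the extremal vertices of every $p\in P$ named $x_p,y_p$ and given positions on the boundary, so that the clockwise boundary walks $\gamma_p$ from $x_p$ to $y_p$ avoid the cut and any two of them on the same boundary walk are nested or share no edge. A *forest labeling* of $P$ is a map $\mathcal L:P\to[k]$ such that $\bigcup_{\mathcal L(p)=i}p$ is a forest for every $i\in[k]$. The *Path Covering with Forests Number* $\mathrm{PCFN}(P)$ is the minimum size of a set $F$ of forests such that every path of $P$ is contained in some forest of $F$. **Binary NCS.** Choose a root $p_1\in P$ and a boundary edge $e_1$ (the cut) such that $\gamma_p\subseteq\gamma_{p_1}\not\ni e_1$ for all $p\in P$. Put $p\preceq q$ if $\gamma_p\subseteq\gamma_q$;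 the Hasse diagram of $\preceq$ is the genealogy tree. $P$ is a *binary* NCS (BNCS) if each path $q$ has no child, or has exactly two children, the right child $q_r$ (first after $x_q$, clockwise) and the left child $q_\ell$, and then $q,q_r,q_\ell$ form a face $f$ of $\bigcup_{p\in P}p$. The path $q$ is called the upper path of $f$; the extremal edges of $\partial f\setminus q$ are denoted $e^f_r\in q_r$ and $e^f_\ell\in q_\ell$; a path interferes with $f$ if it contains one of them. A BNCS $B$ (in a possibly different plane graph) *carries* an NCS $P$ if there are an injection $j:P\to B$ and a map of vertices sending the edges of each $p\in P$ to edges of $j(p)$ and identifying no two edges of $\bigcup_{p\in P}p$. **Algorithm FifteenForests on a BNCS $B$.** Let $T_1,\dots,T_5$ be the triples $\{1,2,3\},\dots,\{13,14,15\}$. For $p\in B$ let $Touch_p$ be the set of the $q\preceq p$ sharing a vertex with $p$, and $Max_p$ the set of the $\preceq$-maximal elements of $\{q\preceq p\}\setminus Touch_p$. Let $MAX$ be the smallest set containing $p_1$ and, with each $p$, all of $Max_p$. Set $triple(p_1)=T_1$ and, proceeding from $p_1$ downwards, for each $p\in MAX$ execute the following two steps. * ColorTouch: choose an ordering $(c_1,c_2,c_3)$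 of $triple(p)$ and call $RC(p,p,(c_1,c_2,c_3))$. Here $RC(p,q,(c_1,c_2,c_3))$ sets $\mathcal L(q)=c_1$; if exactly one child $q'$ of $q$ is in $Touch_p$ it calls $RC(p,q',(c_1,c_2,c_3))$; if both are, it calls $RC(p,q_r,(c_1,c_3,c_2))$ and $RC(p,q_\ell,(c_2,c_1,c_3))$. * TripleMax: name the four triples other than $triple(p)$ as $X,Y,W,Z$. For each $q$ with both children in $Max_p$, set $triple(q_r)=X$ and $triple(q_\ell)=Y$. Let $Max_p^{III}$ be the set of the $m\in Max_p$ whose sibling is in $Touch_p$; for $m\ne m'$ write $m\dashrightarrow m'$ if $m$ interferes with the face whose upper path is the parent of $m'$. Split $Max_p^{III}$ into two classes without $\dashrightarrow$ inside a class; set $triple=W$ on the first class and $triple=Z$ on the second. On an NCS $P$, the algorithm first transforms $P$ into a BNCS $B$ carrying $P$, runs as above on $B$, and labels each $p\in P$ by $\mathcal L(j(p))$. **Theorem.** Let $P$ be an NCS. 1. Whatever BNCS $B$ carrying $P$ (with whatever root $p_1$ and edge $e_1$) is used, the algorithm FifteenForests can be executed on $B$, and for all choices made during the execution the resulting labeling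 $\mathcal L:B\to[15]$ is a forest labeling of $B$, and $p\mapsto\mathcal L(j(p))$ is a forest labeling of $P$ with at most 15 labels. 2. $P$ has a forest labeling with at most 15 labels, and $\mathrm{PCFN}(P)\le 15$. -/

import Mathlib

open SimpleGraph

/-! ### Forests and the Path Covering with Forests Number -/

/-- A subgraph is a forest when it has no cycle. -/
def IsForest {V : Type*} {G : SimpleGraph V} (H : G.Subgraph) : Prop :=
  H.coe.IsAcyclic

/-- The Path Covering with Forests Number of a set `S` of paths (seen as subgraphs of `G`): the
minimum size of a set `F` of forests such that every path of `S` is contained in a forest of `F`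
(it is `⊤` if there is no such `F`). -/
noncomputable def pcfn {V : Type*} {G : SimpleGraph V} (S : Set G.Subgraph) : ℕ∞ :=
  ⨅ F ∈ {F : Set G.Subgraph | (∀ H ∈ F, IsForest H) ∧ ∀ p ∈ S, ∃ H ∈ F, p ≤ H}, F.encard

/-! ### Weighted plane graphs -/

/-- Walking along the faces of the embedding with rotation `rot`: a dart is followed by the dart
that comes after its reverse in the order `rot` around their common vertex. -/
def faceStep {V : Type*} {G : SimpleGraph V} (rot : Equiv.Perm G.Dart) : Equiv.Perm G.Dart :=
  (Function.Involutive.toPerm Dart.symm Dart.symm_involutive).trans rot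

/-- A finite undirected graph with non-negative edge lengths and a fixed embedding in the plane, the
embedding being given combinatorially: `rot` sends each dart to the next dart in clockwise order
around its starting vertex. The faces are the orbits of `faceStep rot`, i.e. of `d ↦ rot d.symm`, which
walks along a face keeping it on the left.

`euler` is Euler's formula: every component of the graph is embedded with genus `0`. (A component
with an edge satisfies `#V + #faces = #E + 2`; an isolated vertex has no dart, hence no orbit, and
its single face is counted separately.)

`outer` is the set of the darts along the external face. In a disconnected graph the boundary of the
external face may consist of several closed walks, at most one for each component. -/
structure PlaneGraph (V : Type*) [Fintype V] where
  graph : SimpleGraph V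
  len : Sym2 V → ℝ
  len_nonneg : ∀ e ∈ graph.edgeSet, 0 ≤ len e
  rot : Equiv.Perm graph.Dart
  rot_cycle : ∀ d d' : graph.Dart, rot.SameCycle d d' ↔ d.fst = d'.fst
  euler :
    Nat.card V + (Nat.card (Quotient (Equiv.Perm.SameCycle.setoid (faceStep rot)))
        + Nat.card {v : V // ∀ u, ¬ graph.Adj v u})
      = Nat.card graph.edgeSet + 2 * Nat.card graph.ConnectedComponent
  outer : Set graph.Dart
  outer_face : ∀ d ∈ outer, faceStep rot d ∈ outer
  outer_unique : ∀ d ∈ outer, ∀ d' ∈ outer, graph.Reachable d.fst d'.fst →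
    (faceStep rot).SameCycle d d'

namespace PlaneGraph

variable {V : Type*} [Fintype V] (G : PlaneGraph V)

/-- The next dart along a face (the face is on the left; the external face is followed clockwise
around the graph). -/
def face : Equiv.Perm G.graph.Dart := faceStep G.rot

/-- The vertex `v` lies on the external face. -/
def OnOuter (v : V) : Prop := ∃ d ∈ G.outer, d.fst = v

/-- The vertex found after `k` steps along the face of `e`, starting from the tail of `e`. -/
def corner (e : G.graph.Dart) (k : ℕ) : V := ((G.face)^[k] e).fst

/-- The length of the closed walk along the face of `e`. -/
noncomputable def faceLength (e : G.graph.Dart) : ℕ := Function.minimalPeriod G.face e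

/-- The length of a walk. -/
def walkLength {u v : V} (p : G.graph.Walk u v) : ℝ := (p.edges.map G.len).sum

/-- Turning clockwise around their common tail, starting from `d₁`, one meets first `d₂`, then `d₃`,
before coming back to `d₁`. -/
def InSector (d₁ d₂ d₃ : G.graph.Dart) : Prop :=
  ∃ i j : ℕ, 0 < i ∧ i < j ∧ j < Function.minimalPeriod G.rot d₁ ∧
    (G.rot)^[i] d₁ = d₂ ∧ (G.rot)^[j] d₁ = d₃

/-- The walk `q` crosses the walk `p`: after possibly reversing `q`, they have a common stretch `cs`
of darts (possibly empty: then they have a common vertex), which `p` enters by `a` and leaves by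
`b`, and `q` enters by `a'` and leaves by `b'`, such that `a'` and `b'` are on opposite sides
of `p`. -/
def Crosses {u v u' v' : V} (p : G.graph.Walk u v) (q : G.graph.Walk u' v') : Prop :=
  ∃ (a b a' b' : G.graph.Dart) (cs : List G.graph.Dart),
    (a :: cs ++ [b]) <:+: p.darts ∧
    ((a' :: cs ++ [b']) <:+: q.darts ∨ (a' :: cs ++ [b']) <:+: q.reverse.darts) ∧
    a.snd = a'.snd ∧ b.fst = b'.fst ∧
    [cs.headD b, a.symm, a'.symm].Nodup ∧ [b, (cs.getLastD a).symm, b'].Nodup ∧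
    ¬ (G.InSector (cs.headD b) a'.symm a.symm ↔ G.InSector b b' (cs.getLastD a).symm)

end PlaneGraph

/-! ### Sets of non-crossing shortest paths -/

/-- A family of paths of `G`; `x i` and `y i` are the extremal vertices of the `i`-th path. -/
structure PathFamily {V : Type*} (G : SimpleGraph V) (ι : Type*) where
  x : ι → V
  y : ι → V
  path : ∀ i, G.Walk (x i) (y i)
  isPath : ∀ i, (path i).IsPath

namespace PathFamily

variable {V : Type*} {G : SimpleGraph V} {ι : Type*} (P : PathFamily G ι)

/-- The `i`-th path as a graph. -/
def sub (i : ι) : G.Subgraph := (P.path i).toSubgraph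

/-- The set of paths of the family. -/
def paths : Set G.Subgraph := Set.range P.sub

/-- The set of edges of the union `U` of all the paths. -/
def unionEdges : Set (Sym2 V) := {e | ∃ i, e ∈ (P.path i).edges}

/-- The intersection of any two paths is empty or a path. -/
def SingleTouch : Prop :=
  ∀ i j, P.sub i ⊓ P.sub j = ⊥ ∨
    ∃ (u v : V) (w : G.Walk u v), w.IsPath ∧ P.sub i ⊓ P.sub j = w.toSubgraph

/-- `L` is a forest labeling: the union of the paths with a given label is always a forest. -/
def IsForestLabeling {k : ℕ} (L : ι → Fin k) : Prop :=
  ∀ c : Fin k, IsForest (⨆ i ∈ {i | L i = c}, P.sub i)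

end PathFamily

/-- A choice of the boundary arcs `γ_p` showing that the terminal pairs are well-formed. The closed
walk around the external face (of the component containing the `i`-th path) is cut open at the dart
`base i`; its darts and its corners are numbered `0, 1, 2, …` from there, clockwise, and `γ_i`
consists of the darts with number in `[a i, b i)`. Thus `γ_i` goes clockwise from one extremal
vertex of the `i`-th path to the other, avoiding the dart `base i`, and any two arcs on the same
closed walk are nested or share no dart. -/
structure TerminalArcs {V : Type*} [Fintype V] (G : PlaneGraph V) {ι : Type*}
    (P : PathFamily G.graph ι) where
  base : ι → G.graph.Dart
  base_outer : ∀ i, base i ∈ G.outer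
  base_eq : ∀ i j, G.graph.Reachable (base i).fst (base j).fst → base i = base j
  a : ι → ℕ
  b : ι → ℕ
  one_le_a : ∀ i, 1 ≤ a i
  a_le_b : ∀ i, a i ≤ b i
  b_le : ∀ i, b i ≤ G.faceLength (base i)
  ends : ∀ i, s(G.corner (base i) (a i), G.corner (base i) (b i)) = s(P.x i, P.y i)
  laminar : ∀ i j, base i = base j →
    Finset.Ico (a i) (b i) ⊆ Finset.Ico (a j) (b j) ∨
    Finset.Ico (a j) (b j) ⊆ Finset.Ico (a i) (b i) ∨
    Disjoint (Finset.Ico (a i) (b i)) (Finset.Ico (a j) (b j))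

/-- `P` is a set of non-crossing shortest paths (NCS) in the plane graph `G`. -/
structure IsNCS {V : Type*} [Fintype V] (G : PlaneGraph V) {ι : Type*}
    (P : PathFamily G.graph ι) : Prop where
  ends_ne : ∀ i, P.x i ≠ P.y i
  pairs_distinct : Function.Injective fun i => s(P.x i, P.y i)
  outer : ∀ i, G.OnOuter (P.x i) ∧ G.OnOuter (P.y i)
  shortest : ∀ i (r : G.graph.Walk (P.x i) (P.y i)), G.walkLength (P.path i) ≤ G.walkLength r
  singleTouch : P.SingleTouch
  nonCrossing : ∀ i j, ¬ G.Crosses (P.path i) (P.path j)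
  wellFormed : Nonempty (TerminalArcs G P)

/-! ### Genealogy tree and binary sets of non-crossing shortest paths -/

/-- The choices that determine the genealogy tree: the root path `root` and a dart `e₁ = base root`
on the external face such that no arc `γ_i` contains `e₁` and all of them are contained
in `γ_root`. -/
structure Genealogy {V : Type*} [Fintype V] (G : PlaneGraph V) {ι : Type*}
    (P : PathFamily G.graph ι) extends TerminalArcs G P where
  root : ι
  base_root : ∀ i, base i = base root
  le_root : ∀ i, Finset.Ico (a i) (b i) ⊆ Finset.Ico (a root) (b root)

namespace Genealogy

variable {V : Type*} [Fintype V] {G : PlaneGraph V} {ι : Type*} {P : PathFamily G.graph ι}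
  (T : Genealogy G P)

/-- The arc `γ_i`. -/
def arc (i : ι) : Finset ℕ := Finset.Ico (T.a i) (T.b i)

/-- `i ≼ j`: the path `i` is a descendant of the path `j` (or equal to it). -/
def Le (i j : ι) : Prop := T.arc i ⊆ T.arc j

/-- `c` is a child of `p` in the genealogy tree. -/
def IsChild (c p : ι) : Prop :=
  T.arc c ⊂ T.arc p ∧ ∀ k, ¬ (T.arc c ⊂ T.arc k ∧ T.arc k ⊂ T.arc p)

/-- The path `p` has exactly two children, the right child `r` and the left child `l`: clockwise
from `x_p` to `y_p` one meets first the terminals of `r`, then those of `l`. -/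
def Children (p r l : ι) : Prop :=
  T.IsChild r p ∧ T.IsChild l p ∧ T.b r ≤ T.a l ∧ ∀ c, T.IsChild c p → c = r ∨ c = l

end Genealogy

/-- In the plane graph `U` induced by the union of the paths, `d'` follows `d` along a face of `U`:
`d'` is the first dart of `U` met when turning clockwise from `d.symm`. -/
def NextInUnion {V : Type*} [Fintype V] (G : PlaneGraph V) {ι : Type*}
    (P : PathFamily G.graph ι) (d d' : G.graph.Dart) : Prop :=
  d'.edge ∈ P.unionEdges ∧ ∃ k : ℕ, 0 < k ∧ (G.rot)^[k] d.symm = d' ∧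
    ∀ j, 0 < j → j < k → ((G.rot)^[j] d.symm).edge ∉ P.unionEdges

/-- The paths `p`, `r`, `l` form a face of `U` with boundary the cycle `C`. -/
def FormFace {V : Type*} [Fintype V] (G : PlaneGraph V) {ι : Type*}
    (P : PathFamily G.graph ι) (p r l : ι) {v : V} (C : G.graph.Walk v v) : Prop :=
  C.IsCycle ∧
  (∀ e ∈ C.edges, e ∈ (P.path p).edges ∨ e ∈ (P.path r).edges ∨ e ∈ (P.path l).edges) ∧
  ∀ d ∈ C.darts, ∃ d' ∈ C.darts, NextInUnion G P d d'

namespace Genealogy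

variable {V : Type*} [Fintype V] {G : PlaneGraph V} {ι : Type*} {P : PathFamily G.graph ι}
  (T : Genealogy G P)

/-- Each path has zero or two children, and in the latter case it forms a face with its children.
A set of non-crossing shortest paths with this property is a *binary* one (BNCS). -/
def IsBinary : Prop :=
  ∀ p, (∀ c, ¬ T.IsChild c p) ∨
    ∃ r l, T.Children p r l ∧ ∃ (v : V) (C : G.graph.Walk v v), FormFace G P p r l C

/-- For the face `f` formed by the path `q` (its upper path) and its children: `e` is the extremal
edge of the lower boundary `∂f ∖ q` that belongs to the child `c` of `q`. It is `e^f_r` if `c` is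
the right child, and `e^f_ℓ` if `c` is the left child. -/
def ExtremalEdge (q c : ι) (e : Sym2 V) : Prop :=
  ∃ r l, T.Children q r l ∧ (c = r ∨ c = l) ∧
    ∃ (v : V) (C : G.graph.Walk v v), FormFace G P q r l C ∧ e ∈ C.edges ∧
      e ∈ (P.path c).edges ∧ e ∉ (P.path q).edges ∧ ∃ u ∈ e, u ∈ (P.path q).support

/-- The path `m` interferes with the face whose upper path is `q`. -/
def Interferes (m q : ι) : Prop :=
  ∃ c e, T.ExtremalEdge q c e ∧ e ∈ (P.path m).edges

/-! ### The algorithm `FifteenForests` -/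

/-- `q ∈ Touch_p`. -/
def Touch (p q : ι) : Prop :=
  T.Le q p ∧ ∃ v, v ∈ (P.path q).support ∧ v ∈ (P.path p).support

/-- `m ∈ Max_p`: among the descendants of `p` that do not touch `p`, the path `m` is maximal. -/
def Max (p m : ι) : Prop :=
  (T.Le m p ∧ ¬ T.Touch p m) ∧ ∀ k, T.Le k p → ¬ T.Touch p k → T.Le m k → T.Le k m

/-- The set `MAX` of all the paths `p` on which the main loop of the algorithm is executed. -/
inductive InMAX : ι → Prop
  | root : InMAX T.root
  | step {p m : ι} : InMAX p → T.Max p m → InMAX m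

/-- The face with upper path `q` and children `r`, `l` is of type II for `p`. -/
def TypeII (p q r l : ι) : Prop := T.Children q r l ∧ T.Max p r ∧ T.Max p l

/-- `m ∈ Max_p^III`: the path `m ∈ Max_p` forms a face of type III for `p` with its parent and its
sibling, i.e. its sibling is in `Touch_p`. -/
def MaxIII (p m : ι) : Prop :=
  T.Max p m ∧ ∃ q r l, T.Children q r l ∧ ((m = r ∧ T.Touch p l) ∨ (m = l ∧ T.Touch p r))

/-- `m ⇢ m'`, for two distinct paths: `m` interferes with the face `f_{m'}` whose upper path is the
parent of `m'`. -/
def Arrow (m m' : ι) : Prop :=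
  m ≠ m' ∧ ∃ q, T.IsChild m' q ∧ T.Interferes m q

/-- The recursive calls `RightColor(p, q, σ)` made when `RightColor(p, p, σ₀)` is called. -/
inductive RightColor (p : ι) (σ₀ : Fin 15 × Fin 15 × Fin 15) :
    ι → Fin 15 × Fin 15 × Fin 15 → Prop
  | start : RightColor p σ₀ p σ₀
  | one {q q' : ι} {c₁ c₂ c₃ : Fin 15} : RightColor p σ₀ q (c₁, c₂, c₃) →
      T.IsChild q' q → T.Touch p q' → (∀ q'', T.IsChild q'' q → T.Touch p q'' → q'' = q') →
      RightColor p σ₀ q' (c₁, c₂, c₃)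
  | right {q r l : ι} {c₁ c₂ c₃ : Fin 15} : RightColor p σ₀ q (c₁, c₂, c₃) →
      T.Children q r l → T.Touch p r → T.Touch p l → RightColor p σ₀ r (c₁, c₃, c₂)
  | left {q r l : ι} {c₁ c₂ c₃ : Fin 15} : RightColor p σ₀ q (c₁, c₂, c₃) →
      T.Children q r l → T.Touch p r → T.Touch p l → RightColor p σ₀ l (c₂, c₁, c₃)

/-- The label `c` belongs to the triple with index `t`; the five triples are `{0, 1, 2}`,
`{3, 4, 5}`, `{6, 7, 8}`, `{9, 10, 11}` and `{12, 13, 14}`. -/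
def InTriple (c : Fin 15) (t : Fin 5) : Prop := (c : ℕ) / 3 = (t : ℕ)

/-- The effect of `ColorTouch(p)`: an ordering `(c₁, c₂, c₃)` of the triple of `p` is chosen,
`RightColor(p, p, (c₁, c₂, c₃))` is called, and each of the recursive calls assigns to its path the
first label of its permutation. -/
def ColorTouch (triple : ι → Fin 5) (L : ι → Fin 15) (p : ι) : Prop :=
  ∃ c₁ c₂ c₃ : Fin 15, [c₁, c₂, c₃].Nodup ∧
    InTriple c₁ (triple p) ∧ InTriple c₂ (triple p) ∧ InTriple c₃ (triple p) ∧
    ∀ q σ, T.RightColor p (c₁, c₂, c₃) q σ → L q = σ.1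

/-- The effect of `TripleMax(p)`: the four triples different from that of `p` are named `X`, `Y`,
`W`, `Z` in some order; the children forming a face of type II for `p` get `X` (right child) and
`Y` (left child); `Max_p^III` is split into two classes, `A` and its complement, without arrows
inside a class, and the paths of the first get `W`, those of the second `Z`. -/
def TripleMax (triple : ι → Fin 5) (p : ι) : Prop :=
  ∃ X Y W Z : Fin 5, [triple p, X, Y, W, Z].Nodup ∧
    (∀ q r l, T.TypeII p q r l → triple r = X ∧ triple l = Y) ∧
    ∃ A : Set ι,
      (∀ u v, T.MaxIII p u → T.MaxIII p v → (u ∈ A ↔ v ∈ A) → ¬ T.Arrow u v) ∧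
      ∀ m, T.MaxIII p m → (m ∈ A → triple m = W) ∧ (m ∉ A → triple m = Z)

/-- `L` is a possible output of `FifteenForests`: the root gets the first triple, and `ColorTouch`
and `TripleMax` are executed for each path of `MAX`. The variables `triple` and `L` do not change
once assigned, so that all these assignments hold for their final values. -/
def FifteenForests (L : ι → Fin 15) : Prop :=
  ∃ triple : ι → Fin 5, triple T.root = 0 ∧
    ∀ p, T.InMAX p → T.ColorTouch triple L p ∧ T.TripleMax triple p

end Genealogy

/-- The family `Q` carries the family `P`, as it is the case when `Q` is obtained from `P` by adding
auxiliary paths and by contracting or adding vertices and edges on the external face: every path of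
`P` is sent to a path of `Q` (distinct ones to distinct ones) by a vertex map which maps the edges
of the path to edges of its image path, and which identifies no two edges of the union of `P`. -/
structure Carries {V W : Type*} {G : SimpleGraph V} {H : SimpleGraph W} {ι κ : Type*}
    (Q : PathFamily H κ) (P : PathFamily G ι) where
  toFun : ι → κ
  injective : Function.Injective toFun
  vert : V → W
  map_edge : ∀ i, ∀ e ∈ (P.path i).edges, e.map vert ∈ (Q.path (toFun i)).edges
  edge_injOn : Set.InjOn (Sym2.map vert) P.unionEdges

/-! ### Gluing acyclic graphs -/

section Gluing

variable {V : Type*}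

/-! Planarity enters through one statement, `walks_meet`: walks joining interleaving pairs of
corners of a face share a vertex. By Euler's formula every cycle modulo `2` is a sum of face
boundaries (`range_faceBoundary`), so a walk closed up by an arc of the face two-colours the plane,
and a second walk avoiding the first cannot change colour. Together with single touch, this turns
the paths on one boundary walk into a `ChordSystem`, in which the rest of the argument takes place.
The main consequences are `sep` (a vertex common to a path below `r` and to a path not strictly
below `r` lies on `r`) and `eq_of_linked` (if two meeting pairs interleave, all four paths share one
vertex). Acyclicity comes mostly from gluing: two forests whose common vertices are joined in their
intersection have a forest as union.

On a BNCS, a path `q` and its children `r`, `l` form a cycle, and every such cycle uses both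
extremal edges. Gluing the branches below the children shows that a cycle in a union of paths
retreats to the three paths of one face (`isAcyclic_of_extEdge`). It therefore suffices that paths
through the two extremal edges of a face never have the same label (`ne_of_extEdge`). Let `p ∈ MAX`
be the path with `q ∈ Touch_p`. If both children touch `p`, the permutations of `RightColor`
separate the labels, because the two paths can turn only one way in the tree. If neither does, the
triples `X` and `Y` differ. In the mixed case the missing child has triple `W` or `Z`, and the other
label lies in the triple of `p`, in `X` or `Y`, or in the opposite class of `Max_p^III`.

The algorithm can be executed because every path is labeled by exactly one call, and because `⇢` has
at most one arrow into each point and no cycle, so it is bipartite. The labeling is pulled back to a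
carried family since a map identifying no edges sends a cycle to a closed trail.

The second claim is proved without a BNCS (`exists_grouped_labeling`). Outermost paths are coloured
with three of four groups by a degeneracy argument; paths touching an outermost path share its group
and get one of three labels there; those missing it are treated recursively, with that group
restricted. -/

/-- Any two common vertices of `H₁` and `H₂` are joined in their intersection. -/
def MeetConnected (H₁ H₂ : SimpleGraph V) : Prop :=
  ∀ u v, u ∈ H₁.support → u ∈ H₂.support → v ∈ H₁.support → v ∈ H₂.support →
    (H₁ ⊓ H₂).Reachable u v

/-- A detour around the bridge can leave `H₂` only through `H₁`. Such an excursion begins and ends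
at common vertices, which `H₁ ⊓ H₂` joins; as the edge is not in `H₁`, this intersection survives
its deletion, and the detour can be pushed into `H₂`. -/
lemma isBridge_sup_of_meetConnected {H₁ H₂ : SimpleGraph V} (hm : MeetConnected H₁ H₂) {a b : V}
    (hab : H₂.Adj a b) (h₁ : ¬ H₁.Adj a b) (hb : H₂.IsBridge s(a, b)) :
    (H₁ ⊔ H₂).IsBridge s(a, b) := by
  rw [isBridge_iff] at hb ⊢
  intro hr
  apply hb
  set K := H₂.deleteEdges {s(a, b)} with hK
  have hle : H₁ ⊓ H₂ ≤ K := by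
    intro x y hxy
    rw [hK, deleteEdges_adj]
    refine ⟨hxy.2, fun h => h₁ ?_⟩
    have : s(x, y) ∈ H₁.edgeSet := hxy.1
    rw [Set.mem_singleton_iff.1 h] at this
    exact this
  -- Induction along a walk ending at `a`. In `H₁` one keeps track of a common vertex `t`, reachable
  -- from `a`, at which the excursion returns to `H₂`.
  have key : ∀ w z, ((H₁ ⊔ H₂).deleteEdges {s(a, b)}).Walk w z → z = a →
      (w ∈ H₂.support → K.Reachable a w) ∧
      (w ∈ H₁.support → ∃ t ∈ H₁.support, t ∈ H₂.support ∧ K.Reachable a t) := by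
    intro w z p
    induction p with
    | nil =>
      rintro rfl
      exact ⟨fun _ => Reachable.refl _, fun h => ⟨_, h, hab.mem_support_left, Reachable.refl _⟩⟩
    | @cons w w' _ hadj p ih =>
      intro hz
      obtain ⟨ih₁, ih₂⟩ := ih hz
      rw [deleteEdges_adj, sup_adj] at hadj
      obtain ⟨hadj, hne⟩ := hadj
      have step : w ∈ H₂.support → K.Reachable a w := by
        intro hw2
        rcases hadj with hadj | hadj
        · obtain ⟨t, ht₁, ht₂, htr⟩ := ih₂ hadj.mem_support_right
          exact htr.trans ((hm t w ht₁ ht₂ hadj.mem_support_left hw2).mono hle)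
        · refine (ih₁ hadj.mem_support_right).trans (Adj.reachable ?_).symm
          rw [hK, deleteEdges_adj]
          exact ⟨hadj, hne⟩
      refine ⟨step, fun hw1 => ?_⟩
      by_cases hw2 : w ∈ H₂.support
      · exact ⟨w, hw1, hw2, step hw2⟩
      · rcases hadj with hadj | hadj
        · exact ih₂ hadj.mem_support_right
        · exact absurd hadj.mem_support_left hw2
  exact (key b a hr.some.reverse rfl).1 hab.mem_support_right

/-- Every cycle of the union of `H₁` and of an acyclic graph glued to it along a connected graph
lies in `H₁`. -/
lemma edges_subset_of_meetConnected {H₁ H₂ K : SimpleGraph V} (hm : MeetConnected H₁ H₂)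
    (hac : H₂.IsAcyclic) {v : V} {c : K.Walk v v} (hc : c.IsCycle)
    (hcs : ∀ e ∈ c.edges, e ∈ (H₁ ⊔ H₂).edgeSet) : ∀ e ∈ c.edges, e ∈ H₁.edgeSet := by
  intro e he
  by_contra hne
  have hc' := hc.transfer (H := H₁ ⊔ H₂) hcs
  have he' : e ∈ (c.transfer _ hcs).edges := by rwa [Walk.edges_transfer]
  have hes := hcs e he
  induction e with
  | h a b =>
    have h₂ : H₂.Adj a b := by
      rcases hes with h | h
      · exact absurd h hne
      · exact h
    exact (isBridge_sup_of_meetConnected hm h₂ hne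
      (isAcyclic_iff_forall_isBridge.1 hac h₂)).notMem_edges_of_isCycle hc' he'

lemma not_isCycle_of_edges_subset {H K : SimpleGraph V} (hac : H.IsAcyclic) {v : V}
    {c : K.Walk v v} (hcs : ∀ e ∈ c.edges, e ∈ H.edgeSet) : ¬ c.IsCycle :=
  fun hc => hac _ (hc.transfer (H := H) hcs)

lemma IsAcyclic.sup_of_meetConnected {H₁ H₂ : SimpleGraph V} (hm : MeetConnected H₁ H₂)
    (h₁ : H₁.IsAcyclic) (h₂ : H₂.IsAcyclic) : (H₁ ⊔ H₂).IsAcyclic := by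
  intro v c hc
  exact not_isCycle_of_edges_subset h₁
    (edges_subset_of_meetConnected hm h₂ hc fun e he => c.edges_subset_edgeSet he) hc

lemma mem_support_sup {H₁ H₂ : SimpleGraph V} {u : V} :
    u ∈ (H₁ ⊔ H₂).support ↔ u ∈ H₁.support ∨ u ∈ H₂.support := by
  simp only [mem_support, sup_adj, exists_or]

lemma mem_support_biSup {κ : Type*} {S : Set κ} {H : κ → SimpleGraph V} {u : V} :
    u ∈ (⨆ i ∈ S, H i).support ↔ ∃ i ∈ S, u ∈ (H i).support := by
  simp only [mem_support, iSup_adj]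
  constructor
  · rintro ⟨w, i, hi, h⟩
    exact ⟨i, hi, w, h⟩
  · rintro ⟨i, hi, w, h⟩
    exact ⟨w, i, hi, h⟩

/-- Gluing acyclic graphs `H i` to an acyclic graph `H₀`, when the common vertices of `H i` with the
rest are joined in `H₀ ⊓ H i`. -/
lemma isAcyclic_sup_biSup {κ : Type*} {H₀ : SimpleGraph V} {H : κ → SimpleGraph V} {S : Set κ}
    (hS : S.Finite) (h₀ : H₀.IsAcyclic) (h : ∀ i ∈ S, (H i).IsAcyclic)
    (hm : ∀ i ∈ S, ∀ u v, u ∈ (H i).support → v ∈ (H i).support →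
      (u ∈ H₀.support ∨ ∃ j ∈ S, j ≠ i ∧ u ∈ (H j).support) →
      (v ∈ H₀.support ∨ ∃ j ∈ S, j ≠ i ∧ v ∈ (H j).support) → (H₀ ⊓ H i).Reachable u v) :
    (H₀ ⊔ ⨆ i ∈ S, H i).IsAcyclic := by
  classical
  induction S, hS using Set.Finite.induction_on with
  | empty => simpa using h₀
  | @insert i S hi hS ih =>
    have h' := ih (fun j hj => h j (Set.mem_insert_of_mem _ hj)) fun j hj u v hu hv hu' hv' =>
      hm j (Set.mem_insert_of_mem _ hj) u v hu hv
        (hu'.imp_right fun ⟨k, hk, hk'⟩ => ⟨k, Set.mem_insert_of_mem _ hk, hk'⟩)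
        (hv'.imp_right fun ⟨k, hk, hk'⟩ => ⟨k, Set.mem_insert_of_mem _ hk, hk'⟩)
    have e : (H₀ ⊔ ⨆ j ∈ insert i S, H j) = (H₀ ⊔ ⨆ j ∈ S, H j) ⊔ H i := by
      rw [iSup_insert, sup_comm (H i), sup_assoc]
    rw [e]
    refine IsAcyclic.sup_of_meetConnected ?_ h' (h i (Set.mem_insert _ _))
    intro u v hu₁ hu₂ hv₁ hv₂
    have conv : ∀ u, u ∈ (H₀ ⊔ ⨆ j ∈ S, H j).support →
        u ∈ H₀.support ∨ ∃ j ∈ insert i S, j ≠ i ∧ u ∈ (H j).support := by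
      intro u hu
      rw [mem_support_sup, mem_support_biSup] at hu
      exact hu.imp_right fun ⟨j, hj, hj'⟩ =>
        ⟨j, Set.mem_insert_of_mem _ hj, fun e => hi (e ▸ hj), hj'⟩
    exact (hm i (Set.mem_insert _ _) u v hu₂ hv₂ (conv u hu₁) (conv v hv₁)).mono
      (inf_le_inf_right _ le_sup_left)

/-- A disjoint union of acyclic graphs is acyclic. -/
lemma isAcyclic_biSup_of_disjoint {κ : Type*} {H : κ → SimpleGraph V} {S : Set κ}
    (hS : S.Finite) (h : ∀ i ∈ S, (H i).IsAcyclic)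
    (hd : ∀ i ∈ S, ∀ j ∈ S, i ≠ j → ∀ u, u ∈ (H i).support → u ∉ (H j).support) :
    (⨆ i ∈ S, H i).IsAcyclic := by
  have := isAcyclic_sup_biSup (H₀ := ⊥) hS isAcyclic_bot h (by
    intro i hi u v hu _ hu' _
    rcases hu' with hu' | ⟨j, hj, hji, hu'⟩
    · simp at hu'
    · exact absurd hu' (hd i hi j hj hji.symm u hu))
  simpa using this

end Gluing

/-! ### Planarity: interleaving walks between corners of a face meet -/

namespace PlaneGraph

variable {V : Type*} [Fintype V] (G : PlaneGraph V)

lemma face_apply (d : G.graph.Dart) : G.face d = G.rot d.symm := rfl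

lemma rot_fst (d : G.graph.Dart) : (G.rot d).fst = d.fst :=
  ((G.rot_cycle d (G.rot d)).1 ⟨1, by simp⟩).symm

lemma face_fst (d : G.graph.Dart) : (G.face d).fst = d.snd := by
  rw [face_apply, rot_fst]; rfl

/-- The faces of the embedding. -/
abbrev Face := Quotient (Equiv.Perm.SameCycle.setoid (faceStep G.rot))

/-- The face to the left of a dart. -/
def faceOf (d : G.graph.Dart) : G.Face := Quotient.mk _ d

lemma faceOf_face (d : G.graph.Dart) : G.faceOf (G.face d) = G.faceOf d :=
  Quotient.sound (show (faceStep G.rot).SameCycle (G.face d) d from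
    Equiv.Perm.SameCycle.symm ⟨1, by simp [face]⟩)

/-- A chosen orientation of an edge. -/
noncomputable def dartOf (e : G.graph.edgeSet) : G.graph.Dart :=
  (show ∃ d : G.graph.Dart, d.edge = e from by
    obtain ⟨e, he⟩ := e
    induction e with
    | h u v => exact ⟨⟨(u, v), he⟩, rfl⟩).choose

lemma dartOf_edge (e : G.graph.edgeSet) : (G.dartOf e).edge = e :=
  (show ∃ d : G.graph.Dart, d.edge = e from by
    obtain ⟨e, he⟩ := e
    induction e with
    | h u v => exact ⟨⟨(u, v), he⟩, rfl⟩).choose_spec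

lemma dartOf_eq_or (d : G.graph.Dart) :
    G.dartOf ⟨d.edge, d.edge_mem⟩ = d ∨ G.dartOf ⟨d.edge, d.edge_mem⟩ = d.symm :=
  dart_edge_eq_iff _ _ |>.1 (G.dartOf_edge ⟨d.edge, d.edge_mem⟩)

/-- A symmetric function of the darts sums over the darts to twice its sum over the edges. -/
lemma sum_dart {K : Type*} [AddCommMonoid K] [Fintype G.graph.Dart] [Fintype G.graph.edgeSet]
    (h : G.graph.Dart → K) :
    ∑ d, h d = ∑ e : G.graph.edgeSet, (h (G.dartOf e) + h (G.dartOf e).symm) := by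
  classical
  rw [← Finset.sum_fiberwise (s := Finset.univ)
    (g := fun d : G.graph.Dart => (⟨d.edge, d.edge_mem⟩ : G.graph.edgeSet))]
  refine Finset.sum_congr rfl fun e _ => ?_
  have : (Finset.univ.filter fun d : G.graph.Dart =>
      (⟨d.edge, d.edge_mem⟩ : G.graph.edgeSet) = e) = {G.dartOf e, (G.dartOf e).symm} := by
    ext d
    simp only [Finset.mem_filter, Finset.mem_univ, true_and, Finset.mem_insert,
      Finset.mem_singleton, Subtype.ext_iff]
    rw [← G.dartOf_edge e, dart_edge_eq_iff]
  rw [this, Finset.sum_pair (Dart.symm_ne _).symm]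

open Classical in
/-- The incidence matrix modulo `2`. -/
noncomputable def incidence : Matrix G.graph.edgeSet V (ZMod 2) := fun e v =>
  (if v = (G.dartOf e).fst then 1 else 0) + (if v = (G.dartOf e).snd then 1 else 0)

lemma incidence_mulVec (g : V → ZMod 2) (e : G.graph.edgeSet) :
    (G.incidence.mulVec g) e = g (G.dartOf e).fst + g (G.dartOf e).snd := by
  classical
  simp [Matrix.mulVec, dotProduct, incidence, add_mul, Finset.sum_add_distrib]

/-- The boundary of a sum of faces modulo `2`. -/
noncomputable def faceBoundary : (G.Face → ZMod 2) →ₗ[ZMod 2] (G.graph.edgeSet → ZMod 2) where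
  toFun D e := D (G.faceOf (G.dartOf e)) + D (G.faceOf (G.dartOf e).symm)
  map_add' D D' := by ext e; simp only [Pi.add_apply]; ring
  map_smul' c D := by ext e; simp [mul_add]

lemma faceBoundary_apply_edge (D : G.Face → ZMod 2) (d : G.graph.Dart) :
    G.faceBoundary D ⟨d.edge, d.edge_mem⟩ = D (G.faceOf d) + D (G.faceOf d.symm) := by
  change D (G.faceOf (G.dartOf _)) + D (G.faceOf (G.dartOf _).symm) = _
  rcases G.dartOf_eq_or d with h | h
  · rw [h]
  · rw [h, Dart.symm_symm, add_comm]

/-- Pairing with a coboundary gives a sum over darts. The face permutation carries the head of a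
dart to the tail of the next dart of the same face, so the two halves of the sum agree and cancel
modulo `2`. -/
lemma faceBoundary_mem_ker [Fintype G.graph.edgeSet] (D : G.Face → ZMod 2) :
    G.incidence.transpose.mulVec (G.faceBoundary D) = 0 := by
  classical
  have key : ∀ g : V → ZMod 2, ∑ e, G.faceBoundary D e * (G.incidence.mulVec g) e = 0 := by
    intro g
    have h₁ : ∑ d : G.graph.Dart, D (G.faceOf d) * (g d.fst + g d.snd) =
        ∑ e, G.faceBoundary D e * (G.incidence.mulVec g) e := by
      rw [G.sum_dart]
      refine Finset.sum_congr rfl fun e _ => ?_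
      rw [incidence_mulVec]
      change _ = (D (G.faceOf (G.dartOf e)) + D (G.faceOf (G.dartOf e).symm)) * _
      simp only [Dart.symm_toProd, Prod.fst_swap, Prod.snd_swap]
      ring
    rw [← h₁]
    simp only [mul_add, Finset.sum_add_distrib]
    have h₂ : ∑ d : G.graph.Dart, D (G.faceOf d) * g d.snd =
        ∑ d : G.graph.Dart, D (G.faceOf d) * g d.fst := by
      rw [← Equiv.sum_comp G.face fun d => D (G.faceOf d) * g d.fst]
      refine Finset.sum_congr rfl fun d _ => ?_
      rw [face_fst, faceOf_face]
    rw [h₂]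
    exact CharTwo.add_self_eq_zero _
  ext v
  rw [Pi.zero_apply, ← key (Pi.single v 1)]
  refine Finset.sum_congr rfl fun e _ => ?_
  rw [mul_comm]
  congr 1
  simp

lemma eq_of_incidence_mulVec_eq_zero {g : V → ZMod 2} (hg : G.incidence.mulVec g = 0) {u v : V}
    (h : G.graph.Reachable u v) : g u = g v := by
  obtain ⟨p⟩ := h
  induction p with
  | nil => rfl
  | @cons u w _ hadj p ih =>
    rw [← ih]
    have h₁ := congrFun hg ⟨s(u, w), hadj⟩
    rw [incidence_mulVec, Pi.zero_apply] at h₁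
    have h₁ := CharTwo.add_eq_zero.1 h₁
    rcases G.dartOf_eq_or ⟨(u, w), hadj⟩ with h | h
    · change G.dartOf ⟨s(u, w), hadj⟩ = _ at h
      rw [h] at h₁; exact h₁
    · change G.dartOf ⟨s(u, w), hadj⟩ = _ at h
      rw [h] at h₁; exact h₁.symm

/-- Elements of the kernel are constant on components, so one representative of each component
determines them. -/
lemma finrank_ker_incidence_le :
    Module.finrank (ZMod 2) (LinearMap.ker G.incidence.mulVecLin) ≤
      Nat.card G.graph.ConnectedComponent := by
  classical
  have := Fintype.ofFinite G.graph.ConnectedComponent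
  rw [Nat.card_eq_fintype_card, ← Module.finrank_fintype_fun_eq_card (ZMod 2)]
  let ψ : (LinearMap.ker G.incidence.mulVecLin) →ₗ[ZMod 2]
      (G.graph.ConnectedComponent → ZMod 2) :=
    { toFun := fun g c => (g : V → ZMod 2) c.out
      map_add' := fun _ _ => rfl
      map_smul' := fun _ _ => rfl }
  refine LinearMap.finrank_le_finrank_of_injective (f := ψ) fun g g' h => ?_
  ext v
  have h' := congrFun h (G.graph.connectedComponentMk v)
  have hr : G.graph.Reachable (G.graph.connectedComponentMk v).out v :=
    ConnectedComponent.exact (Quot.out_eq _)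
  have e₁ := G.eq_of_incidence_mulVec_eq_zero g.2 hr
  have e₂ := G.eq_of_incidence_mulVec_eq_zero g'.2 hr
  exact e₁.symm.trans (h'.trans e₂)

/-- Zero boundary means equal values on both sides of every edge. Since `rot d` is the face
successor of `d.symm`, the value is also constant around each vertex, hence on a component. -/
lemma eq_of_faceBoundary_eq_zero {D : G.Face → ZMod 2} (hD : G.faceBoundary D = 0)
    {u v : V} (h : G.graph.Reachable u v) :
    ∀ d d' : G.graph.Dart, d.fst = u → d'.fst = v → D (G.faceOf d) = D (G.faceOf d') := by
  classical
  have hsymm : ∀ d : G.graph.Dart, D (G.faceOf d) = D (G.faceOf d.symm) := fun d => by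
    have := congrFun hD ⟨d.edge, d.edge_mem⟩
    rw [faceBoundary_apply_edge] at this
    exact CharTwo.add_eq_zero.1 this
  have hrot : ∀ d : G.graph.Dart, D (G.faceOf (G.rot d)) = D (G.faceOf d) := fun d => by
    rw [hsymm d, ← G.faceOf_face d.symm, face_apply, Dart.symm_symm]
  have hsame : ∀ d d' : G.graph.Dart, d.fst = d'.fst → D (G.faceOf d) = D (G.faceOf d') := by
    intro d d' h
    obtain ⟨i, -, -, rfl⟩ := ((G.rot_cycle d d').2 h).exists_pow_eq'
    clear h
    induction i with
    | zero => rfl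
    | succ i ih => rw [pow_succ', Equiv.Perm.mul_apply, hrot]; exact ih
  obtain ⟨p⟩ := h
  induction p with
  | nil => exact fun d d' h h' => hsame d d' (h.trans h'.symm)
  | @cons u w _ hadj p ih =>
    intro d d' h h'
    rw [hsame d ⟨(u, w), hadj⟩ h, hsymm]
    exact ih _ d' rfl h'

/-- A component with a dart contributes at most one value of `D`. An isolated vertex has no dart and
leaves its coordinate free, which accounts for the separate term in `euler`. -/
lemma finrank_ker_faceBoundary_add_le :
    Module.finrank (ZMod 2) (LinearMap.ker G.faceBoundary) +
      Nat.card {v : V // ∀ u, ¬ G.graph.Adj v u} ≤ Nat.card G.graph.ConnectedComponent := by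
  classical
  have := Fintype.ofFinite G.graph.ConnectedComponent
  rw [Nat.card_eq_fintype_card, Nat.card_eq_fintype_card,
    ← Module.finrank_fintype_fun_eq_card (ZMod 2), ← Module.finrank_fintype_fun_eq_card (ZMod 2),
    ← Module.finrank_prod]
  let ψ : (LinearMap.ker G.faceBoundary) × ({v : V // ∀ u, ¬ G.graph.Adj v u} → ZMod 2)
      →ₗ[ZMod 2] (G.graph.ConnectedComponent → ZMod 2) :=
    { toFun := fun x c =>
        if h : ∃ d : G.graph.Dart, G.graph.connectedComponentMk d.fst = c
        then (x.1 : G.Face → ZMod 2) (G.faceOf h.choose)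
        else if h' : ∀ u, ¬ G.graph.Adj c.out u then x.2 ⟨c.out, h'⟩ else 0
      map_add' := fun x y => by
        ext c
        dsimp only [Pi.add_apply]
        split_ifs <;> simp
      map_smul' := fun r x => by
        ext c
        dsimp only [Pi.smul_apply]
        split_ifs <;> simp }
  refine LinearMap.finrank_le_finrank_of_injective (f := ψ) ?_
  rw [← LinearMap.ker_eq_bot, LinearMap.ker_eq_bot']
  rintro ⟨⟨D, hD⟩, h⟩ h0
  have h0' : ∀ c, ψ (⟨D, hD⟩, h) c = 0 := fun c => congrFun h0 c
  have e₁ : D = 0 := by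
    ext f
    induction f using Quotient.inductionOn with
    | h d =>
      have hex : ∃ d' : G.graph.Dart, G.graph.connectedComponentMk d'.fst =
        G.graph.connectedComponentMk d.fst := ⟨d, rfl⟩
      have := h0' (G.graph.connectedComponentMk d.fst)
      change (if h : ∃ d' : G.graph.Dart, G.graph.connectedComponentMk d'.fst =
        G.graph.connectedComponentMk d.fst then D (G.faceOf h.choose) else _) = 0 at this
      rw [dif_pos hex] at this
      rw [Pi.zero_apply, ← this]
      exact G.eq_of_faceBoundary_eq_zero hD (ConnectedComponent.exact hex.choose_spec).symm _ _
        rfl rfl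
  have e₂ : h = 0 := by
    ext v
    obtain ⟨v, hv⟩ := v
    have hout : ∀ w, G.graph.Reachable w v → w = v := by
      rintro w ⟨p⟩
      cases hp : p.reverse with
      | nil => rfl
      | cons hadj _ => exact absurd hadj (hv _)
    have hv' : (G.graph.connectedComponentMk v).out = v :=
      hout _ (ConnectedComponent.exact (Quot.out_eq _))
    have hex : ¬ ∃ d' : G.graph.Dart, G.graph.connectedComponentMk d'.fst =
        G.graph.connectedComponentMk v := by
      rintro ⟨d, hd⟩
      have := hout _ (ConnectedComponent.exact hd)
      exact hv d.snd (this ▸ d.adj)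
    have := h0' (G.graph.connectedComponentMk v)
    change (if hd : ∃ d' : G.graph.Dart, G.graph.connectedComponentMk d'.fst =
        G.graph.connectedComponentMk v then D (G.faceOf hd.choose) else
        if h' : ∀ u, ¬ G.graph.Adj (G.graph.connectedComponentMk v).out u
        then h ⟨(G.graph.connectedComponentMk v).out, h'⟩ else 0) = 0 at this
    have hiso : ∀ u, ¬ G.graph.Adj (G.graph.connectedComponentMk v).out u := by rwa [hv']
    rw [dif_neg hex, dif_pos hiso] at this
    rw [Pi.zero_apply, ← this]
    congr 1
    exact Subtype.ext hv'.symm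
  subst e₁ e₂
  rfl

/-- The cycle space is spanned by the boundaries of the faces. -/
lemma range_faceBoundary [Fintype G.graph.edgeSet] :
    LinearMap.range G.faceBoundary = LinearMap.ker G.incidence.transpose.mulVecLin := by
  classical
  refine Submodule.eq_of_le_of_finrank_le ?_ ?_
  · rintro _ ⟨D, rfl⟩
    exact G.faceBoundary_mem_ker D
  · have : Fintype G.Face := Fintype.ofFinite _
    -- With `I` isolated vertices and `c` components, the range has dimension at least `F + I - c`
    -- and the cycle space at most `E - V + c`; by Euler's formula the two bounds coincide.
    have h₁ := G.faceBoundary.finrank_range_add_finrank_ker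
    have h₂ := G.incidence.transpose.mulVecLin.finrank_range_add_finrank_ker
    have h₃ := G.incidence.mulVecLin.finrank_range_add_finrank_ker
    have h₄ := G.finrank_ker_incidence_le
    have h₅ := G.finrank_ker_faceBoundary_add_le
    have h₆ := Matrix.rank_transpose G.incidence
    have h₇ := G.euler
    simp only [Matrix.rank] at h₆
    rw [Module.finrank_fintype_fun_eq_card] at h₁ h₂ h₃
    rw [Nat.card_eq_fintype_card (α := V), Nat.card_eq_fintype_card (α := G.graph.edgeSet),
      Nat.card_eq_fintype_card (α := Quotient (Equiv.Perm.SameCycle.setoid (faceStep G.rot)))] at h₇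
    change Fintype.card V + (Fintype.card G.Face + _) = _ at h₇
    omega

end PlaneGraph

/-! ### Face colourings modulo `2` and interleaving walks -/

namespace PlaneGraph

variable {V : Type*} [Fintype V] (G : PlaneGraph V)

lemma incidence_mulVec_edge (g : V → ZMod 2) (d : G.graph.Dart) :
    (G.incidence.mulVec g) ⟨d.edge, d.edge_mem⟩ = g d.fst + g d.snd := by
  rw [incidence_mulVec]
  rcases G.dartOf_eq_or d with h | h
  · rw [h]
  · rw [h, Dart.symm_toProd, Prod.fst_swap, Prod.snd_swap, add_comm]

open Classical in
lemma sum_ite_edge_mul [Fintype G.graph.edgeSet] (g : V → ZMod 2) (d : G.graph.Dart) :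
    ∑ e : G.graph.edgeSet, (if d.edge = e then 1 else 0) * (G.incidence.mulVec g) e =
      g d.fst + g d.snd := by
  rw [← G.incidence_mulVec_edge g d, Finset.sum_eq_single ⟨d.edge, d.edge_mem⟩]
  · simp
  · intro e _ he
    rw [if_neg fun h => he (Subtype.ext h.symm), zero_mul]
  · simp

-- Telescoping: the boundary modulo `2` of a walk is the sum of its two ends.
open Classical in
lemma sum_count_edges_mul [Fintype G.graph.edgeSet] (g : V → ZMod 2) {u v : V}
    (p : G.graph.Walk u v) :
    ∑ e : G.graph.edgeSet, (p.edges.count (e : Sym2 V) : ZMod 2) * (G.incidence.mulVec g) e =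
      g u + g v := by
  induction p with
  | nil => simp [CharTwo.add_self_eq_zero]
  | @cons u w v hadj p ih =>
    have : ∀ e : G.graph.edgeSet, ((Walk.cons hadj p).edges.count (e : Sym2 V) : ZMod 2) =
        p.edges.count (e : Sym2 V) +
          if (⟨(u, w), hadj⟩ : G.graph.Dart).edge = e then 1 else 0 := by
      intro e
      rw [Walk.edges_cons, List.count_cons]
      push_cast
      congr 1
      simp only [beq_iff_eq]
      rfl
    simp only [this, add_mul, Finset.sum_add_distrib, ih, sum_ite_edge_mul]
    rw [add_comm (g w), add_add_add_comm, add_comm (g v)]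
    linear_combination CharTwo.add_self_eq_zero (g w)

/-- A chain modulo `2` without boundary is the boundary of a face-invariant function of the darts. -/
lemma exists_face_coloring [Fintype G.graph.edgeSet] (C : Sym2 V → ZMod 2)
    (hC : ∀ g : V → ZMod 2,
      ∑ e : G.graph.edgeSet, C (e : Sym2 V) * (G.incidence.mulVec g) e = 0) :
    ∃ D : G.graph.Dart → ZMod 2, (∀ d, D (G.face d) = D d) ∧
      ∀ d, D d + D d.symm = C d.edge := by
  classical
  have hmem : (fun e : G.graph.edgeSet => C e) ∈ LinearMap.range G.faceBoundary := by
    rw [range_faceBoundary, LinearMap.mem_ker]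
    ext v
    rw [Pi.zero_apply, ← hC (Pi.single v 1), Matrix.mulVecLin_apply]
    refine Finset.sum_congr rfl fun e _ => ?_
    rw [mul_comm]
    congr 1
    simp
  obtain ⟨D, hD⟩ := hmem
  refine ⟨fun d => D (G.faceOf d), fun d => congrArg D (G.faceOf_face d), fun d => ?_⟩
  rw [← faceBoundary_apply_edge, hD]

lemma corner_succ (e : G.graph.Dart) (k : ℕ) : G.corner e (k + 1) = ((G.face)^[k] e).snd := by
  rw [corner, Function.iterate_succ_apply', face_fst]

lemma iterate_face_injOn (e : G.graph.Dart) :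
    Set.InjOn (fun t => (G.face)^[t] e) (Set.Iio (G.faceLength e)) :=
  Function.iterate_injOn_Iio_minimalPeriod

/-- Walks joining interleaving pairs of corners of a face have a common vertex. -/
theorem walks_meet (e : G.graph.Dart) {i j k l : ℕ} (hi : 1 ≤ i) (hij : i ≤ j) (hjk : j ≤ k)
    (hkl : k ≤ l) (hl : l ≤ G.faceLength e) (A : G.graph.Walk (G.corner e i) (G.corner e k))
    (B : G.graph.Walk (G.corner e j) (G.corner e l)) : ∃ z, z ∈ A.support ∧ z ∈ B.support := by
  classical
  by_contra! hcon
  have hij : i < j := hij.lt_of_ne fun h => hcon _ A.start_mem_support (h ▸ B.start_mem_support)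
  have hjk : j < k := hjk.lt_of_ne fun h => hcon _ A.end_mem_support (h ▸ B.start_mem_support)
  have hkl : k < l := hkl.lt_of_ne fun h => hcon _ A.end_mem_support (h ▸ B.end_mem_support)
  set E : ℕ → G.graph.Dart := fun t => (G.face)^[t] e with hE
  have hE1 : ∀ t, G.face (E t) = E (t + 1) := fun t =>
    (Function.iterate_succ_apply' G.face t e).symm
  have tele : ∀ (g : V → ZMod 2) (k : ℕ), i ≤ k →
      ∑ t ∈ Finset.Ico i k, (g (E t).fst + g (E t).snd) =
        g (G.corner e i) + g (G.corner e k) := by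
    intro g k hk
    induction k, hk using Nat.le_induction with
    | base => simp [CharTwo.add_self_eq_zero]
    | succ k hk ih =>
      rw [Finset.sum_Ico_succ_top hk, ih, corner_succ]
      change g _ + g (E k).fst + (g (E k).fst + g (E k).snd) = _ + g (E k).snd
      linear_combination CharTwo.add_self_eq_zero (g (E k).fst)
  -- `A` and the arc `[i, k)` of the face have the same ends, so their sum is a cycle and bounds a
  -- two-colouring `D` of the faces.
  obtain ⟨D, hD, hDC⟩ := G.exists_face_coloring
    (fun x => (A.edges.count x : ZMod 2) +
      ∑ t ∈ Finset.Ico i k, if (E t).edge = x then 1 else 0) (by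
    intro g
    simp only [add_mul, Finset.sum_add_distrib, sum_count_edges_mul, Finset.sum_mul]
    rw [Finset.sum_comm]
    simp only [sum_ite_edge_mul]
    rw [tele g k (by omega)]
    exact CharTwo.add_self_eq_zero _)
  -- `S` marks the darts of the arc. Adding it to `D` cancels the colour change across the edges of
  -- the arc, so that `D + S` can change only at vertices of `A`.
  set S : G.graph.Dart → ZMod 2 := fun d => ∑ t ∈ Finset.Ico i k, if E t = d then 1 else 0 with hS
  have hSS : ∀ d : G.graph.Dart, S d + S d.symm =
      ∑ t ∈ Finset.Ico i k, if (E t).edge = d.edge then (1 : ZMod 2) else 0 := by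
    intro d
    rw [hS, ← Finset.sum_add_distrib]
    refine Finset.sum_congr rfl fun t _ => ?_
    simp only [dart_edge_eq_iff]
    by_cases h₁ : E t = d
    · have h₂ : E t ≠ d.symm := fun h => d.symm_ne (h.symm.trans h₁)
      simp [h₁, d.symm_ne.symm]
    · simp [h₁]
  -- Along a face, `S` jumps only on entering the arc at `E i` and on leaving it at `E k`; the tails
  -- of these darts are the ends of `A`.
  have hSface : ∀ d, G.face d ≠ E i → G.face d ≠ E k → S (G.face d) = S d := by
    intro d hdi hdk
    obtain ⟨i, rfl⟩ : ∃ i', i = i' + 1 := ⟨i - 1, by omega⟩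
    obtain ⟨k, rfl⟩ : ∃ k', k = k' + 1 := ⟨k - 1, by omega⟩
    have h₁ : S (G.face d) = ∑ t ∈ Finset.Ico i k, if E t = d then 1 else 0 := by
      rw [hS]
      simp only
      rw [← Finset.sum_Ico_add' _ i k 1]
      refine Finset.sum_congr rfl fun t _ => ?_
      simp only [← hE1, G.face.injective.eq_iff]
    rw [← hE1, G.face.injective.ne_iff] at hdi hdk
    rw [h₁, hS, Finset.sum_eq_sum_Ico_succ_bot (by omega), if_neg hdi.symm, zero_add]
    simp only
    rw [Finset.sum_Ico_succ_top (by omega), if_neg hdk.symm, add_zero]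
  set D' : G.graph.Dart → ZMod 2 := fun d => D d + S d with hD'
  have hsymm : ∀ d : G.graph.Dart, d.fst ∉ A.support → D' d.symm = D' d := by
    intro d hd
    have h₁ := hDC d
    have h₂ := hSS d
    have h₃ : A.edges.count d.edge = 0 := by
      rw [List.count_eq_zero]
      exact fun h => hd (A.fst_mem_support_of_mem_edges h)
    simp only [h₃, Nat.cast_zero, zero_add, ← h₂] at h₁
    have h₄ : D' d + D' d.symm = 0 := by
      change D d + S d + (D d.symm + S d.symm) = 0
      rw [add_add_add_comm, h₁]
      exact CharTwo.add_self_eq_zero _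
    exact (CharTwo.add_eq_zero.1 h₄).symm
  have hrot : ∀ d : G.graph.Dart, d.fst ∉ A.support → D' (G.rot d) = D' d := by
    intro d hd
    rw [← hsymm d hd]
    have h₁ : G.rot d = G.face d.symm := by rw [face_apply, Dart.symm_symm]
    have hne : ∀ t, (E t).fst ∈ A.support → G.face d.symm ≠ E t := by
      intro t ht h
      rw [← h, ← h₁, rot_fst] at ht
      exact hd ht
    change D _ + S _ = D _ + S _
    rw [h₁, hD, hSface _ (hne i A.start_mem_support) (hne k A.end_mem_support)]
  have hsame : ∀ d d' : G.graph.Dart, d.fst ∉ A.support → d.fst = d'.fst → D' d = D' d' := by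
    intro d d' hd h
    obtain ⟨n, -, -, rfl⟩ := ((G.rot_cycle d d').2 h).exists_pow_eq'
    clear h
    have hf : ∀ n : ℕ, ((G.rot ^ n) d).fst = d.fst := by
      intro n
      induction n with
      | zero => rfl
      | succ n ih => rw [pow_succ', Equiv.Perm.mul_apply, rot_fst, ih]
    induction n with
    | zero => rfl
    | succ n ih =>
      rw [pow_succ', Equiv.Perm.mul_apply, hrot _ (by rwa [hf]), ← ih]
  have hwalk : ∀ {u v : V} (p : G.graph.Walk u v), (∀ z ∈ p.support, z ∉ A.support) →
      ∀ d d' : G.graph.Dart, d.fst = u → d'.fst = v → D' d = D' d' := by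
    intro u v p
    induction p with
    | nil =>
      intro hp d d' h h'
      exact hsame d d' (h ▸ hp _ (by simp)) (h.trans h'.symm)
    | @cons u w _ hadj p ih =>
      intro hp d d' h h'
      have hu : u ∉ A.support := hp u (by simp)
      rw [hsame d ⟨(u, w), hadj⟩ (h ▸ hu) h, ← hsymm _ hu]
      exact ih (fun z hz => hp z (by simp [hz])) _ d' rfl h'
  -- `B` avoids `A`, so `D'` agrees at both ends of `B`. But `D` is constant along the face, while
  -- `S` is `1` at `E j` and `0` at `E l`.
  have hfin := hwalk B (fun z hz hz' => hcon z hz' hz) (E j) (E l) rfl rfl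
  have hDE : ∀ t, D (E t) = D e := by
    intro t
    induction t with
    | zero => rfl
    | succ t ih => rw [← hE1, hD, ih]
  have hinj := G.iterate_face_injOn e
  have hSj : S (E j) = 1 := by
    rw [hS]
    simp only
    rw [Finset.sum_eq_single j]
    · simp
    · intro t ht htj
      rw [Finset.mem_Ico] at ht
      exact if_neg fun h => htj (hinj (Set.mem_Iio.2 (by omega)) (Set.mem_Iio.2 (by omega)) h)
    · intro h
      exact absurd (Finset.mem_Ico.2 ⟨by omega, by omega⟩) h
  have hSl : S (E l) = 0 := by
    refine Finset.sum_eq_zero fun t ht => if_neg fun h => ?_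
    rw [Finset.mem_Ico] at ht
    rcases hl.lt_or_eq with hl | hl
    · have := hinj (Set.mem_Iio.2 (by omega)) (Set.mem_Iio.2 hl) h
      omega
    -- If `l` is the length of the face, the numbering wraps around to `E 0`, which is outside the
    -- arc because `1 ≤ i`.
    · have h0 : E l = E 0 := by
        rw [hl]
        exact Function.iterate_minimalPeriod
      rw [h0] at h
      have := hinj (Set.mem_Iio.2 (by omega)) (Set.mem_Iio.2 (by omega)) h
      omega
  change D _ + S _ = D _ + S _ at hfin
  rw [hDE, hDE, hSj, hSl] at hfin
  exact one_ne_zero (add_left_cancel hfin)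

end PlaneGraph

/-! ### Systems of single-touch chords -/

/-- The part of a path `f` between the indices `lo` and `hi`. -/
def segGraph {V : Type*} (f : ℕ → V) (lo hi : ℕ) : SimpleGraph V where
  Adj u v := u ≠ v ∧ ∃ k, lo ≤ k ∧ k < hi ∧ s(u, v) = s(f k, f (k + 1))
  symm := ⟨fun u v h => ⟨h.1.symm, by simpa only [Sym2.eq_swap (a := v)] using h.2⟩⟩
  loopless := ⟨fun _ h => h.1 rfl⟩

/-- `u` and `v` are joined by a walk of `G` with vertices in `S`. -/
def WalkJoined {V : Type*} (G : SimpleGraph V) (S : Set V) (u v : V) : Prop :=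
  ∃ p : G.Walk u v, ∀ z ∈ p.support, z ∈ S

namespace WalkJoined

variable {V : Type*} {G : SimpleGraph V} {S T : Set V} {u v w : V}

lemma mono (h : WalkJoined G S u v) (hST : S ⊆ T) : WalkJoined G T u v :=
  h.imp fun _ hp z hz => hST (hp z hz)

lemma symm (h : WalkJoined G S u v) : WalkJoined G S v u := by
  obtain ⟨p, hp⟩ := h
  exact ⟨p.reverse, fun z hz => hp z (by simpa using hz)⟩

lemma trans (h : WalkJoined G S u v) (h' : WalkJoined G S v w) : WalkJoined G S u w := by
  obtain ⟨p, hp⟩ := h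
  obtain ⟨q, hq⟩ := h'
  exact ⟨p.append q, fun z hz => ((Walk.mem_support_append_iff p q).1 hz).elim (hp z) (hq z)⟩

lemma union (h : WalkJoined G S u v) (h' : WalkJoined G T v w) : WalkJoined G (S ∪ T) u w :=
  (h.mono Set.subset_union_left).trans (h'.mono Set.subset_union_right)

lemma refl (hu : u ∈ S) : WalkJoined G S u u := ⟨Walk.nil, fun z hz => by simp_all⟩

lemma of_adj (h : G.Adj u v) (hu : u ∈ S) (hv : v ∈ S) : WalkJoined G S u v :=
  ⟨Walk.cons h Walk.nil, fun z hz => by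
    simp only [Walk.support_cons, Walk.support_nil, List.mem_cons, List.not_mem_nil, or_false] at hz
    rcases hz with rfl | rfl <;> assumption⟩

end WalkJoined

/-- A family of paths `f i 0, …, f i (n i)` of `G`, with ends at the positions `a i < b i` of a line.
The arcs `[a i, b i]` are laminar, walks between interleaving ends meet, and any two paths meet in a
connected graph. -/
structure ChordSystem {V : Type*} (G : SimpleGraph V) (ι : Type*) where
  n : ι → ℕ
  f : ι → ℕ → V
  a : ι → ℤ
  b : ι → ℤ
  pos : ∀ i, 0 < n i
  adj : ∀ i k, k < n i → G.Adj (f i k) (f i (k + 1))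
  inj : ∀ i k l, k ≤ n i → l ≤ n i → f i k = f i l → k = l
  lt : ∀ i, a i < b i
  laminar : ∀ i j, (a j ≤ a i ∧ b i ≤ b j) ∨ (a i ≤ a j ∧ b j ≤ b i) ∨ b i ≤ a j ∨ b j ≤ a i
  ext : ∀ i j, a i = a j → b i = b j → i = j
  link : ∀ (i j k l : ι) (p q r s : Bool), cond p (b i) (a i) ≤ cond q (b j) (a j) →
    cond q (b j) (a j) ≤ cond r (b k) (a k) → cond r (b k) (a k) ≤ cond s (b l) (a l) →
    ∀ (A : G.Walk (cond p (f i (n i)) (f i 0)) (cond r (f k (n k)) (f k 0)))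
      (B : G.Walk (cond q (f j (n j)) (f j 0)) (cond s (f l (n l)) (f l 0))),
      ∃ z, z ∈ A.support ∧ z ∈ B.support
  touch : ∀ (i j : ι) (k k' l l' : ℕ), k ≤ n i → k' ≤ n j → l ≤ n i → l' ≤ n j →
    f i k = f j k' → f i l = f j l' →
    (segGraph (f i) 0 (n i) ⊓ segGraph (f j) 0 (n j)).Reachable (f i k) (f i l)

namespace ChordSystem

variable {V ι : Type*} {G : SimpleGraph V} (C : ChordSystem G ι)

/-- The vertices of the path `i`. -/
def vs (i : ι) : Set V := {v | ∃ k ≤ C.n i, C.f i k = v}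

/-- The part of the path `i` between two indices. -/
def seg (i : ι) (lo hi : ℕ) : SimpleGraph V := segGraph (C.f i) lo hi

/-- The path `i` as a graph. -/
def pg (i : ι) : SimpleGraph V := C.seg i 0 (C.n i)

/-- An end of the path `i`. -/
def endVert (i : ι) (s : Bool) : V := cond s (C.f i (C.n i)) (C.f i 0)

/-- The position of an end of the path `i`. -/
def endPos (i : ι) (s : Bool) : ℤ := cond s (C.b i) (C.a i)

/-- The vertices of the path `i` from the index `k` to one of the ends. -/
def tail (i : ι) (k : ℕ) (s : Bool) : Set V :=
  {v | ∃ t ≤ C.n i, (cond s (k ≤ t) (t ≤ k) : Prop) ∧ C.f i t = v}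

variable {C}

lemma f_mem {i : ι} {k : ℕ} (hk : k ≤ C.n i) : C.f i k ∈ C.vs i := ⟨k, hk, rfl⟩

lemma seg_mono {i : ι} {lo hi lo' hi' : ℕ} (h : lo' ≤ lo) (h' : hi ≤ hi') :
    C.seg i lo hi ≤ C.seg i lo' hi' := by
  rintro u v ⟨hne, k, hk, hk', e⟩
  exact ⟨hne, k, h.trans hk, hk'.trans_le h', e⟩

lemma seg_adj {i : ι} {lo hi k : ℕ} (h : lo ≤ k) (h' : k < hi) (hn : hi ≤ C.n i) :
    (C.seg i lo hi).Adj (C.f i k) (C.f i (k + 1)) :=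
  ⟨(C.adj i k (by omega)).ne, k, h, h', rfl⟩

lemma pg_adj {i : ι} {k : ℕ} (h : k < C.n i) : (C.pg i).Adj (C.f i k) (C.f i (k + 1)) :=
  seg_adj (Nat.zero_le _) h le_rfl

lemma exists_of_adj {i : ι} {lo hi : ℕ} {u v : V} (h : (C.seg i lo hi).Adj u v) :
    ∃ k, lo ≤ k ∧ k < hi ∧ ((u = C.f i k ∧ v = C.f i (k + 1)) ∨
      (u = C.f i (k + 1) ∧ v = C.f i k)) := by
  obtain ⟨-, k, h₁, h₂, e⟩ := h
  exact ⟨k, h₁, h₂, by simpa using e⟩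

lemma exists_of_mem_support {i : ι} {lo hi : ℕ} {v : V} (h : v ∈ (C.seg i lo hi).support) :
    ∃ k, lo ≤ k ∧ k ≤ hi ∧ C.f i k = v := by
  obtain ⟨w, hw⟩ := h
  obtain ⟨k, h₁, h₂, ⟨rfl, -⟩ | ⟨rfl, -⟩⟩ := exists_of_adj hw
  · exact ⟨k, h₁, h₂.le, rfl⟩
  · exact ⟨k + 1, by omega, by omega, rfl⟩

lemma support_pg (i : ι) : (C.pg i).support = C.vs i := by
  ext v
  constructor
  · intro h
    obtain ⟨k, -, hk, rfl⟩ := exists_of_mem_support h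
    exact f_mem hk
  · rintro ⟨k, hk, rfl⟩
    rcases hk.lt_or_eq with hk | rfl
    · exact (pg_adj hk).mem_support_left
    · obtain ⟨m, hm⟩ : ∃ m, C.n i = m + 1 := ⟨C.n i - 1, by have := C.pos i; omega⟩
      have := pg_adj (C := C) (i := i) (k := m) (by omega)
      rw [hm]
      exact this.mem_support_right

lemma mem_vs_of_adj {i : ι} {u v : V} (h : (C.pg i).Adj u v) : u ∈ C.vs i ∧ v ∈ C.vs i := by
  rw [← support_pg]
  exact ⟨h.mem_support_left, h.mem_support_right⟩

lemma seg_reachable {i : ι} {lo hi k l : ℕ} (hk : lo ≤ k) (hkl : k ≤ l) (hl : l ≤ hi)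
    (hn : hi ≤ C.n i) : (C.seg i lo hi).Reachable (C.f i k) (C.f i l) := by
  induction l, hkl using Nat.le_induction with
  | base => exact Reachable.refl _
  | succ l hkl ih => exact (ih (by omega)).trans (seg_adj (by omega) (by omega) hn).reachable

lemma pg_reachable {i : ι} {u v : V} (hu : u ∈ C.vs i) (hv : v ∈ C.vs i) :
    (C.pg i).Reachable u v := by
  obtain ⟨k, hk, rfl⟩ := hu
  obtain ⟨l, hl, rfl⟩ := hv
  exact (seg_reachable (Nat.zero_le _) (Nat.zero_le k) hk le_rfl).symm.trans
    (seg_reachable (Nat.zero_le _) (Nat.zero_le l) hl le_rfl)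

lemma meet_reachable {i j : ι} {u v : V} (hu : u ∈ C.vs i) (hu' : u ∈ C.vs j)
    (hv : v ∈ C.vs i) (hv' : v ∈ C.vs j) : (C.pg i ⊓ C.pg j).Reachable u v := by
  obtain ⟨k, hk, rfl⟩ := hu
  obtain ⟨l, hl, rfl⟩ := hv
  obtain ⟨k', hk', e⟩ := hu'
  obtain ⟨l', hl', e'⟩ := hv'
  exact C.touch i j k k' l l' hk hk' hl hl' e.symm e'.symm

/-- A connected part of a path contains all the edges between any two of its vertices. -/
lemma adj_of_reachable {i : ι} {K : SimpleGraph V} (hK : K ≤ C.pg i) {k l m : ℕ}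
    (hkm : k ≤ m) (hml : m < l) (hl : l ≤ C.n i) (h : K.Reachable (C.f i k) (C.f i l)) :
    K.Adj (C.f i m) (C.f i (m + 1)) := by
  -- A walk in the path changes the index by one at each step, so it must pass from `m` to `m + 1`.
  have key : ∀ {x y : V} (p : K.Walk x y) (k : ℕ), k ≤ m → x = C.f i k → y = C.f i l →
      K.Adj (C.f i m) (C.f i (m + 1)) := by
    intro x y p
    induction p with
    | nil =>
      intro k hk hx hy
      have := C.inj i k l (by omega) hl (hx.symm.trans hy)
      omega
    | @cons x w y hxw p ih =>
      intro k hk hx hy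
      obtain ⟨t, -, ht, ⟨h₁, h₂⟩ | ⟨h₁, h₂⟩⟩ := exists_of_adj (hK hxw)
      · obtain rfl := C.inj i k t (by omega) (by omega) (hx.symm.trans h₁)
        rcases hk.lt_or_eq with hk | rfl
        · exact ih (k + 1) (by omega) h₂ hy
        · rwa [h₁, h₂] at hxw
      · have := C.inj i k (t + 1) (by omega) (by omega) (hx.symm.trans h₁)
        exact ih t (by omega) h₂ hy
  obtain ⟨p⟩ := h
  exact key p k hkm rfl rfl

lemma pg_isAcyclic (i : ι) : (C.pg i).IsAcyclic := by
  rw [isAcyclic_iff_forall_isBridge]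
  intro e he
  induction e with
  | h u v =>
    have key : ∀ k, k < C.n i → (C.pg i).IsBridge s(C.f i k, C.f i (k + 1)) := by
      intro k hk
      rw [isBridge_iff]
      intro hr
      have := adj_of_reachable (deleteEdges_le _) le_rfl (Nat.lt_succ_self k) hk hr
      rw [deleteEdges_adj] at this
      exact this.2 rfl
    obtain ⟨k, -, hk, ⟨rfl, rfl⟩ | ⟨rfl, rfl⟩⟩ := exists_of_adj he
    · exact key k hk
    · rw [Sym2.eq_swap]; exact key k hk

lemma seg_isAcyclic {i : ι} {lo hi : ℕ} (h : hi ≤ C.n i) : (C.seg i lo hi).IsAcyclic :=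
  (pg_isAcyclic i).anti (seg_mono (Nat.zero_le _) h)

/-- By single touch the intersection is connected, so it contains the whole part of `i` between two
common vertices. The convexity statements that follow rest on this. -/
lemma convex_adj {i j : ι} {k l m : ℕ} (hk : C.f i k ∈ C.vs j) (hl : C.f i l ∈ C.vs j)
    (hkm : k ≤ m) (hml : m < l) (hln : l ≤ C.n i) : (C.pg j).Adj (C.f i m) (C.f i (m + 1)) :=
  (adj_of_reachable inf_le_left hkm hml hln
    (meet_reachable (f_mem (by omega)) hk (f_mem hln) hl)).2

lemma seg_le_pg {i j : ι} {k l : ℕ} (hk : C.f i k ∈ C.vs j) (hl : C.f i l ∈ C.vs j)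
    (hln : l ≤ C.n i) : C.seg i k l ≤ C.pg j := by
  intro u v h
  obtain ⟨m, h₁, h₂, ⟨rfl, rfl⟩ | ⟨rfl, rfl⟩⟩ := exists_of_adj h
  · exact convex_adj hk hl h₁ h₂ hln
  · exact (convex_adj hk hl h₁ h₂ hln).symm

lemma convex {i j : ι} {k l m : ℕ} (hk : C.f i k ∈ C.vs j) (hl : C.f i l ∈ C.vs j)
    (hkm : k ≤ m) (hml : m ≤ l) (hln : l ≤ C.n i) : C.f i m ∈ C.vs j := by
  rcases hml.lt_or_eq with hml | rfl
  · exact (mem_vs_of_adj (convex_adj hk hl hkm hml hln)).1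
  · exact hl

lemma adj_of_mem {i j : ι} {u v : V} (h : (C.pg i).Adj u v) (hu : u ∈ C.vs j) (hv : v ∈ C.vs j) :
    (C.pg j).Adj u v := by
  obtain ⟨m, -, h₂, ⟨rfl, rfl⟩ | ⟨rfl, rfl⟩⟩ := exists_of_adj h
  · exact convex_adj hu hv le_rfl (Nat.lt_succ_self m) h₂
  · exact (convex_adj hv hu le_rfl (Nat.lt_succ_self m) h₂).symm

/-- A vertex of a path between two common vertices with another path is also between them there. -/
lemma between {i j : ι} {k l m k' l' : ℕ} (hkm : k ≤ m) (hml : m ≤ l) (hl : l ≤ C.n i)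
    (hk' : k' ≤ C.n j) (hl' : l' ≤ C.n j) (ek : C.f i k = C.f j k') (el : C.f i l = C.f j l') :
    ∃ m', min k' l' ≤ m' ∧ m' ≤ max k' l' ∧ C.f i m = C.f j m' := by
  rcases hml.lt_or_eq with hml | rfl
  · have hk : C.f j k' ∈ C.vs i := ek ▸ f_mem (by omega)
    have hl₀ : C.f j l' ∈ C.vs i := el ▸ f_mem hl
    have hle : C.seg j (min k' l') (max k' l') ≤ C.pg i := by
      rcases le_total k' l' with h | h
      · rw [min_eq_left h, max_eq_right h]; exact seg_le_pg hk hl₀ hl'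
      · rw [min_eq_right h, max_eq_left h]; exact seg_le_pg hl₀ hk hk'
    have hr : (C.seg j (min k' l') (max k' l')).Reachable (C.f i k) (C.f i l) := by
      rw [ek, el]
      rcases le_total k' l' with h | h
      · rw [min_eq_left h, max_eq_right h]; exact seg_reachable le_rfl h le_rfl hl'
      · rw [min_eq_right h, max_eq_left h]; exact (seg_reachable le_rfl h le_rfl hk').symm
    obtain ⟨m', h₁, h₂, e⟩ :=
      exists_of_mem_support (adj_of_reachable hle hkm hml hl hr).mem_support_left
    exact ⟨m', h₁, h₂, e.symm⟩
  · exact ⟨l', min_le_right _ _, le_max_right _ _, el⟩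

lemma joined_seg {i : ι} {k l : ℕ} (hkl : k ≤ l) (hl : l ≤ C.n i) :
    WalkJoined G {v | ∃ t, k ≤ t ∧ t ≤ l ∧ C.f i t = v} (C.f i k) (C.f i l) := by
  induction l, hkl using Nat.le_induction with
  | base => exact WalkJoined.refl ⟨k, le_rfl, le_rfl, rfl⟩
  | succ l hkl ih =>
    refine ((ih (by omega)).mono ?_).trans (WalkJoined.of_adj (C.adj i l hl)
      ⟨l, hkl, by omega, rfl⟩ ⟨l + 1, by omega, le_rfl, rfl⟩)
    rintro v ⟨t, h₁, h₂, e⟩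
    exact ⟨t, h₁, by omega, e⟩

lemma tail_subset {i : ι} {k : ℕ} {s : Bool} : C.tail i k s ⊆ C.vs i := by
  rintro v ⟨t, ht, -, rfl⟩
  exact f_mem ht

lemma joined_tail {i : ι} {k : ℕ} (hk : k ≤ C.n i) (s : Bool) :
    WalkJoined G (C.tail i k s) (C.f i k) (C.endVert i s) := by
  cases s
  · refine (joined_seg (Nat.zero_le k) hk).symm.mono ?_
    rintro v ⟨t, -, h, e⟩
    exact ⟨t, h.trans hk, h, e⟩
  · refine (joined_seg hk le_rfl).mono ?_
    rintro v ⟨t, h, h', e⟩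
    exact ⟨t, h', h, e⟩

lemma joined_vs {i : ι} : WalkJoined G (C.vs i) (C.endVert i false) (C.endVert i true) := by
  refine (joined_seg (Nat.zero_le (C.n i)) le_rfl).mono ?_
  rintro v ⟨t, -, h, e⟩
  exact ⟨t, h, e⟩

/-- If both directions met `j`, the vertex would lie between two common vertices, against convexity.
-/
lemma tail_avoid {i j : ι} {k : ℕ} (h : C.f i k ∉ C.vs j) :
    ∃ s, ∀ z ∈ C.tail i k s, z ∉ C.vs j := by
  by_contra! hcon
  obtain ⟨_, ⟨t, ht, htk, rfl⟩, htj⟩ := hcon false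
  obtain ⟨_, ⟨t', ht', htk', rfl⟩, htj'⟩ := hcon true
  exact h (convex htj htj' htk htk' ht')

lemma link_joined {i j k l : ι} {p q r s : Bool} (h₁ : C.endPos i p ≤ C.endPos j q)
    (h₂ : C.endPos j q ≤ C.endPos k r) (h₃ : C.endPos k r ≤ C.endPos l s) {S T : Set V}
    (hS : WalkJoined G S (C.endVert i p) (C.endVert k r))
    (hT : WalkJoined G T (C.endVert j q) (C.endVert l s)) : ∃ z, z ∈ S ∧ z ∈ T := by
  obtain ⟨A, hA⟩ := hS
  obtain ⟨B, hB⟩ := hT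
  obtain ⟨z, hz, hz'⟩ := C.link i j k l p q r s h₁ h₂ h₃ A B
  exact ⟨z, hA z hz, hB z hz'⟩

/-- The path `i` is below the path `j`. -/
def Le (C : ChordSystem G ι) (i j : ι) : Prop := C.a j ≤ C.a i ∧ C.b i ≤ C.b j

lemma Le.refl (i : ι) : C.Le i i := ⟨le_rfl, le_rfl⟩

lemma Le.trans {i j k : ι} (h : C.Le i j) (h' : C.Le j k) : C.Le i k :=
  ⟨h'.1.trans h.1, h.2.trans h'.2⟩

lemma Le.antisymm {i j : ι} (h : C.Le i j) (h' : C.Le j i) : i = j :=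
  C.ext i j (le_antisymm h'.1 h.1) (le_antisymm h.2 h'.2)

lemma le_total_of_le {i j k : ι} (h : C.Le k i) (h' : C.Le k j) : C.Le i j ∨ C.Le j i := by
  have := C.laminar i j
  have := C.lt k
  unfold Le at *
  omega

lemma endPos_bounds (i : ι) (s : Bool) : C.a i ≤ C.endPos i s ∧ C.endPos i s ≤ C.b i := by
  have := C.lt i
  cases s <;> simp [endPos, this.le]

/-- A path `r` separates the paths below it from the paths that are not strictly below it. -/
lemma sep {q r s : ι} (hq : C.Le q r) (hs : C.Le s r → s = r) {w : V} (hwq : w ∈ C.vs q)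
    (hws : w ∈ C.vs s) : w ∈ C.vs r := by
  by_contra hw
  obtain ⟨k, hk, rfl⟩ := hwq
  obtain ⟨l, hl, e⟩ := hws
  obtain ⟨x, hx⟩ := tail_avoid hw
  obtain ⟨y, hy⟩ := tail_avoid (C := C) (i := s) (k := l) (e ▸ hw)
  -- A tail of `q` and a tail of `s`, both avoiding `r`, are joined at `w`. They lead from inside
  -- the arc of `r` to outside it, so they would have to meet `r`.
  have h₁ := ((joined_tail hk x).symm.union (e ▸ joined_tail hl y))
  have hout : C.endPos s y ≤ C.a r ∨ C.b r ≤ C.endPos s y := by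
    have := C.laminar s r
    by_cases h : C.Le s r
    · obtain rfl := hs h
      exact absurd (f_mem hl) (e ▸ hw)
    · have h₂ := C.endPos_bounds s y
      have h₃ := C.lt r
      have h₄ := C.lt s
      unfold Le at h
      cases y <;> simp only [endPos, cond_true, cond_false] at * <;> omega
  have hb := C.endPos_bounds q x
  have hdis : ∀ z, z ∈ C.tail q k x ∪ C.tail s l y → z ∉ C.vs r := fun z hz =>
    hz.elim (hx z) (hy z)
  rcases hout with h | h
  · obtain ⟨z, hz, hz'⟩ := link_joined (i := s) (j := r) (k := q) (l := r) (p := y) (q := false)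
      (r := x) (s := true) h (hq.1.trans hb.1) (hb.2.trans hq.2) h₁.symm joined_vs
    exact hdis z hz hz'
  · obtain ⟨z, hz, hz'⟩ := link_joined (i := r) (j := q) (k := r) (l := s) (p := false) (q := x)
      (r := true) (s := y) (hq.1.trans hb.1) (hb.2.trans hq.2) h joined_vs h₁
    exact hdis z hz' hz

end ChordSystem

/-! ### Interleaving chords: coincidences, orders along paths, reflection -/

namespace ChordSystem

variable {V ι : Type*} {G : SimpleGraph V} {C : ChordSystem G ι}

/-- The ends of `i` and `j` interleave with those of `t` and `m`. -/
def Linked (C : ChordSystem G ι) (i j t m : ι) : Prop :=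
  ∀ (p q r s : Bool) (S T : Set V), WalkJoined G S (C.endVert i p) (C.endVert j q) →
    WalkJoined G T (C.endVert t r) (C.endVert m s) → ∃ z, z ∈ S ∧ z ∈ T

lemma linked_of_lt {i t j m : ι} (h₁ : C.b i ≤ C.a t) (h₂ : C.b t ≤ C.a j) (h₃ : C.b j ≤ C.a m) :
    C.Linked i j t m := by
  intro p q r s S T hS hT
  have hi := C.endPos_bounds i p
  have hj := C.endPos_bounds j q
  have ht := C.endPos_bounds t r
  have hm := C.endPos_bounds m s
  exact link_joined (by omega) (by omega) (by omega) hS hT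

/-- Each end of `m` lies to the left of `i` or to the right of `j`, and interleaves on either side.
-/
lemma linked_of_le {i t j m : ι} (h₁ : C.b i ≤ C.a t) (h₂ : C.b t ≤ C.a j) (hi : C.Le i m)
    (hj : C.Le j m) : C.Linked i j t m := by
  intro p q r s S T hS hT
  have hi' := C.endPos_bounds i p
  have hj' := C.endPos_bounds j q
  have ht' := C.endPos_bounds t r
  unfold Le at hi hj
  cases s
  · obtain ⟨z, hz, hz'⟩ := link_joined (i := m) (j := i) (k := t) (l := j) (p := false) (q := p)
      (r := r) (s := q) (show C.a m ≤ _ by omega) (by omega) (by omega) hT.symm hS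
    exact ⟨z, hz', hz⟩
  · exact link_joined (by omega) (by omega) (show _ ≤ C.b m by omega) hS hT

/-- Selects the direction in which to leave `i`: away from `v` if `v` is on `i`, and otherwise, from
a vertex off `j`, a direction that avoids `j`. -/
lemma exists_tail {i j : ι} {k : ℕ} {v : V} (hv : v ≠ C.f i k) :
    ∃ s, v ∉ C.tail i k s ∧
      (v ∉ C.vs i → C.f i k ∉ C.vs j → ∀ z ∈ C.tail i k s, z ∉ C.vs j) := by
  by_cases hvi : v ∈ C.vs i
  · obtain ⟨m, hm, rfl⟩ := hvi
    have hne : m ≠ k := fun h => hv (by rw [h])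
    rcases lt_or_gt_of_ne hne with h | h
    · refine ⟨true, ?_, fun h' => absurd (f_mem hm) h'⟩
      rintro ⟨t, ht, hkt, e⟩
      have := C.inj i t m ht hm e
      simp only [cond_true] at hkt
      omega
    · refine ⟨false, ?_, fun h' => absurd (f_mem hm) h'⟩
      rintro ⟨t, ht, hkt, e⟩
      have := C.inj i t m ht hm e
      simp only [cond_false] at hkt
      omega
  · by_cases hj : C.f i k ∈ C.vs j
    · exact ⟨true, fun h => hvi (tail_subset h), fun _ h => absurd hj h⟩
    · obtain ⟨s, hs⟩ := tail_avoid hj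
      exact ⟨s, fun h => hvi (tail_subset h), fun _ _ => hs⟩

/-- If the tails met, the base of the first would lie on `i` between the base of the second and the
meeting point, and `between` would put it on the second tail. -/
lemma tail_disjoint_aux {i j : ι} {k l : ℕ} {s s' : Bool} (hl : l ≤ C.n j)
    (hv : C.f j l ∉ C.tail i k s) (hw : C.f i k ∉ C.tail j l s') (hvi : C.f j l ∈ C.vs i) :
    ∀ z ∈ C.tail i k s, z ∉ C.tail j l s' := by
  rintro _ ⟨m, hm, hkm, rfl⟩ ⟨m', hm', hlm', e⟩
  obtain ⟨mv, hmv, ev⟩ := hvi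
  have hkb : (min mv m ≤ k ∧ k ≤ max mv m) := by
    cases s
    · have : k < mv := by
        by_contra h
        exact hv ⟨mv, hmv, by simp only [cond_false]; omega, ev⟩
      simp only [cond_false] at hkm
      omega
    · have : mv < k := by
        by_contra h
        exact hv ⟨mv, hmv, by simp only [cond_true]; omega, ev⟩
      simp only [cond_true] at hkm
      omega
  have : ∃ k', min l m' ≤ k' ∧ k' ≤ max l m' ∧ C.f i k = C.f j k' := by
    rcases le_total mv m with h | h
    · exact between (by omega) (by omega) hm hl hm' ev e.symm
    · rw [min_comm, max_comm]
      exact between (by omega) (by omega) hmv hm' hl e.symm ev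
  obtain ⟨k', h₁, h₂, e'⟩ := this
  rw [e'] at hw
  apply hw
  refine ⟨k', by omega, ?_, rfl⟩
  cases s' <;> simp only [cond_true, cond_false] at * <;> omega

lemma tail_disjoint {i j : ι} {k l : ℕ} {s s' : Bool} (hk : k ≤ C.n i) (hl : l ≤ C.n j)
    (hv : C.f j l ∉ C.tail i k s) (hw : C.f i k ∉ C.tail j l s')
    (h : C.f j l ∉ C.vs i → C.f i k ∉ C.vs j →
      (∀ z ∈ C.tail i k s, z ∉ C.vs j) ∨ (∀ z ∈ C.tail j l s', z ∉ C.vs i)) :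
    ∀ z ∈ C.tail i k s, z ∉ C.tail j l s' := by
  intro z hz hz'
  by_cases hvi : C.f j l ∈ C.vs i
  · exact tail_disjoint_aux hl hv hw hvi z hz hz'
  by_cases hwj : C.f i k ∈ C.vs j
  · exact tail_disjoint_aux hk hw hv hwj z hz' hz
  rcases h hvi hwj with h | h
  · exact h z hz (tail_subset hz')
  · exact h z hz' (tail_subset hz)

/-- If `i` meets `j`, `t` meets `m`, and their ends interleave, then they all meet in one vertex. -/
theorem eq_of_linked {i j t m : ι} (hl : C.Linked i j t m) {v w : V} (hvi : v ∈ C.vs i)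
    (hvj : v ∈ C.vs j) (hwt : w ∈ C.vs t) (hwm : w ∈ C.vs m) : v = w := by
  by_contra hne
  obtain ⟨ki, hki, rfl⟩ := hvi
  obtain ⟨kj, hkj, ej⟩ := hvj
  obtain ⟨kt, hkt, rfl⟩ := hwt
  obtain ⟨km, hkm, em⟩ := hwm
  -- Avoidance is assigned cyclically: `t` avoids `i`, `i` avoids `m`, `m` avoids `j`, `j` avoids
  -- `t`. Each pair of tails that has to be disjoint is covered once.
  obtain ⟨st, ht, ht'⟩ := exists_tail (j := i) hne
  obtain ⟨si, hi, hi'⟩ := exists_tail (j := m) (Ne.symm hne)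
  obtain ⟨sm, hm, hm'⟩ := exists_tail (j := j) (v := C.f i ki) (by rwa [em])
  obtain ⟨sj, hj, hj'⟩ := exists_tail (j := t) (v := C.f t kt) (by rw [ej]; exact Ne.symm hne)
  have h₁ := (joined_tail hki si).symm.union (ej ▸ joined_tail hkj sj)
  have h₂ := (joined_tail hkt st).symm.union (em ▸ joined_tail hkm sm)
  obtain ⟨z, hz, hz'⟩ := hl _ _ _ _ _ _ h₁ h₂
  have dti := tail_disjoint hkt hki ht hi fun h h' => Or.inl (ht' h h')
  have dim := tail_disjoint hki hkm (by rwa [em]) hm fun h h' => Or.inl (hi' (by rwa [← em]) h')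
  have dmj := tail_disjoint hkm hkj (by rwa [ej]) (by rwa [em]) fun h h' =>
    Or.inl (hm' (by rwa [← ej]) h')
  have djt := tail_disjoint hkj hkt hj (by rwa [ej]) fun h h' => Or.inl (hj' h (by simpa using h'))
  rcases hz with hz | hz <;> rcases hz' with hz' | hz'
  · exact dti z hz' hz
  · exact dim z hz hz'
  · exact djt z hz hz'
  · exact dmj z hz' hz

/-- Nested paths run through their common vertices in the same order. -/
lemma index_lt_of_le {r q : ι} (h : C.Le r q) {k l k' l' : ℕ} (hl : l ≤ C.n r) (hk' : k' ≤ C.n q)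
    (hl' : l' ≤ C.n q) (ek : C.f r k = C.f q k') (el : C.f r l = C.f q l') (hkl : k < l) :
    k' < l' := by
  by_contra hcon
  have hlk : l' < k' := by
    refine lt_of_le_of_ne (not_lt.1 hcon) fun h => ?_
    have := C.inj r k l (by omega) hl (by rw [ek, el, h])
    omega
  -- If the orders disagreed, exchanging tails at the two common vertices would give disjoint walks
  -- from the start of `q` to the end of `r` and from the start of `r` to the end of `q`, whose ends
  -- interleave.
  have hA := (joined_tail hl' false).symm.union (el ▸ joined_tail hl true)
  have hB := (joined_tail (show k ≤ C.n r by omega) false).symm.union (ek ▸ joined_tail hk' true)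
  obtain ⟨z, hz, hz'⟩ := link_joined (i := q) (j := r) (k := r) (l := q) (p := false) (q := false)
    (r := true) (s := true) h.1 (C.lt r).le h.2 hA hB
  rcases hz with ⟨t, ht, hts, rfl⟩ | ⟨t, ht, hts, rfl⟩ <;>
    rcases hz' with ⟨t', ht', hts', e⟩ | ⟨t', ht', hts', e⟩ <;>
    simp only [cond_true, cond_false] at hts hts'
  · obtain ⟨m', h₁, h₂, e'⟩ := between hts' hkl.le hl ht hl' e el
    have := C.inj q k' m' hk' (by omega) (ek.symm.trans e')
    omega
  · have := C.inj q t t' ht ht' e.symm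
    omega
  · have := C.inj r t t' ht ht' e.symm
    omega
  · obtain ⟨m', h₁, h₂, e'⟩ := between hkl.le hts ht hk' ht' ek e.symm
    have := C.inj q l' m' hl' (by omega) (el.symm.trans e')
    omega

/-- On the right one of two disjoint arcs below `q`, the vertices of `q` come before the vertices of
the left one. -/
lemma index_lt_right {q r l : ι} (hl : C.Le l q) (hrl : C.b r ≤ C.a l) {k m : ℕ}
    (hk : k ≤ C.n r) (hm : m ≤ C.n r) (hkq : C.f r k ∈ C.vs q) (hml : C.f r m ∈ C.vs l)
    (hkl : C.f r k ∉ C.vs l) (hmq : C.f r m ∉ C.vs q) : k < m := by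
  by_contra hcon
  have hmk : m < k := lt_of_le_of_ne (not_lt.1 hcon) fun h => hmq (h ▸ hkq)
  obtain ⟨kq, hkq', eq⟩ := id hkq
  obtain ⟨ml, hml', el⟩ := id hml
  obtain ⟨s, hs⟩ := tail_avoid (C := C) (i := l) (k := ml) (j := q) (by rwa [el])
  -- In the wrong order, the start of `r` would be joined to an end of `l`, and the end of `r` to
  -- that of `q`, by disjoint interleaving walks.
  have hA := (joined_tail hm false).symm.union (el ▸ joined_tail hml' s)
  have hB := (joined_tail hk true).symm.union (eq ▸ joined_tail hkq' true)
  have hb := C.endPos_bounds l s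
  obtain ⟨z, hz, hz'⟩ := link_joined (i := r) (j := r) (k := l) (l := q) (p := false) (q := true)
    (r := s) (s := true) (C.lt r).le (hrl.trans hb.1) (hb.2.trans hl.2) hA hB
  rcases hz with ⟨t, ht, hts, rfl⟩ | hz <;> rcases hz' with ⟨t', ht', hts', e⟩ | hz'
  · have := C.inj r t t' ht ht' e.symm
    simp only [cond_true, cond_false] at hts hts'
    omega
  · exact hmq (convex (tail_subset hz') hkq hts hmk.le hk)
  · obtain rfl := e
    exact hkl (convex hml (tail_subset hz) hmk.le hts' ht')
  · exact hs z hz (tail_subset hz')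

/-- On `q`, the vertices of the right one of two disjoint arcs below `q` come before those of the left
one. -/
lemma index_lt_upper {q r l : ι} (hr : C.Le r q) (hl : C.Le l q) (hrl : C.b r ≤ C.a l)
    (hno : ∀ z, z ∈ C.vs q → z ∈ C.vs r → z ∉ C.vs l) {k k' : ℕ}
    (hk : k ≤ C.n q) (hk' : k' ≤ C.n q) (hkr : C.f q k ∈ C.vs r) (hkl : C.f q k' ∈ C.vs l) :
    k < k' := by
  by_contra hcon
  have hlt : k' < k := lt_of_le_of_ne (not_lt.1 hcon) fun h => hno _ (f_mem hk) hkr (h ▸ hkl)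
  obtain ⟨ku, hku, eu⟩ := id hkr
  obtain ⟨kv, hkv, ev⟩ := id hkl
  -- The same exchange: from the start of `q` to the end of `l`, and from the start of `r` to the
  -- end of `q`.
  have hA := (joined_tail hk' false).symm.union (ev ▸ joined_tail hkv true)
  have hB := (joined_tail hku false).symm.union (eu.symm ▸ joined_tail hk true)
  have := C.lt l
  have := C.lt r
  obtain ⟨z, hz, hz'⟩ := link_joined (i := q) (j := r) (k := l) (l := q) (p := false)
    (q := false) (r := true) (s := true) hr.1 (show C.a r ≤ C.b l by omega) hl.2 hA hB
  rcases hz with ⟨t, ht, hts, rfl⟩ | hz <;> rcases hz' with hz' | ⟨t', ht', hts', e⟩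
  · exact hno _ (f_mem hk') (convex (tail_subset hz') hkr hts hlt.le hk) hkl
  · have := C.inj q t t' ht ht' e.symm
    simp only [cond_true, cond_false] at hts hts'
    omega
  · obtain ⟨t, ht, hts, rfl⟩ := hz'
    have hzl := tail_subset hz
    have := index_lt_right (q := q) hl hrl hku ht (eu ▸ f_mem hk) hzl
      (eu ▸ hno _ (f_mem hk) hkr) fun h => hno _ h (f_mem ht) hzl
    simp only [cond_false] at hts
    omega
  · obtain rfl := e
    exact hno _ (f_mem hk) hkr (convex hkl (tail_subset hz) hlt.le hts' ht')

/-- The mirror image of a system of chords. -/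
def mirror (C : ChordSystem G ι) : ChordSystem G ι where
  n := C.n
  f i k := C.f i (C.n i - k)
  a i := - C.b i
  b i := - C.a i
  pos := C.pos
  adj i k hk := by
    have := C.adj i (C.n i - (k + 1)) (by omega)
    rw [show C.n i - (k + 1) + 1 = C.n i - k by omega] at this
    exact this.symm
  inj i k l hk hl h := by
    have := C.inj i _ _ (Nat.sub_le _ _) (Nat.sub_le _ _) h
    omega
  lt i := neg_lt_neg (C.lt i)
  laminar i j := by
    have := C.laminar i j
    omega
  ext i j h h' := C.ext i j (by omega) (by omega)
  link i j k l p q r s h₁ h₂ h₃ A B := by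
    have hv : ∀ i p, cond p (C.f i (C.n i - C.n i)) (C.f i (C.n i - 0)) =
        cond (!p) (C.f i (C.n i)) (C.f i 0) := by
      intro i p
      cases p <;> simp
    have hp : ∀ i p, cond p (-C.a i) (-C.b i) = - cond (!p) (C.b i) (C.a i) := by
      intro i p
      cases p <;> simp
    rw [hp, hp, neg_le_neg_iff] at h₁ h₂ h₃
    -- Reflection reverses the order of the four ends, so the two walks exchange their roles.
    obtain ⟨z, hz, hz'⟩ := C.link l k j i (!s) (!r) (!q) (!p) h₃ h₂ h₁
      (B.reverse.copy (hv l s) (hv j q)) (A.reverse.copy (hv k r) (hv i p))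
    exact ⟨z, by simpa using hz', by simpa using hz⟩
  touch i j k k' l l' hk hk' hl hl' e e' := by
    have hrev : ∀ i, segGraph (C.f i) 0 (C.n i) ≤ segGraph (fun k => C.f i (C.n i - k)) 0 (C.n i) := by
      rintro i u v ⟨hne, m, -, hm, h⟩
      refine ⟨hne, C.n i - (m + 1), Nat.zero_le _, by omega, ?_⟩
      simp only
      rw [show C.n i - (C.n i - (m + 1)) = m + 1 by omega,
        show C.n i - (C.n i - (m + 1) + 1) = m by omega, h, Sym2.eq_swap]
    exact (C.touch i j _ _ _ _ (Nat.sub_le _ _) (Nat.sub_le _ _) (Nat.sub_le _ _)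
      (Nat.sub_le _ _) e e').mono (inf_le_inf (hrev i) (hrev j))

lemma mirror_vs (i : ι) : C.mirror.vs i = C.vs i := by
  ext v
  constructor
  · rintro ⟨k, hk, rfl⟩
    exact f_mem (Nat.sub_le _ _)
  · rintro ⟨k, hk, rfl⟩
    refine ⟨C.n i - k, Nat.sub_le _ _, ?_⟩
    change C.f i (C.n i - (C.n i - k)) = _
    rw [Nat.sub_sub_self hk]

lemma mirror_pg (i : ι) : C.mirror.pg i = C.pg i := by
  ext u v
  constructor
  · intro h
    obtain ⟨k, -, hk, h⟩ := exists_of_adj h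
    change k < C.n i at hk
    change (u = C.f i (C.n i - k) ∧ v = C.f i (C.n i - (k + 1))) ∨
      (u = C.f i (C.n i - (k + 1)) ∧ v = C.f i (C.n i - k)) at h
    have h' := pg_adj (C := C) (i := i) (k := C.n i - (k + 1)) (by omega)
    rw [show C.n i - (k + 1) + 1 = C.n i - k by omega] at h'
    rcases h with ⟨rfl, rfl⟩ | ⟨rfl, rfl⟩
    · exact h'.symm
    · exact h'
  · intro h
    obtain ⟨k, -, hk, h⟩ := exists_of_adj h
    have h' := pg_adj (C := C.mirror) (i := i) (k := C.n i - (k + 1)) (by change _ < C.n i; omega)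
    change (C.mirror.pg i).Adj (C.f i (C.n i - (C.n i - (k + 1))))
      (C.f i (C.n i - (C.n i - (k + 1) + 1))) at h'
    rw [show C.n i - (C.n i - (k + 1)) = k + 1 by omega,
      show C.n i - (C.n i - (k + 1) + 1) = k by omega] at h'
    rcases h with ⟨rfl, rfl⟩ | ⟨rfl, rfl⟩
    · exact h'.symm
    · exact h'

lemma mirror_le {i j : ι} : C.mirror.Le i j ↔ C.Le i j := by
  change (- C.b j ≤ - C.b i ∧ - C.a i ≤ - C.a j) ↔ _
  unfold Le
  omega

end ChordSystem

namespace ChordSystem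

variable {V ι : Type*} {G : SimpleGraph V} {C : ChordSystem G ι}

lemma mem_support_biSup_pg {S : Set ι} {u : V} :
    u ∈ (⨆ i ∈ S, C.pg i).support ↔ ∃ i ∈ S, u ∈ C.vs i := by
  simp only [mem_support_biSup, support_pg]

lemma pg_le_biSup {S : Set ι} {i : ι} (hi : i ∈ S) : C.pg i ≤ ⨆ i ∈ S, C.pg i :=
  le_iSup₂_of_le i hi le_rfl

/-! ### Colouring an antichain -/

/-- In a non-empty family of pairwise disjoint arcs there is a path `m` such that all the other paths
meeting it, but for two of them, pairwise meet on it. -/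
lemma exists_degenerate {M : Finset ι} (hne : M.Nonempty)
    (hM : ∀ i ∈ M, ∀ j ∈ M, i ≠ j → C.b i ≤ C.a j ∨ C.b j ≤ C.a i) :
    ∃ m ∈ M, ∃ a b : ι, ∀ k ∈ M, ∀ l ∈ M, k ≠ m → k ≠ a → k ≠ b → l ≠ m → l ≠ a → l ≠ b →
      (C.vs m ∩ C.vs k).Nonempty → (C.vs m ∩ C.vs l).Nonempty →
      ∃ z ∈ C.vs m, z ∈ C.vs k ∧ z ∈ C.vs l := by
  classical
  set Btw : ι × ι → Finset ι := fun p => M.filter fun t => C.b p.1 ≤ C.a t ∧ C.b t ≤ C.a p.2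
    with hBtw
  -- Pairs that meet although some arc lies between them. A pair with the fewest arcs in between
  -- yields the required path.
  set Q := (M ×ˢ M).filter fun p => C.b p.1 ≤ C.a p.2 ∧ (C.vs p.1 ∩ C.vs p.2).Nonempty ∧
    (Btw p).Nonempty with hQ
  rcases Q.eq_empty_or_nonempty with hQe | hQne
  -- Without such pairs, the leftmost path meets at most one other path: of two, the nearer would
  -- lie in between.
  · obtain ⟨m, hm, hmin⟩ := M.exists_min_image C.a hne
    have hlt : ∀ k ∈ M, k ≠ m → C.b m ≤ C.a k := by
      intro k hk hkm
      have := hM k hk m hm hkm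
      have := hmin k hk
      have := C.lt k
      omega
    have hnb : ∀ k ∈ M, k ≠ m → (C.vs m ∩ C.vs k).Nonempty → ∀ t ∈ M, t ≠ m →
        ¬ C.b t ≤ C.a k := by
      intro k hk hkm hmk t ht htm htk
      have : (m, k) ∈ Q := by
        rw [hQ, Finset.mem_filter]
        exact ⟨Finset.mk_mem_product hm hk, hlt k hk hkm, hmk,
          ⟨t, Finset.mem_filter.2 ⟨ht, hlt t ht htm, htk⟩⟩⟩
      rw [hQe] at this
      exact absurd this (Finset.notMem_empty _)
    refine ⟨m, hm, m, m, fun k hk l hl hkm _ _ hlm _ _ hmk hml => ?_⟩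
    by_cases hkl : k = l
    · subst hkl
      obtain ⟨z, hz, hz'⟩ := hmk
      exact ⟨z, hz, hz', hz'⟩
    · rcases hM k hk l hl hkl with h | h
      · exact absurd h (hnb l hl hlm hml k hk hkm)
      · exact absurd h (hnb k hk hkm hmk l hl hlm)
  · obtain ⟨⟨i, j⟩, hij, hmin⟩ := Q.exists_min_image (fun p => (Btw p).card) hQne
    rw [hQ, Finset.mem_filter, Finset.mem_product] at hij
    obtain ⟨⟨hi, hj⟩, hij, ⟨v, hvi, hvj⟩, hb⟩ := hij
    simp only at hi hj hij hvi hvj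
    -- `t` is the leftmost arc between `i` and `j`. Paths outside can meet it only in the vertex `v`
    -- common to `i` and `j`; by minimality at most one path inside meets it.
    obtain ⟨t, ht, htmin⟩ := (Btw (i, j)).exists_min_image C.a hb
    have htB := ht
    rw [hBtw, Finset.mem_filter] at ht
    obtain ⟨htM, hit, htj⟩ := ht
    simp only at hit htj
    have hempty : ∀ k ∈ M, C.b t ≤ C.a k → (k = j ∨ C.b k ≤ C.a j) →
        (C.vs t ∩ C.vs k).Nonempty → ∀ x ∈ M, C.b t ≤ C.a x → ¬ C.b x ≤ C.a k := by
      intro k hk htk hkj hmeet x hx htx hxk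
      have hmem : (t, k) ∈ Q := by
        rw [hQ, Finset.mem_filter]
        exact ⟨Finset.mk_mem_product htM hk, htk, hmeet,
          ⟨x, Finset.mem_filter.2 ⟨hx, htx, hxk⟩⟩⟩
      have hcard := hmin _ hmem
      have hsub : Btw (t, k) ⊂ Btw (i, j) := by
        have htt := C.lt t
        have hkk := C.lt k
        refine Finset.ssubset_iff_of_subset ?_ |>.2 ⟨t, htB, fun h => ?_⟩
        · intro y hy
          rw [hBtw, Finset.mem_filter] at hy ⊢
          refine ⟨hy.1, ?_, ?_⟩
          · have := hy.2.1
            simp only at *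
            omega
          · have := hy.2.2
            rcases hkj with rfl | hkj
            · exact this
            · simp only at *
              omega
        · rw [hBtw, Finset.mem_filter] at h
          have := h.2.1
          simp only at this
          omega
      exact absurd (Finset.card_lt_card hsub) (not_lt.2 hcard)
    have hinner : ∀ k ∈ M, k ≠ t → k ≠ i → k ≠ j → C.b i ≤ C.a k → C.b k ≤ C.a j →
        C.b t ≤ C.a k := by
      intro k hk hkt _ _ hik hkj
      have := hM k hk t htM hkt
      have := htmin k (Finset.mem_filter.2 ⟨hk, hik, hkj⟩)
      have := C.lt k
      omega
    have hout : ∀ k ∈ M, k ≠ t → k ≠ i → k ≠ j → ¬ (C.b i ≤ C.a k ∧ C.b k ≤ C.a j) →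
        ∀ w, w ∈ C.vs t → w ∈ C.vs k → v = w := by
      intro k hk hkt hki hkj hn w hwt hwk
      have h₁ := hM k hk i hi hki
      have h₂ := hM k hk j hj hkj
      have h₃ : C.b k ≤ C.a i ∨ C.b j ≤ C.a k := by
        have := C.lt k
        have := C.lt i
        have := C.lt j
        omega
      rcases h₃ with h₃ | h₃
      · exact (eq_of_linked (linked_of_lt h₃ hit htj) hwk hwt hvi hvj).symm
      · exact eq_of_linked (linked_of_lt hit htj h₃) hvi hvj hwt hwk
    -- The two kinds of neighbours exclude each other: an outside neighbour puts `v` on `t`, so `t`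
    -- meets `j`, and minimality leaves no arc between them.
    have hmixed : ∀ k ∈ M, k ≠ t → k ≠ i → k ≠ j → ∀ l ∈ M, l ≠ t → l ≠ i → l ≠ j →
        (C.vs t ∩ C.vs k).Nonempty → (C.b i ≤ C.a l ∧ C.b l ≤ C.a j) →
        (C.b i ≤ C.a k ∧ C.b k ≤ C.a j) := by
      intro k hk hkt hki hkj l hl hlt hli hlj ⟨w, hw, hw'⟩ hil
      by_contra hcon
      obtain rfl := hout k hk hkt hki hkj hcon w hw hw'
      exact hempty j hj htj (Or.inl rfl) ⟨v, hw, hvj⟩ l hl (hinner l hl hlt hli hlj hil.1 hil.2)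
        hil.2
    refine ⟨t, htM, i, j, fun k hk l hl hkt hki hkj hlt hli hlj hmk hml => ?_⟩
    by_cases hki' : C.b i ≤ C.a k ∧ C.b k ≤ C.a j
    · have hli' := hmixed l hl hlt hli hlj k hk hkt hki hkj hml hki'
      have h₁ := hinner k hk hkt hki hkj hki'.1 hki'.2
      have h₂ := hinner l hl hlt hli hlj hli'.1 hli'.2
      by_cases hkl : k = l
      · subst hkl
        obtain ⟨z, hz, hz'⟩ := hmk
        exact ⟨z, hz, hz', hz'⟩
      · rcases hM k hk l hl hkl with h | h
        · exact absurd h (hempty l hl h₂ (Or.inr hli'.2) hml k hk h₁)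
        · exact absurd h (hempty k hk h₁ (Or.inr hki'.2) hmk l hl h₂)
    · have hli' : ¬ (C.b i ≤ C.a l ∧ C.b l ≤ C.a j) := fun h =>
        hki' (hmixed k hk hkt hki hkj l hl hlt hli hlj hmk h)
      obtain ⟨w, hw, hw'⟩ := hmk
      obtain ⟨w', hw₁, hw₁'⟩ := hml
      have e₁ := hout k hk hkt hki hkj hki' w hw hw'
      have e₂ := hout l hl hlt hli hlj hli' w' hw₁ hw₁'
      subst e₁ e₂
      exact ⟨v, hw, hw', hw₁'⟩

/-- Pairwise disjoint arcs can be coloured with three of four colours so that the paths of each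
colour form a forest. -/
lemma exists_antichain_coloring (t₀ : Fin 4) (M : Finset ι)
    (hM : ∀ i ∈ M, ∀ j ∈ M, i ≠ j → C.b i ≤ C.a j ∨ C.b j ≤ C.a i) :
    ∃ τ : ι → Fin 4, (∀ i ∈ M, τ i ≠ t₀) ∧
      ∀ c, (⨆ i ∈ {i | i ∈ M ∧ τ i = c}, C.pg i).IsAcyclic := by
  classical
  induction h : M.card using Nat.strong_induction_on generalizing M with
  | _ N ih =>
  rcases M.eq_empty_or_nonempty with rfl | hne
  · exact ⟨fun _ => 0, by simp, by simp⟩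
  obtain ⟨m, hm, a, b, hab⟩ := exists_degenerate hne hM
  obtain ⟨τ, hτ, hac⟩ := ih (M.erase m).card (h ▸ Finset.card_erase_lt_of_mem hm) (M.erase m)
    (fun i hi j hj => hM i (Finset.mem_of_mem_erase hi) j (Finset.mem_of_mem_erase hj)) rfl
  -- Four colours leave one different from `t₀` and from those of the two exceptional paths. The
  -- remaining neighbours of `m` of that colour meet each other on `m`, so `m` can be glued to them.
  obtain ⟨c₀, h₀, ha, hb⟩ : ∃ c : Fin 4, c ≠ t₀ ∧ c ≠ τ a ∧ c ≠ τ b := by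
    have : ∀ x y z : Fin 4, ∃ c : Fin 4, c ≠ x ∧ c ≠ y ∧ c ≠ z := by decide
    exact this _ _ _
  refine ⟨Function.update τ m c₀, fun i hi => ?_, fun c => ?_⟩
  · by_cases him : i = m
    · subst him; simpa using h₀
    · rw [Function.update_of_ne him]; exact hτ i (Finset.mem_erase.2 ⟨him, hi⟩)
  · by_cases hc : c = c₀
    · subst hc
      have hle : (⨆ i ∈ {i | i ∈ M ∧ Function.update τ m c i = c}, C.pg i) ≤
          (⨆ i ∈ {i | i ∈ M.erase m ∧ τ i = c}, C.pg i) ⊔ C.pg m := by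
        refine iSup₂_le fun i hi => ?_
        by_cases him : i = m
        · subst him; exact le_sup_right
        · refine le_sup_of_le_left (pg_le_biSup ?_)
          have := hi.2
          rw [Function.update_of_ne him] at this
          exact ⟨Finset.mem_erase.2 ⟨him, hi.1⟩, this⟩
      refine IsAcyclic.anti hle (IsAcyclic.sup_of_meetConnected ?_ (hac c) (pg_isAcyclic m))
      intro u v hu hu' hv hv'
      rw [mem_support_biSup_pg] at hu hv
      rw [support_pg] at hu' hv'
      obtain ⟨k, ⟨hk, hkc⟩, hku⟩ := hu
      obtain ⟨l, ⟨hl, hlc⟩, hlv⟩ := hv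
      obtain ⟨hkm, hkM⟩ := Finset.mem_erase.1 hk
      obtain ⟨hlm, hlM⟩ := Finset.mem_erase.1 hl
      obtain ⟨z, hzm, hzk, hzl⟩ := hab k hkM l hlM hkm (fun e => ha (e ▸ hkc.symm))
        (fun e => hb (e ▸ hkc.symm)) hlm (fun e => ha (e ▸ hlc.symm))
        (fun e => hb (e ▸ hlc.symm)) ⟨u, hu', hku⟩ ⟨v, hv', hlv⟩
      have h₁ := (meet_reachable hku hu' hzk hzm).mono
        (inf_le_inf_right (C.pg m) (pg_le_biSup (C := C)
          (S := {i | i ∈ M.erase m ∧ τ i = c}) ⟨hk, hkc⟩))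
      have h₂ := (meet_reachable hzl hzm hlv hv').mono
        (inf_le_inf_right (C.pg m) (pg_le_biSup (C := C)
          (S := {i | i ∈ M.erase m ∧ τ i = c}) ⟨hl, hlc⟩))
      exact h₁.trans h₂
    · refine IsAcyclic.anti (iSup₂_le fun i hi => ?_) (hac c)
      have him : i ≠ m := by
        rintro rfl
        have := hi.2
        rw [Function.update_self] at this
        exact hc this.symm
      have := hi.2
      rw [Function.update_of_ne him] at this
      exact pg_le_biSup (C := C) (S := {i | i ∈ M.erase m ∧ τ i = c})
        ⟨Finset.mem_erase.2 ⟨him, hi.1⟩, this⟩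

/-! ### Colouring the paths that touch a given one -/

/-- A laminar family can be coloured with three colours so that any two disjoint arcs without an arc
in between have different colours. -/
lemma exists_laminar_coloring (T : Finset ι) (α β γ : Fin 3) (hαβ : α ≠ β) (hαγ : α ≠ γ)
    (hβγ : β ≠ γ) : ∃ κ : ι → Fin 3,
      (∀ c ∈ T, (∀ h ∈ T, ¬ C.b h ≤ C.a c) → κ c = α) ∧
      (∀ c ∈ T, (∀ h ∈ T, ¬ C.b c ≤ C.a h) → κ c ≠ γ) ∧
      ∀ c ∈ T, ∀ d ∈ T, C.b c ≤ C.a d → (∀ h ∈ T, ¬ (C.b c ≤ C.a h ∧ C.b h ≤ C.a d)) →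
        κ c ≠ κ d := by
  classical
  induction h : T.card using Nat.strong_induction_on generalizing T α β γ with
  | _ N ih =>
  rcases T.eq_empty_or_nonempty with rfl | hne
  · exact ⟨fun _ => 0, by simp, by simp, by simp⟩
  -- `d₁` will be the largest of the arcs that start leftmost: every arc is below it or to its
  -- right.
  obtain ⟨x₀, hx₀, hmin⟩ := T.exists_min_image C.a hne
  obtain ⟨d₁, hd₁, hmax⟩ := (T.filter fun x => C.a x = C.a x₀).exists_max_image C.b
    ⟨x₀, Finset.mem_filter.2 ⟨hx₀, rfl⟩⟩
  rw [Finset.mem_filter] at hd₁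
  obtain ⟨hd₁, hd₁a⟩ := hd₁
  have hdich : ∀ x ∈ T, C.Le x d₁ ∨ C.b d₁ ≤ C.a x := by
    intro x hx
    have h₁ := C.laminar x d₁
    have h₂ := hmin x hx
    have h₃ := C.lt x
    by_cases h₄ : C.a x = C.a x₀
    · have := hmax x (Finset.mem_filter.2 ⟨hx, h₄⟩)
      exact Or.inl ⟨by omega, this⟩
    · unfold Le
      omega
  have hltd := C.lt d₁
  by_cases hall : ∀ x ∈ T, C.Le x d₁
  · obtain ⟨κ, h₁, h₂, h₃⟩ := ih (T.erase d₁).card (h ▸ Finset.card_erase_lt_of_mem hd₁)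
      (T.erase d₁) α β γ hαβ hαγ hβγ rfl
    refine ⟨Function.update κ d₁ α, fun c hc hex => ?_, fun c hc hex => ?_,
      fun c hc d hd hcd hex => ?_⟩
    · by_cases hcd : c = d₁
      · subst hcd; simp
      · rw [Function.update_of_ne hcd]
        exact h₁ c (Finset.mem_erase.2 ⟨hcd, hc⟩) fun h hh => hex h (Finset.mem_of_mem_erase hh)
    · by_cases hcd : c = d₁
      · subst hcd; simpa using hαγ
      · rw [Function.update_of_ne hcd]
        exact h₂ c (Finset.mem_erase.2 ⟨hcd, hc⟩) fun h hh => hex h (Finset.mem_of_mem_erase hh)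
    · have hc₁ := hall c hc
      have hd₁' := hall d hd
      have hltc := C.lt c
      have hltd' := C.lt d
      unfold Le at hc₁ hd₁'
      have hcd₁ : c ≠ d₁ := by rintro rfl; omega
      have hdd₁ : d ≠ d₁ := by rintro rfl; omega
      rw [Function.update_of_ne hcd₁, Function.update_of_ne hdd₁]
      exact h₃ c (Finset.mem_erase.2 ⟨hcd₁, hc⟩) d (Finset.mem_erase.2 ⟨hdd₁, hd⟩) hcd
        fun h hh => hex h (Finset.mem_of_mem_erase hh)
  · push Not at hall
    obtain ⟨y, hy, hyd⟩ := hall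
    have hyd := (hdich y hy).resolve_left hyd
    set F₁ := T.filter fun x => C.Le x d₁ with hF₁
    set F₂ := T.filter fun x => ¬ C.Le x d₁ with hF₂
    have hnle : ∀ x, C.b d₁ ≤ C.a x → ¬ C.Le x d₁ := by
      intro x hx hle
      have := C.lt x
      unfold Le at hle
      omega
    have hc₁ : F₁.card < N := h ▸ Finset.card_lt_card
      (Finset.filter_ssubset.2 ⟨y, hy, hnle y hyd⟩)
    have hc₂ : F₂.card < N := h ▸ Finset.card_lt_card
      (Finset.filter_ssubset.2 ⟨d₁, hd₁, not_not.2 (Le.refl d₁)⟩)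
    -- The permutations are those of `RightColor`. Below `d₁` the last arcs avoid `β`, and to its
    -- right the first arcs have colour `β`, so the requirement also holds across the cut.
    obtain ⟨κ₁, h₁, h₂, h₃⟩ := ih _ hc₁ F₁ α γ β hαγ hαβ hβγ.symm rfl
    obtain ⟨κ₂, k₁, k₂, k₃⟩ := ih _ hc₂ F₂ β α γ hαβ.symm hβγ hαγ rfl
    have hyF : y ∈ F₂ := Finset.mem_filter.2 ⟨hy, hnle y hyd⟩
    have hsub₁ : ∀ x ∈ F₁, x ∈ T := fun x hx => (Finset.mem_filter.1 hx).1
    have hsub₂ : ∀ x ∈ F₂, x ∈ T := fun x hx => (Finset.mem_filter.1 hx).1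
    have hpos₂ : ∀ x ∈ F₂, C.b d₁ ≤ C.a x := fun x hx =>
      (hdich x (hsub₂ x hx)).resolve_left (Finset.mem_filter.1 hx).2
    refine ⟨fun x => if C.Le x d₁ then κ₁ x else κ₂ x, fun c hc hex => ?_, fun c hc hex => ?_,
      fun c hc d hd hcd hex => ?_⟩
    · by_cases hcd : C.Le c d₁
      · simp only [hcd, if_true]
        exact h₁ c (Finset.mem_filter.2 ⟨hc, hcd⟩) fun h hh => hex h (hsub₁ h hh)
      · exact absurd ((hdich c hc).resolve_left hcd) (hex d₁ hd₁)
    · by_cases hcd : C.Le c d₁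
      · exact absurd (hcd.2.trans hyd) (hex y hy)
      · simp only [hcd, if_false]
        exact k₂ c (Finset.mem_filter.2 ⟨hc, hcd⟩) fun h hh => hex h (hsub₂ h hh)
    · by_cases hc' : C.Le c d₁ <;> by_cases hd' : C.Le d d₁ <;> simp only [hc', hd', if_true, if_false]
      · exact h₃ c (Finset.mem_filter.2 ⟨hc, hc'⟩) d (Finset.mem_filter.2 ⟨hd, hd'⟩) hcd
          fun h hh => hex h (hsub₁ h hh)
      · have hd₂ := (hdich d hd).resolve_left hd'
        rw [k₁ d (Finset.mem_filter.2 ⟨hd, hd'⟩) fun h hh hhd =>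
          hex h (hsub₂ h hh) ⟨hc'.2.trans (hpos₂ h hh), hhd⟩]
        exact h₂ c (Finset.mem_filter.2 ⟨hc, hc'⟩) fun h hh hch =>
          hex h (hsub₁ h hh) ⟨hch, (Finset.mem_filter.1 hh).2.2.trans hd₂⟩
      · have := (hdich c hc).resolve_left hc'
        have := C.lt c
        have := C.lt d
        unfold Le at hd'
        omega
      · exact k₃ c (Finset.mem_filter.2 ⟨hc, hc'⟩) d (Finset.mem_filter.2 ⟨hd, hd'⟩) hcd
          fun h hh => hex h (hsub₂ h hh)

/-- Paths below `m` that touch `m` form a forest together with `m` if any two of them with disjoint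
arcs that meet have a common vertex on `m`. -/
lemma isAcyclic_touch {m : ι} (S : Finset ι) (hS : ∀ c ∈ S, C.Le c m ∧ (C.vs c ∩ C.vs m).Nonempty)
    (hcd : ∀ c ∈ S, ∀ d ∈ S, C.b c ≤ C.a d → (C.vs c ∩ C.vs d).Nonempty →
      ∃ z ∈ C.vs c, z ∈ C.vs d ∧ z ∈ C.vs m) :
    (C.pg m ⊔ ⨆ c ∈ {c | c ∈ S}, C.pg c).IsAcyclic := by
  classical
  induction h : S.card using Nat.strong_induction_on generalizing S with
  | _ N ih =>
  rcases S.eq_empty_or_nonempty with rfl | hne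
  · simpa using pg_isAcyclic m
  obtain ⟨c, hc, hmin⟩ := S.exists_min_image (fun c => C.b c - C.a c) hne
  have hnle : ∀ d ∈ S, d ≠ c → ¬ C.Le d c := by
    intro d hd hdc hle
    have := hmin d hd
    exact hdc (hle.antisymm ⟨by unfold Le at hle; omega, by unfold Le at hle; omega⟩)
  have hac := ih (S.erase c).card (h ▸ Finset.card_erase_lt_of_mem hc) (S.erase c)
    (fun d hd => hS d (Finset.mem_of_mem_erase hd))
    (fun d hd e he => hcd d (Finset.mem_of_mem_erase hd) e (Finset.mem_of_mem_erase he)) rfl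
  set H := C.pg m ⊔ ⨆ d ∈ {d | d ∈ S.erase c}, C.pg d with hH
  have hle : (C.pg m ⊔ ⨆ d ∈ {d | d ∈ S}, C.pg d) ≤ H ⊔ C.pg c := by
    refine sup_le (le_sup_of_le_left le_sup_left) (iSup₂_le fun d hd => ?_)
    by_cases hdc : d = c
    · subst hdc; exact le_sup_right
    · exact le_sup_of_le_left (le_sup_of_le_right
        (pg_le_biSup (C := C) (S := {d | d ∈ S.erase c}) (Finset.mem_erase.2 ⟨hdc, hd⟩)))
  refine IsAcyclic.anti hle (IsAcyclic.sup_of_meetConnected ?_ hac (pg_isAcyclic c))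
  -- Every vertex of the shortest arc `c` shared with the rest is joined, inside the intersection,
  -- to a vertex of `m`; two such vertices of `m` are then joined in the intersection of `c` and
  -- `m`.
  have key : ∀ u, u ∈ H.support → u ∈ C.vs c →
      ∃ z ∈ C.vs c, z ∈ C.vs m ∧ (H ⊓ C.pg c).Reachable u z := by
    intro u hu huc
    rw [hH, mem_support_sup, mem_support_biSup_pg, support_pg] at hu
    rcases hu with hu | ⟨d, hd, hu⟩
    · exact ⟨u, huc, hu, Reachable.refl _⟩
    · have hd' := Finset.mem_erase.1 hd
      have hpd : C.pg d ≤ H := le_sup_of_le_right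
        (pg_le_biSup (C := C) (S := {d | d ∈ S.erase c}) hd)
      have hz : ∃ z ∈ C.vs c, z ∈ C.vs d ∧ z ∈ C.vs m := by
        obtain ⟨z, hzc, hzm⟩ := (hS c hc).2
        by_cases hcle : C.Le c d
        · exact ⟨z, hzc, sep hcle (fun h => h.antisymm (hS d hd'.2).1) hzc hzm, hzm⟩
        · have hdle := hnle d hd'.2 hd'.1
          have := C.laminar c d
          unfold Le at hcle hdle
          have : C.b c ≤ C.a d ∨ C.b d ≤ C.a c := by omega
          rcases this with h | h
          · exact hcd c hc d hd'.2 h ⟨u, huc, hu⟩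
          · obtain ⟨z, h₁, h₂, h₃⟩ := hcd d hd'.2 c hc h ⟨u, hu, huc⟩
            exact ⟨z, h₂, h₁, h₃⟩
      obtain ⟨z, hzc, hzd, hzm⟩ := hz
      exact ⟨z, hzc, hzm, (meet_reachable hu huc hzd hzc).mono (inf_le_inf_right _ hpd)⟩
  intro u v hu hu' hv hv'
  rw [support_pg] at hu' hv'
  obtain ⟨z, hzc, hzm, hz⟩ := key u hu hu'
  obtain ⟨z', hzc', hzm', hz'⟩ := key v hv hv'
  exact hz.trans (((meet_reachable hzm hzc hzm' hzc').mono
    (inf_le_inf_right _ le_sup_left)).trans hz'.symm)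

end ChordSystem

/-! ### A direct labeling: four groups of three labels -/

namespace ChordSystem

variable {V ι : Type*} {G : SimpleGraph V} {C : ChordSystem G ι}

/-- The paths below `m` that touch it can be coloured with three colours so that each colour class
forms a forest together with `m`. -/
lemma exists_touch_coloring (m : ι) (T : Finset ι)
    (hT : ∀ c ∈ T, C.Le c m ∧ (C.vs c ∩ C.vs m).Nonempty) :
    ∃ κ : ι → Fin 3, ∀ k, (C.pg m ⊔ ⨆ c ∈ {c | c ∈ T ∧ κ c = k}, C.pg c).IsAcyclic := by
  classical
  obtain ⟨κ, -, -, hκ⟩ := exists_laminar_coloring (C := C) T 0 1 2 (by decide) (by decide)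
    (by decide)
  refine ⟨κ, fun k => ?_⟩
  have := isAcyclic_touch (C := C) (m := m) (T.filter fun c => κ c = k)
    (fun c hc => hT c (Finset.mem_filter.1 hc).1) fun c hc d hd hcd hmeet => by
      rw [Finset.mem_filter] at hc hd
      by_contra hcon
      -- Between two disjoint arcs of the same colour there is an arc `h`, which touches `m`. By
      -- `eq_of_linked` the contact of `c` and `d` is the contact of `h` and `m`.
      refine hκ c hc.1 d hd.1 hcd (fun h hh hb => ?_) (hc.2.trans hd.2.symm)
      obtain ⟨w, hwc, hwd⟩ := hmeet
      obtain ⟨z, hzh, hzm⟩ := (hT h hh).2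
      obtain rfl := eq_of_linked (linked_of_le hb.1 hb.2 (hT c hc.1).1 (hT d hd.1).1)
        hwc hwd hzh hzm
      exact hcon ⟨w, hwc, hwd, hzm⟩
  simpa only [Finset.mem_filter] using this

/-- The paths of a finite set can be labeled with `12` labels, in four groups of three, so that the
paths of each label form a forest and the paths of one given group are disjoint from some path
above them. -/
lemma exists_grouped_labeling (F : Finset ι) (t₀ : Fin 4) :
    ∃ (τ : ι → Fin 4) (κ : ι → Fin 3),
      (∀ c k, (⨆ i ∈ {i | i ∈ F ∧ τ i = c ∧ κ i = k}, C.pg i).IsAcyclic) ∧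
      ∀ q ∈ F, τ q = t₀ → ∃ m ∈ F, C.Le q m ∧ ∀ z ∈ C.vs q, z ∉ C.vs m := by
  classical
  induction h : F.card using Nat.strong_induction_on generalizing F t₀ with
  | _ N ih =>
  set M := F.filter fun m => ∀ x ∈ F, C.Le m x → x = m with hM
  have hanti : ∀ i ∈ M, ∀ j ∈ M, i ≠ j → C.b i ≤ C.a j ∨ C.b j ≤ C.a i := by
    intro i hi j hj hij
    rw [hM, Finset.mem_filter] at hi hj
    rcases C.laminar i j with h | h | h | h
    · exact absurd (hi.2 j hj.1 h).symm hij
    · exact absurd (hj.2 i hi.1 h) hij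
    · exact Or.inl h
    · exact Or.inr h
  obtain ⟨τA, hτA, hacA⟩ := exists_antichain_coloring t₀ M hanti
  have htop : ∀ x ∈ F, ∃ m ∈ M, C.Le x m := by
    intro x hx
    obtain ⟨m, hm, hmax⟩ := (F.filter fun y => C.Le x y).exists_max_image
      (fun y => C.b y - C.a y) ⟨x, Finset.mem_filter.2 ⟨hx, Le.refl x⟩⟩
    rw [Finset.mem_filter] at hm
    refine ⟨m, Finset.mem_filter.2 ⟨hm.1, fun y hy hmy => ?_⟩, hm.2⟩
    have := hmax y (Finset.mem_filter.2 ⟨hy, hm.2.trans hmy⟩)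
    exact (hmy.antisymm ⟨by unfold Le at hmy; omega, by unfold Le at hmy; omega⟩).symm
  choose! top htopM htop using htop
  have hMF : ∀ m ∈ M, m ∈ F := fun m hm => (Finset.mem_filter.1 hm).1
  have huniq : ∀ x, ∀ m ∈ M, ∀ m' ∈ M, C.Le x m → C.Le x m' → m = m' := by
    intro x m hm m' hm' h h'
    by_contra hne
    have := hanti m hm m' hm' hne
    have := C.lt x
    unfold Le at h h'
    omega
  set Tm : ι → Finset ι := fun m => F.filter fun x => C.Le x m ∧ (C.vs x ∩ C.vs m).Nonempty
    with hTm
  set Dm : ι → Finset ι := fun m => F.filter fun x => C.Le x m ∧ ¬ (C.vs x ∩ C.vs m).Nonempty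
    with hDm
  have hmm : ∀ m, (C.vs m ∩ C.vs m).Nonempty := fun m => ⟨C.f m 0, f_mem (Nat.zero_le _),
    f_mem (Nat.zero_le _)⟩
  have hT := fun m => exists_touch_coloring (C := C) m (Tm m) fun c hc => (Finset.mem_filter.1 hc).2
  choose κT hκT using hT
  -- The recursion treats the paths missing `m` and restricts the group of `m`: a path in that group
  -- misses some path above it which itself misses `m`, and this shields it from `m` and from the
  -- paths touching `m`.
  have hD : ∀ m ∈ M, ∃ (τ : ι → Fin 4) (κ : ι → Fin 3),
      (∀ c k, (⨆ i ∈ {i | i ∈ Dm m ∧ τ i = c ∧ κ i = k}, C.pg i).IsAcyclic) ∧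
      ∀ q ∈ Dm m, τ q = τA m → ∃ m' ∈ Dm m, C.Le q m' ∧ ∀ z ∈ C.vs q, z ∉ C.vs m' := by
    intro m hm
    refine ih (Dm m).card (h ▸ Finset.card_lt_card ?_) (Dm m) (τA m) rfl
    exact Finset.filter_ssubset.2 ⟨m, hMF m hm, fun h => h.2 (hmm m)⟩
  choose! τD κD hacD hdeep using hD
  set τ : ι → Fin 4 := fun x => if (C.vs x ∩ C.vs (top x)).Nonempty then τA (top x)
    else τD (top x) x with hτ
  set κ : ι → Fin 3 := fun x => if (C.vs x ∩ C.vs (top x)).Nonempty then κT (top x) x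
    else κD (top x) x with hκ
  have hsep : ∀ x y m m', m ∈ M → m' ∈ M → m ≠ m' → C.Le x m → C.Le y m' → ∀ u, u ∈ C.vs x →
      u ∈ C.vs y → u ∈ C.vs m := by
    intro x y m m' hm hm' hne hx hy u hux huy
    refine sep hx (fun hle => ?_) hux huy
    exact absurd (huniq y m hm m' hm' hle hy) hne
  refine ⟨τ, κ, fun c k => ?_, fun q hq hqt => ?_⟩
  -- For a fixed label, `U` consists of the outermost paths of the group, `H m` of `m` and the paths
  -- touching it, `D m` of the recursive part below `m`.
  · set A := {m | m ∈ M ∧ τA m = c} with hA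
    set U : SimpleGraph V := ⨆ m ∈ A, C.pg m with hU
    set H : ι → SimpleGraph V := fun m =>
      C.pg m ⊔ ⨆ x ∈ {x | x ∈ Tm m ∧ κT m x = k}, C.pg x with hH
    set D : ι → SimpleGraph V := fun m =>
      ⨆ x ∈ {x | x ∈ Dm m ∧ τD m x = c ∧ κD m x = k}, C.pg x with hDdef
    have hAfin : A.Finite := M.finite_toSet.subset fun m hm => hm.1
    have hHs : ∀ m u, u ∈ (H m).support → ∃ x, C.Le x m ∧ (C.vs x ∩ C.vs m).Nonempty ∧
        u ∈ C.vs x := by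
      intro m u hu
      rw [hH, mem_support_sup, mem_support_biSup_pg, support_pg] at hu
      rcases hu with hu | ⟨x, hx, hu⟩
      · exact ⟨m, Le.refl m, hmm m, hu⟩
      · exact ⟨x, (Finset.mem_filter.1 hx.1).2.1, (Finset.mem_filter.1 hx.1).2.2, hu⟩
    have hDs : ∀ m u, u ∈ (D m).support → ∃ x ∈ Dm m, τD m x = c ∧ C.Le x m ∧
        ¬ (C.vs x ∩ C.vs m).Nonempty ∧ u ∈ C.vs x := by
      intro m u hu
      rw [hDdef, mem_support_biSup_pg] at hu
      obtain ⟨x, hx, hu⟩ := hu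
      exact ⟨x, hx.1, hx.2.1, (Finset.mem_filter.1 hx.1).2.1, (Finset.mem_filter.1 hx.1).2.2, hu⟩
    -- By `sep`, `H m` meets the other pieces only on `m`, which is connected and contained in `U`.
    have hW : (U ⊔ ⨆ m ∈ A, H m).IsAcyclic := by
      refine isAcyclic_sup_biSup hAfin (hacA c) (fun m _ => hκT m k) ?_
      intro m hm u v hu hv hu' hv'
      have key : ∀ u, u ∈ (H m).support →
          (u ∈ U.support ∨ ∃ j ∈ A, j ≠ m ∧ u ∈ (H j).support) → u ∈ C.vs m := by
        intro u hu hu'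
        obtain ⟨x, hxm, -, hux⟩ := hHs m u hu
        rcases hu' with hu' | ⟨j, hj, hjm, hu'⟩
        · rw [hU, mem_support_biSup_pg] at hu'
          obtain ⟨j, hj, huj⟩ := hu'
          by_cases hjm : j = m
          · exact hjm ▸ huj
          · exact hsep x j m j hm.1 hj.1 (Ne.symm hjm) hxm (Le.refl j) u hux huj
        · obtain ⟨y, hyj, -, huy⟩ := hHs j u hu'
          exact hsep x y m j hm.1 hj.1 hjm.symm hxm hyj u hux huy
      exact (pg_reachable (key u hu hu') (key v hv hv')).mono
        (le_inf (pg_le_biSup (C := C) hm) le_sup_left)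
    have hWs : ∀ u, u ∈ (U ⊔ ⨆ m ∈ A, H m).support → ∃ m ∈ A, u ∈ (H m).support := by
      intro u hu
      rw [mem_support_sup, hU, mem_support_biSup_pg, mem_support_biSup] at hu
      rcases hu with ⟨m, hm, hu⟩ | hu
      · refine ⟨m, hm, ?_⟩
        rw [hH, mem_support_sup, support_pg]
        exact Or.inl hu
      · exact hu
    -- `D m` is disjoint from the other pieces: from other branches by `sep`, from its own branch by
    -- the shielding path.
    have hall : ((U ⊔ ⨆ m ∈ A, H m) ⊔ ⨆ m ∈ {m | m ∈ M}, D m).IsAcyclic := by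
      refine isAcyclic_sup_biSup M.finite_toSet hW (fun m hm => hacD m hm c k) ?_
      intro m hm u v hu _ hu' _
      exfalso
      obtain ⟨x, hxD, hxc, hxm, hxn, hux⟩ := hDs m u hu
      have hum : u ∉ C.vs m := fun h => hxn ⟨u, hux, h⟩
      rcases hu' with hu' | ⟨j, hj, hjm, hu'⟩
      · obtain ⟨j, hj, hu'⟩ := hWs u hu'
        obtain ⟨y, hyj, hyn, huy⟩ := hHs j u hu'
        by_cases hjm : j = m
        · subst hjm
          obtain ⟨m', hm', hxm', hdis⟩ := hdeep j hm x hxD (hxc.trans hj.2.symm)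
          obtain ⟨-, hm'j, hm'n⟩ := Finset.mem_filter.1 hm'
          refine hdis u hux (sep hxm' (fun hle => ?_) hux huy)
          obtain ⟨z, hzy, hzj⟩ := hyn
          refine absurd ⟨z, sep hle (fun h => ?_) hzy hzj, hzj⟩ hm'n
          exact h.antisymm hm'j
        · exact hum (hsep x y m j hm hj.1 (Ne.symm hjm) hxm hyj u hux huy)
      · obtain ⟨y, -, -, hyj, -, huy⟩ := hDs j u hu'
        exact hum (hsep x y m j hm hj hjm.symm hxm hyj u hux huy)
    refine IsAcyclic.anti (iSup₂_le fun x hx => ?_) hall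
    obtain ⟨hxF, hxτ, hxκ⟩ := hx
    by_cases hxt : (C.vs x ∩ C.vs (top x)).Nonempty
    · simp only [hτ, hκ, hxt, if_true] at hxτ hxκ
      refine le_sup_of_le_left (le_sup_of_le_right
        (le_iSup₂_of_le (top x) ⟨htopM x hxF, hxτ⟩ (le_sup_of_le_right ?_)))
      exact pg_le_biSup (C := C) (S := {y | y ∈ Tm (top x) ∧ κT (top x) y = k})
        ⟨Finset.mem_filter.2 ⟨hxF, htop x hxF, hxt⟩, hxκ⟩
    · simp only [hτ, hκ, hxt, if_false] at hxτ hxκ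
      refine le_sup_of_le_right (le_iSup₂_of_le (top x) (htopM x hxF) ?_)
      exact pg_le_biSup (C := C) (S := {y | y ∈ Dm (top x) ∧ τD (top x) y = c ∧ κD (top x) y = k})
        ⟨Finset.mem_filter.2 ⟨hxF, htop x hxF, hxt⟩, hxτ, hxκ⟩
  · refine ⟨top q, hMF _ (htopM q hq), htop q hq, fun z hz hz' => ?_⟩
    have hqn : (C.vs q ∩ C.vs (top q)).Nonempty := ⟨z, hz, hz'⟩
    simp only [hτ, hqn, if_true] at hqt
    exact hτA _ (htopM q hq) hqt

/-- The paths of a finite system of chords can be labeled with `15` labels so that the paths of each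
label form a forest. -/
theorem exists_forest_labeling [Finite ι] (C : ChordSystem G ι) :
    ∃ L : ι → Fin 15, ∀ c, (⨆ i ∈ {i | L i = c}, C.pg i).IsAcyclic := by
  have := Fintype.ofFinite ι
  obtain ⟨τ, κ, h, -⟩ := exists_grouped_labeling (C := C) Finset.univ 0
  -- The number encodes the group and the label inside it; its values stay below `12`.
  refine ⟨fun i => ⟨3 * (τ i : ℕ) + κ i, by omega⟩, fun c => ?_⟩
  by_cases hc : ∃ i, (⟨3 * (τ i : ℕ) + κ i, by omega⟩ : Fin 15) = c
  · obtain ⟨i, rfl⟩ := hc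
    refine IsAcyclic.anti (iSup₂_le fun j hj => ?_) (h (τ i) (κ i))
    have hj' := congrArg Fin.val (show (⟨3 * (τ j : ℕ) + κ j, by omega⟩ : Fin 15) = _ from hj)
    simp only at hj'
    exact pg_le_biSup (C := C) (S := {j | j ∈ Finset.univ ∧ τ j = τ i ∧ κ j = κ i})
      ⟨Finset.mem_univ _, Fin.ext (by omega), Fin.ext (by omega)⟩
  · refine IsAcyclic.anti (G' := ⊥) (iSup₂_le fun j hj => ?_) isAcyclic_bot
    exact absurd ⟨j, hj⟩ hc

end ChordSystem

/-! ### Chord systems from terminal arcs -/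

namespace PathFamily

variable {V : Type*} {G : SimpleGraph V} {ι : Type*} (P : PathFamily G ι)

/-- The union of some of the paths, as a graph. -/
def unionGraph (S : Set ι) : SimpleGraph V where
  Adj u v := ∃ i ∈ S, s(u, v) ∈ (P.path i).edges
  symm := ⟨fun u v h => by simpa only [Sym2.eq_swap (a := v)] using h⟩
  loopless := ⟨fun u ⟨i, _, h⟩ => G.loopless.irrefl u ((P.path i).edges_subset_edgeSet h)⟩

variable {P}

lemma isForest_of_isAcyclic {S : Set ι} (h : (P.unionGraph S).IsAcyclic) :
    IsForest (⨆ i ∈ S, P.sub i) := by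
  refine h.comap (G := (⨆ i ∈ S, P.sub i).coe) ⟨fun v => v.1, ?_⟩ Subtype.val_injective
  intro u v huv
  rw [Subgraph.coe_adj] at huv
  simp only [Subgraph.iSup_adj] at huv
  obtain ⟨i, hi, h⟩ := huv
  exact ⟨i, hi, (Walk.adj_toSubgraph_iff_mem_edges).1 h⟩

end PathFamily

namespace PlaneGraph

variable {V : Type*} [Fintype V] (G : PlaneGraph V)

lemma reachable_corner (e : G.graph.Dart) (k : ℕ) : G.graph.Reachable e.fst (G.corner e k) := by
  induction k with
  | zero => exact Reachable.refl _
  | succ k ih =>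
    rw [corner_succ]
    exact ih.trans ((G.face)^[k] e).adj.reachable

end PlaneGraph

lemma reachable_of_mem_support {V : Type*} {G K : SimpleGraph V} {u v : V} (w : G.Walk u v)
    (hw : ∀ e ∈ w.edges, e ∈ K.edgeSet) {z : V} (hz : z ∈ w.support) : K.Reachable u z := by
  classical
  exact ⟨(w.takeUntil z hz).transfer K fun e he => hw e (w.edges_takeUntil_subset_edges hz he)⟩

namespace TerminalArcs

variable {V : Type*} [Fintype V] {G : PlaneGraph V} {ι : Type*} {P : PathFamily G.graph ι}
  (A : TerminalArcs G P)

/-- The path `i`, directed from the beginning to the end of the arc `γ_i`. -/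
lemma exists_oriented (i : ι) :
    ∃ w : G.graph.Walk (G.corner (A.base i) (A.a i)) (G.corner (A.base i) (A.b i)),
      w.IsPath ∧ w.toSubgraph = P.sub i := by
  have h := A.ends i
  rw [Sym2.eq_iff] at h
  rcases h with ⟨h₁, h₂⟩ | ⟨h₁, h₂⟩
  · rw [h₁, h₂]
    exact ⟨P.path i, P.isPath i, rfl⟩
  · rw [h₁, h₂]
    exact ⟨(P.path i).reverse, (P.isPath i).reverse, Walk.toSubgraph_reverse _⟩

/-- The paths whose terminals lie on a given boundary walk form a system of chords. -/
theorem exists_chordSystem (hP : IsNCS G P) (e : G.graph.Dart) {κ : Type*} (σ : κ → ι)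
    (hσ : Function.Injective σ) (he : ∀ i, A.base (σ i) = e) :
    ∃ C : ChordSystem G.graph κ, (∀ i, C.a i = A.a (σ i)) ∧ (∀ i, C.b i = A.b (σ i)) ∧
      (∀ i v, v ∈ C.vs i ↔ v ∈ (P.path (σ i)).support) ∧
      ∀ i u v, (C.pg i).Adj u v ↔ s(u, v) ∈ (P.path (σ i)).edges := by
  have hw : ∀ i, ∃ w : G.graph.Walk (G.corner e (A.a (σ i))) (G.corner e (A.b (σ i))),
      w.IsPath ∧ w.toSubgraph = P.sub (σ i) := by
    intro i
    have := A.exists_oriented (σ i)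
    rwa [he i] at this
  choose w hwp hws using hw
  have hends : ∀ i, s(G.corner e (A.a (σ i)), G.corner e (A.b (σ i))) =
      s(P.x (σ i), P.y (σ i)) := fun i => by rw [← A.ends (σ i), he i]
  have hne : ∀ i, G.corner e (A.a (σ i)) ≠ G.corner e (A.b (σ i)) := by
    intro i h
    have h' := hends i
    rw [h, Sym2.eq_iff] at h'
    have := hP.ends_ne (σ i)
    rcases h' with ⟨h₁, h₂⟩ | ⟨h₁, h₂⟩
    · exact this (h₁.symm.trans h₂)
    · exact this (h₂.symm.trans h₁)
  have hlt : ∀ i, A.a (σ i) < A.b (σ i) := fun i =>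
    lt_of_le_of_ne (A.a_le_b _) fun h => hne i (by rw [h])
  have hpg : ∀ i u v, (segGraph (w i).getVert 0 (w i).length).Adj u v ↔ (P.sub (σ i)).Adj u v := by
    intro i u v
    rw [← hws i, Walk.toSubgraph_adj_iff]
    constructor
    · rintro ⟨-, k, -, hk, h⟩
      exact ⟨k, h.symm, hk⟩
    · rintro ⟨k, h, hk⟩
      refine ⟨?_, k, Nat.zero_le _, hk, h.symm⟩
      have := (w i).adj_getVert_succ hk
      rcases Sym2.eq_iff.1 h with ⟨rfl, rfl⟩ | ⟨rfl, rfl⟩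
      · exact this.ne
      · exact this.ne.symm
  have hvs : ∀ i v, (∃ k ≤ (w i).length, (w i).getVert k = v) ↔ v ∈ (P.sub (σ i)).verts := by
    intro i v
    rw [← hws i, Walk.verts_toSubgraph, Set.mem_ofPred_eq, Walk.mem_support_iff_exists_getVert]
    exact ⟨fun ⟨k, h₁, h₂⟩ => ⟨k, h₂, h₁⟩, fun ⟨k, h₁, h₂⟩ => ⟨k, h₂, h₁⟩⟩
  have hend : ∀ i (p : Bool), cond p ((w i).getVert (w i).length) ((w i).getVert 0) =
      G.corner e (cond p (A.b (σ i)) (A.a (σ i))) := by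
    intro i p
    cases p <;> simp
  have hpos : ∀ i (p : Bool), cond p (A.b (σ i) : ℤ) (A.a (σ i)) =
      ((cond p (A.b (σ i)) (A.a (σ i)) : ℕ) : ℤ) := by
    intro i p
    cases p <;> simp
  refine ⟨{ n := fun i => (w i).length
            f := fun i => (w i).getVert
            a := fun i => A.a (σ i)
            b := fun i => A.b (σ i)
            pos := fun i => ?_
            adj := fun i k hk => (w i).adj_getVert_succ hk
            inj := fun i k l hk hl h => (hwp i).getVert_injOn hk hl h
            lt := fun i => by exact_mod_cast hlt i
            laminar := fun i j => ?_
            ext := fun i j h₁ h₂ => ?_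
            link := fun i j k l p q r s h₁ h₂ h₃ B D => ?_
            touch := fun i j k k' l l' hk hk' hl hl' h h' => ?_ },
    fun _ => rfl, fun _ => rfl, fun i v => ?_, fun i u v => ?_⟩
  · rw [Nat.pos_iff_ne_zero]
    intro h
    exact hne i (Walk.eq_of_length_eq_zero h)
  · have h₁ := hlt i
    have h₂ := hlt j
    rcases A.laminar (σ i) (σ j) ((he i).trans (he j).symm) with h | h | h
    · rw [Finset.Ico_subset_Ico_iff h₁] at h
      left; exact_mod_cast h
    · rw [Finset.Ico_subset_Ico_iff h₂] at h
      right; left; exact_mod_cast h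
    · have ha := Finset.disjoint_left.1 h |> fun H => @H (A.a (σ i))
      have hb := Finset.disjoint_left.1 h |> fun H => @H (A.a (σ j))
      simp only [Finset.mem_Ico] at ha hb
      omega
  · have h₁ : A.a (σ i) = A.a (σ j) := by exact_mod_cast h₁
    have h₂ : A.b (σ i) = A.b (σ j) := by exact_mod_cast h₂
    refine hσ (hP.pairs_distinct ?_)
    change s(P.x (σ i), P.y (σ i)) = s(P.x (σ j), P.y (σ j))
    rw [← hends, ← hends, h₁, h₂]
  · rw [hpos, hpos, Nat.cast_le] at h₁ h₂ h₃
    -- `walks_meet` needs corners numbered from `1` to the length of the face, which holds because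
    -- the arcs avoid the cut.
    have hb : ∀ i (p : Bool), 1 ≤ cond p (A.b (σ i)) (A.a (σ i)) ∧
        cond p (A.b (σ i)) (A.a (σ i)) ≤ G.faceLength e := by
      intro i p
      have h₁ := A.one_le_a (σ i)
      have h₂ := A.a_le_b (σ i)
      have h₃ := A.b_le (σ i)
      rw [he i] at h₃
      cases p <;> simp only [cond_true, cond_false] <;> omega
    obtain ⟨z, hz, hz'⟩ := G.walks_meet e (hb i p).1 h₁ h₂ h₃ (hb l s).2
      (B.copy (hend i p) (hend k r)) (D.copy (hend j q) (hend l s))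
    exact ⟨z, by simpa using hz, by simpa using hz'⟩
  · have hui : (w i).getVert k ∈ (P.sub (σ i)).verts := (hvs i _).1 ⟨k, hk, rfl⟩
    have huj : (w i).getVert k ∈ (P.sub (σ j)).verts := (hvs j _).1 ⟨k', hk', h.symm⟩
    have hvi : (w i).getVert l ∈ (P.sub (σ i)).verts := (hvs i _).1 ⟨l, hl, rfl⟩
    have hvj : (w i).getVert l ∈ (P.sub (σ j)).verts := (hvs j _).1 ⟨l', hl', h'.symm⟩
    rcases hP.singleTouch (σ i) (σ j) with h₀ | ⟨x, y, t, -, ht⟩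
    · have : (w i).getVert k ∈ (P.sub (σ i) ⊓ P.sub (σ j)).verts := ⟨hui, huj⟩
      rw [h₀] at this
      exact absurd this (Set.notMem_empty _)
    · have hmem : ∀ z, z ∈ (P.sub (σ i)).verts → z ∈ (P.sub (σ j)).verts → z ∈ t.support := by
        intro z h₁ h₂
        have : z ∈ (P.sub (σ i) ⊓ P.sub (σ j)).verts := ⟨h₁, h₂⟩
        rw [ht] at this
        exact (Walk.mem_verts_toSubgraph t).1 this
      have hed : ∀ d ∈ t.edges, d ∈ (segGraph (w i).getVert 0 (w i).length ⊓
          segGraph (w j).getVert 0 (w j).length).edgeSet := by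
        intro d hd
        induction d with
        | h a b =>
          have : t.toSubgraph.Adj a b := (Walk.adj_toSubgraph_iff_mem_edges).2 hd
          rw [← ht, Subgraph.inf_adj] at this
          exact ⟨(hpg i a b).2 this.1, (hpg j a b).2 this.2⟩
      exact (reachable_of_mem_support t hed (hmem _ hui huj)).symm.trans
        (reachable_of_mem_support t hed (hmem _ hvi hvj))
  · refine (hvs i v).trans ?_
    rw [PathFamily.sub, Walk.verts_toSubgraph, Set.mem_ofPred_eq]
  · exact (hpg i u v).trans Walk.adj_toSubgraph_iff_mem_edges

end TerminalArcs

/-- A set of non-crossing shortest paths has a labeling with `15` labels for which the union of the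
paths of each label has no cycle. -/
theorem IsNCS.exists_labeling {V : Type*} [Fintype V] {G : PlaneGraph V} {ι : Type*} [Finite ι]
    {P : PathFamily G.graph ι} (hP : IsNCS G P) :
    ∃ L : ι → Fin 15, ∀ c, (P.unionGraph {i | L i = c}).IsAcyclic := by
  obtain ⟨A⟩ := hP.wellFormed
  have hC := fun e => A.exists_chordSystem hP e (κ := {i // A.base i = e}) Subtype.val
    Subtype.val_injective fun i => i.2
  choose C hCa hCb hCv hCe using hC
  have hL := fun e => (C e).exists_forest_labeling
  choose L hL using hL
  refine ⟨fun i => L (A.base i) ⟨i, rfl⟩, fun c => ?_⟩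
  -- Different cuts lie in different components, so the forests of different boundary walks are
  -- disjoint.
  have hac : (⨆ e ∈ Set.range A.base, ⨆ i ∈ {i | L e i = c}, (C e).pg i).IsAcyclic := by
    refine isAcyclic_biSup_of_disjoint (Set.finite_range _) (fun e _ => hL e c) ?_
    have hr : ∀ e u, u ∈ (⨆ i ∈ {i | L e i = c}, (C e).pg i).support →
        ∃ i, A.base i = e ∧ G.graph.Reachable e.fst u := by
      intro e u hu
      rw [ChordSystem.mem_support_biSup_pg] at hu
      obtain ⟨i, -, hu⟩ := hu
      rw [hCv] at hu
      refine ⟨i.1, i.2, ?_⟩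
      have h₁ := G.reachable_corner e (A.a i.1)
      have h₂ : G.graph.Reachable (P.x i.1) u :=
        reachable_of_mem_support (P.path i.1) (fun d hd => (P.path i.1).edges_subset_edgeSet hd) hu
      have h₃ := A.ends i.1
      rw [Sym2.eq_iff, i.2] at h₃
      rcases h₃ with ⟨h₃, -⟩ | ⟨h₃, -⟩
      · rw [h₃] at h₁; exact h₁.trans h₂
      · rw [h₃] at h₁; exact h₁.trans ((P.path i.1).reachable.symm.trans h₂)
    rintro e - e' - hne u hu hu'
    obtain ⟨i, rfl, hi⟩ := hr e u hu
    obtain ⟨j, rfl, hj⟩ := hr e' u hu'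
    exact hne (A.base_eq i j (hi.trans hj.symm))
  refine hac.anti fun u v ⟨i, hi, h⟩ => ?_
  simp only [iSup_adj]
  exact ⟨A.base i, ⟨i, rfl⟩, ⟨i, rfl⟩, hi, (hCe _ _ _ _).2 h⟩

/-! ### A path and its two children -/

namespace ChordSystem

variable {V ι : Type*} {G : SimpleGraph V} {C : ChordSystem G ι}

/-- The union of three paths. -/
def trio (C : ChordSystem G ι) (q r l : ι) : SimpleGraph V := C.pg q ⊔ C.pg r ⊔ C.pg l

lemma trio_comm (q r l : ι) : C.trio q r l = C.trio q l r := sup_right_comm _ _ _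

/-- `r` and `l` are the right child and the left child of `q`, and they form a cycle with `q`. -/
structure Trio (C : ChordSystem G ι) (q r l : ι) : Prop where
  le_right : C.Le r q
  le_left : C.Le l q
  right_ne : r ≠ q
  left_ne : l ≠ q
  disj : C.b r ≤ C.a l
  cover : ∀ m, C.Le m q → m ≠ q → C.Le m r ∨ C.Le m l
  cyclic : ¬ (C.trio q r l).IsAcyclic

/-- `e` is an extremal edge of the face formed by `q` and its children `r` and `l`, and it belongs
to `r`. -/
structure ExtEdge (C : ChordSystem G ι) (q r l : ι) (e : Sym2 V) : Prop where
  mem : e ∈ (C.pg r).edgeSet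
  notMem : e ∉ (C.pg q).edgeSet
  touch : ∃ u ∈ e, u ∈ C.vs q
  cycle : ∃ (v : V) (c : (C.trio q r l).Walk v v), c.IsCycle ∧ e ∈ c.edges

/-- `β` is the last index on `r` of a vertex of `q`. -/
def LastIndex (C : ChordSystem G ι) (q r : ι) (β : ℕ) : Prop :=
  β ≤ C.n r ∧ C.f r β ∈ C.vs q ∧ ∀ k ≤ C.n r, C.f r k ∈ C.vs q → k ≤ β

lemma exists_lastIndex {q r : ι} (h : ∃ v, v ∈ C.vs r ∧ v ∈ C.vs q) :
    ∃ β, C.LastIndex q r β := by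
  classical
  obtain ⟨v, ⟨k, hk, rfl⟩, hkq⟩ := h
  refine ⟨Nat.findGreatest (fun k => C.f r k ∈ C.vs q) (C.n r), Nat.findGreatest_le _,
    Nat.findGreatest_spec (P := fun k => C.f r k ∈ C.vs q) hk hkq, fun m hm hmq => ?_⟩
  exact Nat.le_findGreatest hm hmq

lemma meetConnected_pg (i j : ι) : MeetConnected (C.pg i) (C.pg j) := by
  intro u v hu hu' hv hv'
  rw [support_pg] at hu hu' hv hv'
  exact meet_reachable hu hu' hv hv'

lemma sup_pg_isAcyclic (i j : ι) : (C.pg i ⊔ C.pg j).IsAcyclic :=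
  IsAcyclic.sup_of_meetConnected (meetConnected_pg i j) (pg_isAcyclic i) (pg_isAcyclic j)

/-- Every contact of `l` with `q` or `r` is joined to `z` along the intersection, so `l` can be
glued. Together with `trio_isAcyclic_of_disjoint`, this shows that a cyclic trio meets pairwise but
has no common vertex. -/
lemma trio_isAcyclic_of_mem {q r l : ι} {z : V} (hq : z ∈ C.vs q) (hr : z ∈ C.vs r)
    (hl : z ∈ C.vs l) : (C.trio q r l).IsAcyclic := by
  refine IsAcyclic.sup_of_meetConnected ?_ (sup_pg_isAcyclic q r) (pg_isAcyclic l)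
  have key : ∀ u, u ∈ (C.pg q ⊔ C.pg r).support → u ∈ (C.pg l).support →
      ((C.pg q ⊔ C.pg r) ⊓ C.pg l).Reachable u z := by
    intro u hu hu'
    rw [mem_support_sup, support_pg, support_pg] at hu
    rw [support_pg] at hu'
    rcases hu with hu | hu
    · exact (meet_reachable hu hu' hq hl).mono (inf_le_inf_right _ le_sup_left)
    · exact (meet_reachable hu hu' hr hl).mono (inf_le_inf_right _ le_sup_right)
  exact fun u v hu hu' hv hv' => (key u hu hu').trans (key v hv hv').symm

lemma trio_isAcyclic_of_disjoint {q r l : ι} (h : ∀ z, z ∈ C.vs q → z ∉ C.vs r) :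
    (C.trio q r l).IsAcyclic := by
  rw [trio, sup_right_comm]
  refine IsAcyclic.sup_of_meetConnected ?_ (sup_pg_isAcyclic q l) (pg_isAcyclic r)
  intro u v hu hu' hv hv'
  rw [mem_support_sup, support_pg, support_pg] at hu hv
  rw [support_pg] at hu' hv'
  have hul := hu.resolve_left fun hu => h u hu hu'
  have hvl := hv.resolve_left fun hv => h v hv hv'
  exact (meet_reachable hul hu' hvl hv').mono (inf_le_inf_right _ le_sup_right)

namespace Trio

variable {q r l : ι}

lemma mirror (h : C.Trio q r l) : C.mirror.Trio q l r where
  le_right := mirror_le.2 h.le_left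
  le_left := mirror_le.2 h.le_right
  right_ne := h.left_ne
  left_ne := h.right_ne
  disj := neg_le_neg h.disj
  cover m hm hne := by
    rw [mirror_le] at hm ⊢
    rw [mirror_le]
    exact (h.cover m hm hne).symm
  cyclic := by
    have := h.cyclic
    rw [trio_comm] at this
    simpa only [trio, mirror_pg] using this

lemma no_common (h : C.Trio q r l) {z : V} (hq : z ∈ C.vs q) (hr : z ∈ C.vs r) : z ∉ C.vs l :=
  fun hl => h.cyclic (trio_isAcyclic_of_mem hq hr hl)

lemma right_meets (h : C.Trio q r l) : ∃ v, v ∈ C.vs r ∧ v ∈ C.vs q := by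
  by_contra! hcon
  exact h.cyclic (trio_isAcyclic_of_disjoint fun z hz hz' => hcon z hz' hz)

lemma children_meet (h : C.Trio q r l) : ∃ v, v ∈ C.vs r ∧ v ∈ C.vs l := by
  by_contra! hcon
  refine h.cyclic ?_
  have := trio_isAcyclic_of_disjoint (C := C) (q := r) (r := l) (l := q) hcon
  have e : C.trio q r l = C.trio r l q := by
    rw [trio, trio, sup_assoc, sup_comm]
  rwa [e]

lemma not_le (h : C.Trio q r l) {x y : ι} (hx : C.Le x r) (hy : C.Le y l) : ¬ C.Le x y := by
  intro hxy
  have := h.disj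
  have := C.lt x
  unfold Le at *
  omega

lemma not_ge (h : C.Trio q r l) {x y : ι} (hx : C.Le x r) (hy : C.Le y l) : ¬ C.Le y x := by
  intro hxy
  have := h.disj
  have := C.lt y
  unfold Le at *
  omega

lemma not_le_right (h : C.Trio q r l) : ¬ C.Le q r := fun hq =>
  h.right_ne (h.le_right.antisymm hq)

lemma not_le_left (h : C.Trio q r l) : ¬ C.Le q l := fun hq => h.left_ne (h.le_left.antisymm hq)

/-- The last contact of `r` with `q` thus splits `r` into a part missing `l` and a part missing `q`.
-/
lemma lt_of_mem_left (h : C.Trio q r l) {k m : ℕ} (hk : k ≤ C.n r) (hm : m ≤ C.n r)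
    (hkq : C.f r k ∈ C.vs q) (hml : C.f r m ∈ C.vs l) : k < m :=
  index_lt_right h.le_left h.disj hk hm hkq hml (h.no_common hkq (f_mem hk))
    fun hmq => h.no_common hmq (f_mem hm) hml

lemma lastIndex_lt (h : C.Trio q r l) {β : ℕ} (hβ : C.LastIndex q r β) : β < C.n r := by
  obtain ⟨_, ⟨m, hm, rfl⟩, hml⟩ := h.children_meet
  exact (h.lt_of_mem_left hβ.1 hm hβ.2.1 hml).trans_le hm

/-- Without the edge following `β`, the first part of `r` meets `q` and `l` only along `q`, and the
second only along `l`; gluing them in turn creates no cycle. -/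
lemma isAcyclic_delete (h : C.Trio q r l) {β : ℕ} (hβ : C.LastIndex q r β) :
    (C.pg q ⊔ C.pg l ⊔ C.seg r 0 β ⊔ C.seg r (β + 1) (C.n r)).IsAcyclic := by
  have hlt := h.lastIndex_lt hβ
  have h₁ : (C.pg q ⊔ C.pg l ⊔ C.seg r 0 β).IsAcyclic := by
    refine IsAcyclic.sup_of_meetConnected ?_ (sup_pg_isAcyclic q l) (seg_isAcyclic hβ.1)
    have key : ∀ u, u ∈ (C.pg q ⊔ C.pg l).support → u ∈ (C.seg r 0 β).support →
        ((C.pg q ⊔ C.pg l) ⊓ C.seg r 0 β).Reachable u (C.f r β) := by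
      intro u hu hu'
      rw [mem_support_sup, support_pg, support_pg] at hu
      obtain ⟨k, -, hk, rfl⟩ := exists_of_mem_support hu'
      have hkq := hu.resolve_right fun hl =>
        absurd (h.lt_of_mem_left hβ.1 (hk.trans hβ.1) hβ.2.1 hl) (by omega)
      exact (seg_reachable le_rfl hk le_rfl hβ.1).mono
        (le_inf ((seg_le_pg hkq hβ.2.1 hβ.1).trans le_sup_left) (seg_mono (Nat.zero_le _) le_rfl))
    exact fun u v hu hu' hv hv' => (key u hu hu').trans (key v hv hv').symm
  refine IsAcyclic.sup_of_meetConnected ?_ h₁ (seg_isAcyclic le_rfl)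
  have key : ∀ u, u ∈ (C.pg q ⊔ C.pg l ⊔ C.seg r 0 β).support →
      u ∈ (C.seg r (β + 1) (C.n r)).support →
      ∃ k, β + 1 ≤ k ∧ k ≤ C.n r ∧ C.f r k = u ∧ u ∈ C.vs l := by
    intro u hu hu'
    obtain ⟨k, hk, hk', rfl⟩ := exists_of_mem_support hu'
    refine ⟨k, hk, hk', rfl, ?_⟩
    rw [mem_support_sup, mem_support_sup, support_pg, support_pg] at hu
    rcases hu with (hu | hu) | hu
    · exact absurd (hβ.2.2 k hk' hu) (by omega)
    · exact hu
    · obtain ⟨m, -, hm, e⟩ := exists_of_mem_support hu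
      have := C.inj r m k (hm.trans hβ.1) hk' e
      omega
  have reach : ∀ k m, β + 1 ≤ k → k ≤ m → m ≤ C.n r → C.f r k ∈ C.vs l → C.f r m ∈ C.vs l →
      ((C.pg q ⊔ C.pg l ⊔ C.seg r 0 β) ⊓ C.seg r (β + 1) (C.n r)).Reachable
        (C.f r k) (C.f r m) := by
    intro k m hk hkm hm hkl hml
    exact (seg_reachable le_rfl hkm le_rfl hm).mono
      (le_inf ((seg_le_pg hkl hml hm).trans (le_sup_right.trans le_sup_left)) (seg_mono hk hm))
  intro u v hu hu' hv hv'
  obtain ⟨k, hk, hk', rfl, hkl⟩ := key u hu hu'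
  obtain ⟨m, hm, hm', rfl, hml⟩ := key v hv hv'
  rcases le_total k m with hkm | hkm
  · exact reach k m hk hkm hm' hkl hml
  · exact (reach m k hm hkm hk' hml hkl).symm

/-- Every cycle formed by `q`, `r` and `l` contains the edge with which `r` leaves `q`. -/
lemma mem_edges_of_lastIndex (h : C.Trio q r l) {β : ℕ} (hβ : C.LastIndex q r β)
    {K : SimpleGraph V} {v : V} {c : K.Walk v v} (hc : c.IsCycle)
    (hcs : ∀ e ∈ c.edges, e ∈ (C.trio q r l).edgeSet) :
    s(C.f r β, C.f r (β + 1)) ∈ c.edges := by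
  by_contra hne
  refine not_isCycle_of_edges_subset (h.isAcyclic_delete hβ) (fun e he => ?_) hc
  have he' := hcs e he
  induction e with
  | h x y =>
    rcases he' with (h' | h') | h'
    · exact Or.inl (Or.inl (Or.inl h'))
    · obtain ⟨hxy, k, -, hk, e⟩ := h'
      rcases lt_trichotomy k β with hkβ | rfl | hkβ
      · exact Or.inl (Or.inr ⟨hxy, k, Nat.zero_le _, hkβ, e⟩)
      · exact absurd he (e ▸ hne)
      · exact Or.inr ⟨hxy, k, hkβ, hk, e⟩
    · exact Or.inl (Or.inl (Or.inr h'))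

lemma extEdge_of_lastIndex (h : C.Trio q r l) {β : ℕ} (hβ : C.LastIndex q r β) :
    C.ExtEdge q r l s(C.f r β, C.f r (β + 1)) where
  mem := pg_adj (h.lastIndex_lt hβ)
  notMem hq := by
    have h₁ := (mem_vs_of_adj (show (C.pg q).Adj _ _ from hq)).2
    have h₂ := h.lastIndex_lt hβ
    have := hβ.2.2 (β + 1) h₂ h₁
    omega
  touch := ⟨C.f r β, Sym2.mem_mk_left _ _, hβ.2.1⟩
  cycle := by
    have := h.cyclic
    rw [IsAcyclic] at this
    push Not at this
    obtain ⟨v, c, hc⟩ := this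
    exact ⟨v, c, hc, h.mem_edges_of_lastIndex hβ hc fun e he => c.edges_subset_edgeSet he⟩

/-- There is only one extremal edge in `r`. -/
lemma eq_of_extEdge (h : C.Trio q r l) {β : ℕ} (hβ : C.LastIndex q r β) {e : Sym2 V}
    (he : C.ExtEdge q r l e) : e = s(C.f r β, C.f r (β + 1)) := by
  obtain ⟨hm, hq, ⟨u, hu, huq⟩, v, c, hc, hec⟩ := he
  have hlt := h.lastIndex_lt hβ
  have : ∃ k < C.n r, e = s(C.f r k, C.f r (k + 1)) := by
    induction e with
    | h x y =>
      obtain ⟨-, k, -, hk, e⟩ := hm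
      exact ⟨k, hk, e⟩
  obtain ⟨k, hk, rfl⟩ := this
  by_cases h₁ : C.f r k ∈ C.vs q
  · have h₂ : C.f r (k + 1) ∉ C.vs q := fun h₂ => hq (adj_of_mem (pg_adj hk) h₁ h₂)
    have h₃ := hβ.2.2 k hk.le h₁
    rcases h₃.lt_or_eq with h₃ | rfl
    · exact absurd (convex h₁ hβ.2.1 (Nat.le_succ k) h₃ hβ.1) h₂
    · rfl
  -- Here the edge would enter `q` at the first contact. The initial part of `r` then hangs at a
  -- single vertex, and no cycle can use it.
  · exfalso
    have h₂ : C.f r (k + 1) ∈ C.vs q := by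
      rcases Sym2.mem_iff.1 hu with rfl | rfl
      · exact absurd huq h₁
      · exact huq
    have hkβ := hβ.2.2 (k + 1) hk h₂
    have hfirst : ∀ m, m ≤ k + 1 → C.f r m ∈ C.vs q → m = k + 1 := by
      intro m hm hmq
      by_contra hne
      exact h₁ (convex hmq h₂ (by omega) (Nat.le_succ k) hk)
    have hmeet : MeetConnected (C.pg q ⊔ C.pg l ⊔ C.seg r (k + 1) (C.n r)) (C.seg r 0 (k + 1)) := by
      have key : ∀ u, u ∈ (C.pg q ⊔ C.pg l ⊔ C.seg r (k + 1) (C.n r)).support →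
          u ∈ (C.seg r 0 (k + 1)).support → u = C.f r (k + 1) := by
        intro u hu hu'
        obtain ⟨m, -, hm, rfl⟩ := exists_of_mem_support hu'
        rw [mem_support_sup, mem_support_sup, support_pg, support_pg] at hu
        rcases hu with (hu | hu) | hu
        · rw [hfirst m hm hu]
        · have := h.lt_of_mem_left hβ.1 (by omega) hβ.2.1 hu
          omega
        · obtain ⟨m', hm', hmn, e⟩ := exists_of_mem_support hu
          have := C.inj r m' m hmn (by omega) e
          rw [show m = k + 1 by omega]
      intro u v hu hu' hv hv'
      rw [key u hu hu', key v hv hv']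
    have hsub := edges_subset_of_meetConnected hmeet (seg_isAcyclic hk) hc (by
      intro e he
      have he' := c.edges_subset_edgeSet he
      induction e with
      | h x y =>
        rcases he' with (h' | h') | h'
        · exact Or.inl (Or.inl (Or.inl h'))
        · obtain ⟨hxy, m, -, hm, e⟩ := h'
          rcases lt_or_ge m (k + 1) with hmk | hmk
          · exact Or.inr ⟨hxy, m, Nat.zero_le _, hmk, e⟩
          · exact Or.inl (Or.inr ⟨hxy, m, hmk, hm, e⟩)
        · exact Or.inl (Or.inl (Or.inr h'))) _ hec
    rcases hsub with (h' | h') | h'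
    · exact hq h'
    · have := h.lt_of_mem_left hβ.1 hk.le hβ.2.1
        (mem_vs_of_adj (show (C.pg l).Adj _ _ from h')).1
      omega
    · obtain ⟨m, hm, hmn, e | e⟩ := exists_of_adj (show (C.seg r (k + 1) (C.n r)).Adj _ _ from h')
      · have := C.inj r k m hk.le (by omega) e.1
        omega
      · have := C.inj r k (m + 1) hk.le (by omega) e.1
        omega

lemma exists_lastIndex (h : C.Trio q r l) : ∃ β, C.LastIndex q r β :=
  ChordSystem.exists_lastIndex h.right_meets

lemma exists_extEdge_right (h : C.Trio q r l) : ∃ e, C.ExtEdge q r l e :=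
  h.exists_lastIndex.imp' _ fun _ hβ => h.extEdge_of_lastIndex hβ

lemma extEdge_right_unique (h : C.Trio q r l) {e e' : Sym2 V} (he : C.ExtEdge q r l e)
    (he' : C.ExtEdge q r l e') : e = e' := by
  obtain ⟨β, hβ⟩ := h.exists_lastIndex
  rw [h.eq_of_extEdge hβ he, h.eq_of_extEdge hβ he']

lemma mem_edges_right (h : C.Trio q r l) {e : Sym2 V} (he : C.ExtEdge q r l e)
    {K : SimpleGraph V} {v : V} {c : K.Walk v v} (hc : c.IsCycle)
    (hcs : ∀ e ∈ c.edges, e ∈ (C.trio q r l).edgeSet) : e ∈ c.edges := by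
  obtain ⟨β, hβ⟩ := h.exists_lastIndex
  rw [h.eq_of_extEdge hβ he]
  exact h.mem_edges_of_lastIndex hβ hc hcs

end Trio

lemma mirror_trio {q r l : ι} : C.mirror.trio q r l = C.trio q r l := by
  simp only [trio, mirror_pg]

lemma extEdge_mirror {q r l : ι} {e : Sym2 V} : C.mirror.ExtEdge q r l e ↔ C.ExtEdge q r l e := by
  constructor
  · rintro ⟨h₁, h₂, h₃, h₄⟩
    rw [mirror_trio] at h₄
    rw [mirror_pg] at h₁ h₂
    rw [mirror_vs] at h₃
    exact ⟨h₁, h₂, h₃, h₄⟩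
  · rintro ⟨h₁, h₂, h₃, h₄⟩
    rw [← mirror_trio] at h₄
    rw [← mirror_pg] at h₁ h₂
    rw [← mirror_vs] at h₃
    exact ⟨h₁, h₂, h₃, h₄⟩

namespace Trio

variable {q r l : ι}

lemma exists_extEdge_left (h : C.Trio q r l) : ∃ e, C.ExtEdge q l r e :=
  h.mirror.exists_extEdge_right.imp fun _ => extEdge_mirror.1

lemma extEdge_left_unique (h : C.Trio q r l) {e e' : Sym2 V} (he : C.ExtEdge q l r e)
    (he' : C.ExtEdge q l r e') : e = e' :=
  h.mirror.extEdge_right_unique (extEdge_mirror.2 he) (extEdge_mirror.2 he')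

lemma mem_edges_left (h : C.Trio q r l) {e : Sym2 V} (he : C.ExtEdge q l r e)
    {K : SimpleGraph V} {v : V} {c : K.Walk v v} (hc : c.IsCycle)
    (hcs : ∀ e ∈ c.edges, e ∈ (C.trio q r l).edgeSet) : e ∈ c.edges :=
  h.mirror.mem_edges_right (extEdge_mirror.2 he) hc (by rwa [mirror_trio, trio_comm])

/-- A path containing the extremal edge of `r` is below `r`. -/
lemma le_of_extEdge_right (h : C.Trio q r l) {e : Sym2 V} (he : C.ExtEdge q r l e) {m : ι}
    (hm : e ∈ (C.pg m).edgeSet) : C.Le m r := by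
  obtain ⟨hr, hq, ⟨u, hu, huq⟩, -⟩ := he
  induction e with
  | h x y =>
    have hxy := mem_vs_of_adj (show (C.pg r).Adj x y from hr)
    have hxy' := mem_vs_of_adj (show (C.pg m).Adj x y from hm)
    by_cases hmq : C.Le m q
    · have hne : m ≠ q := by
        rintro rfl
        exact hq hm
      -- If `m` were below `l`, the end `u` of the edge would lie on `q`, `r` and `l`.
      refine (h.cover m hmq hne).resolve_right fun hml => ?_
      have hsep : ∀ w, w ∈ C.vs m → w ∈ C.vs r → w ∈ C.vs l := fun w hw hw' =>
        sep hml (fun hrl => absurd hrl (h.not_le (Le.refl r) (Le.refl l))) hw hw'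
      rcases Sym2.mem_iff.1 hu with rfl | rfl
      · exact h.no_common huq hxy.1 (hsep _ hxy'.1 hxy.1)
      · exact h.no_common huq hxy.2 (hsep _ hxy'.2 hxy.2)
    -- If `m` is not below `q`, both ends of the edge lie on `q`, and hence the edge does.
    · have hsep : ∀ w, w ∈ C.vs m → w ∈ C.vs r → w ∈ C.vs q := fun w hw hw' =>
        sep h.le_right (fun hmq' => absurd hmq' hmq) hw' hw
      exact absurd (adj_of_mem hr (hsep _ hxy'.1 hxy.1) (hsep _ hxy'.2 hxy.2)) hq

lemma le_of_extEdge_left (h : C.Trio q r l) {e : Sym2 V} (he : C.ExtEdge q l r e) {m : ι}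
    (hm : e ∈ (C.pg m).edgeSet) : C.Le m l :=
  mirror_le.1 (h.mirror.le_of_extEdge_right (extEdge_mirror.2 he) (by rwa [mirror_pg]))

end Trio

/-- Each path has no child, or it forms a cycle with its two children. -/
def Binary (C : ChordSystem G ι) : Prop :=
  ∀ q, (∀ m, C.Le m q → m = q) ∨ ∃ r l, C.Trio q r l

/-- The union of some paths is acyclic, if it misses one of the two extremal edges of every face. -/
theorem isAcyclic_of_extEdge (hC : C.Binary) {S : Set ι} {root : ι} (hroot : ∀ i, C.Le i root)
    (hS : ∀ q r l, C.Trio q r l → ∀ e e', C.ExtEdge q r l e → C.ExtEdge q l r e' →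
      ∀ i ∈ S, ∀ j ∈ S, e ∈ (C.pg i).edgeSet → e' ∉ (C.pg j).edgeSet) :
    (⨆ i ∈ S, C.pg i).IsAcyclic := by
  -- Induction on the length of the arc. The path `q` is added whether or not it belongs to `S`, so
  -- that the branches below the children can be glued along the children.
  have key : ∀ N : ℕ, ∀ q, (C.b q - C.a q).toNat ≤ N →
      (C.pg q ⊔ ⨆ i ∈ {i ∈ S | C.Le i q}, C.pg i).IsAcyclic := by
    intro N
    induction N with
    | zero =>
      intro q hq
      have := C.lt q
      omega
    | succ N ih =>
      intro q hq
      rcases hC q with hleaf | ⟨r, l, h⟩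
      · refine (pg_isAcyclic q).anti (sup_le le_rfl (iSup₂_le fun i hi => ?_))
        rw [hleaf i hi.2]
      set R : ι → SimpleGraph V := fun q => C.pg q ⊔ ⨆ i ∈ {i ∈ S | C.Le i q}, C.pg i with hR
      have hmem : ∀ x u, u ∈ (R x).support ↔ u ∈ C.vs x ∨ ∃ i ∈ S, C.Le i x ∧ u ∈ C.vs i := by
        intro x u
        rw [hR, mem_support_sup, mem_support_biSup, support_pg]
        simp only [support_pg, Set.mem_ofPred_eq, and_assoc]
      have hsub : ∀ {x}, C.Le x q → x ≠ q → (R x).IsAcyclic := by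
        intro x hx hne
        refine ih x ?_
        have h₁ : C.a x ≠ C.a q ∨ C.b x ≠ C.b q := by
          by_contra! hcon
          exact hne (C.ext x q hcon.1 hcon.2)
        have := C.lt x
        unfold Le at hx
        omega
      have hedge : ∀ x, ∀ e ∈ (R x).edgeSet, e ∈ (C.pg x).edgeSet ∨
          ∃ i ∈ S, C.Le i x ∧ e ∈ (C.pg i).edgeSet := by
        intro x e he
        induction e with
        | h y z =>
          have he : (C.pg x).Adj y z ∨ (⨆ i ∈ {i ∈ S | C.Le i x}, C.pg i).Adj y z := he
          simp only [iSup_adj] at he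
          rcases he with he | ⟨i, hi, he⟩
          · exact Or.inl he
          · exact Or.inr ⟨i, hi.1, hi.2, he⟩
      have hle : R q ≤ C.trio q r l ⊔ R r ⊔ R l := by
        refine sup_le (le_sup_of_le_left (le_sup_of_le_left
          (le_sup_of_le_left le_sup_left))) (iSup₂_le fun i hi => ?_)
        by_cases hiq : i = q
        · rw [hiq]
          exact le_sup_of_le_left (le_sup_of_le_left (le_sup_of_le_left le_sup_left))
        · rcases h.cover i hi.2 hiq with h' | h'
          · exact le_sup_of_le_left (le_sup_of_le_right (le_sup_of_le_right
              (le_iSup₂_of_le i ⟨hi.1, h'⟩ le_rfl)))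
          · exact le_sup_of_le_right (le_sup_of_le_right
              (le_iSup₂_of_le i ⟨hi.1, h'⟩ le_rfl))
      have hm : ∀ x, ∀ K, C.pg x ≤ K →
          (∀ u, u ∈ K.support → ∃ s, (C.Le s x → s = x) ∧ u ∈ C.vs s) → MeetConnected K (R x) := by
        intro x K hK hs
        have hmemx : ∀ u, u ∈ K.support → u ∈ (R x).support → u ∈ C.vs x := by
          intro u hu hu'
          obtain ⟨s, hsx, hus⟩ := hs u hu
          rcases (hmem x u).1 hu' with hu' | ⟨i, -, hi, hu'⟩
          · exact hu'
          · exact sep hi hsx hu' hus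
        intro u v hu hu' hv hv'
        exact (pg_reachable (hmemx u hu hu') (hmemx v hv hv')).mono (le_inf hK le_sup_left)
      have htrio : ∀ u, u ∈ (C.trio q r l).support → u ∈ C.vs q ∨ u ∈ C.vs r ∨ u ∈ C.vs l := by
        intro u hu
        rw [trio, mem_support_sup, mem_support_sup, support_pg, support_pg, support_pg, or_assoc]
          at hu
        exact hu
      have hm₁ : MeetConnected (C.trio q r l) (R r) := by
        refine hm r _ (le_sup_of_le_left le_sup_right) fun u hu => ?_
        rcases htrio u hu with hu | hu | hu
        · exact ⟨q, fun h' => absurd h' h.not_le_right, hu⟩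
        · exact ⟨r, fun _ => rfl, hu⟩
        · exact ⟨l, fun h' => absurd h' (h.not_ge (Le.refl r) (Le.refl l)), hu⟩
      have hm₂ : MeetConnected (C.trio q r l ⊔ R r) (R l) := by
        refine hm l _ (le_sup_of_le_left le_sup_right) fun u hu => ?_
        rcases mem_support_sup.1 hu with hu | hu
        · rcases htrio u hu with hu | hu | hu
          · exact ⟨q, fun h' => absurd h' h.not_le_left, hu⟩
          · exact ⟨r, fun h' => absurd h' (h.not_le (Le.refl r) (Le.refl l)), hu⟩
          · exact ⟨l, fun _ => rfl, hu⟩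
        · rcases (hmem r u).1 hu with hu | ⟨i, -, hi, hu⟩
          · exact ⟨r, fun h' => absurd h' (h.not_le (Le.refl r) (Le.refl l)), hu⟩
          · exact ⟨i, fun h' => absurd h' (h.not_le hi (Le.refl l)), hu⟩
      intro v c hc
      -- The cycle retreats from the branches below `l` and `r` to the three paths of the face.
      -- There it uses both extremal edges, which are not on `q` and so come from members of `S`.
      have hin := edges_subset_of_meetConnected hm₁ (hsub h.le_right h.right_ne) hc
        (edges_subset_of_meetConnected hm₂ (hsub h.le_left h.left_ne) hc fun e he =>
          edgeSet_mono hle (c.edges_subset_edgeSet he))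
      obtain ⟨e, he⟩ := h.exists_extEdge_right
      obtain ⟨e', he'⟩ := h.exists_extEdge_left
      obtain ⟨i, hi, -, hei⟩ := (hedge q e (c.edges_subset_edgeSet
        (h.mem_edges_right he hc hin))).resolve_left he.notMem
      obtain ⟨j, hj, -, hej⟩ := (hedge q e' (c.edges_subset_edgeSet
        (h.mem_edges_left he' hc hin))).resolve_left he'.notMem
      exact hS q r l h e e' he he' i hi j hj hei hej
  refine (key _ root le_rfl).anti (le_sup_of_le_right (iSup₂_mono' fun i hi => ?_))
  exact ⟨i, ⟨hi, hroot i⟩, le_rfl⟩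

end ChordSystem

/-! ### Extremal edges and contacts with a path above the face -/

namespace ChordSystem

variable {V ι : Type*} {G : SimpleGraph V} {C : ChordSystem G ι}

/-- The paths `i` and `j` have a common vertex. -/
def Meet (C : ChordSystem G ι) (i j : ι) : Prop := ∃ v, v ∈ C.vs i ∧ v ∈ C.vs j

lemma mirror_meet {i j : ι} : C.mirror.Meet i j ↔ C.Meet i j := by
  simp only [Meet, mirror_vs]

lemma Meet.refl (i : ι) : C.Meet i i := ⟨_, f_mem (Nat.zero_le _), f_mem (Nat.zero_le _)⟩

/-- By `sep`, a contact of `q` with `p` lies on every path between them in the order. -/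
lemma Meet.up {p q k : ι} (h : C.Meet q p) (hqk : C.Le q k) (hkp : C.Le k p) : C.Meet k p := by
  obtain ⟨v, hv, hv'⟩ := h
  exact ⟨v, sep hqk (fun h => h.antisymm hkp) hv hv', hv'⟩

namespace Trio

variable {p q r l m g gr gl : ι} {e : Sym2 V}

/-- If both children of `q` meet a path `p` above `q`, then so do the paths through the extremal
edges. -/
lemma meet_of_extEdge_right (h : C.Trio q r l) (hq : C.Le q p) (hr : C.Meet r p) (hl : C.Meet l p)
    (he : C.ExtEdge q r l e) (hm : e ∈ (C.pg m).edgeSet) : C.Meet m p := by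
  obtain ⟨β, hβ⟩ := h.exists_lastIndex
  obtain rfl := h.eq_of_extEdge hβ he
  refine ⟨C.f r β, (mem_vs_of_adj (show (C.pg m).Adj _ _ from hm)).1, ?_⟩
  obtain ⟨z, hzr, hzp⟩ := hr
  obtain ⟨z', hzl, hzp'⟩ := hl
  have hzq : z ∈ C.vs q := sep h.le_right (fun h' => h'.antisymm hq) hzr hzp
  have hzq' : z' ∈ C.vs q := sep h.le_left (fun h' => h'.antisymm hq) hzl hzp'
  obtain ⟨k, hk, rfl⟩ := hzr
  obtain ⟨i, hi, ei⟩ := id hβ.2.1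
  obtain ⟨j, hj, ej⟩ := id hzq
  obtain ⟨j', hj', rfl⟩ := hzq'
  -- On `q`, the vertex where `r` leaves `q` is not before the contact of `r` with `p`, and is
  -- before that of `l`; by convexity it is on `p`.
  have h₁ : j ≤ i := by
    rcases (hβ.2.2 k hk hzq).lt_or_eq with h' | rfl
    · exact (index_lt_of_le h.le_right hβ.1 hj hi ej.symm ei.symm h').le
    · exact (C.inj q j i hj hi (ej.trans ei.symm)).le
  have h₂ : i < j' := index_lt_upper h.le_right h.le_left h.disj (fun _ => h.no_common) hi hj'
    (ei ▸ f_mem hβ.1) hzl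
  rw [← ei]
  exact convex (by rwa [ej]) hzp' h₁ h₂.le hj'

lemma meet_of_extEdge_left (h : C.Trio q r l) (hq : C.Le q p) (hr : C.Meet r p) (hl : C.Meet l p)
    (he : C.ExtEdge q l r e) (hm : e ∈ (C.pg m).edgeSet) : C.Meet m p :=
  mirror_meet.1 (h.mirror.meet_of_extEdge_right (mirror_le.2 hq) (mirror_meet.2 hl)
    (mirror_meet.2 hr) (extEdge_mirror.2 he) (by rwa [mirror_pg]))

/-- A path through the extremal edge of `r` is not below the right child of a path `g` below `r`, if
the left child of `g` meets a path `p` above `q`. -/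
lemma not_le_of_extEdge_right (h : C.Trio q r l) (hq : C.Le q p) (he : C.ExtEdge q r l e)
    (hm : e ∈ (C.pg m).edgeSet) (hg : C.Trio g gr gl) (hgr : C.Le g r) (hgl : C.Meet gl p) :
    ¬ C.Le m gr := by
  intro hmg
  obtain ⟨β, hβ⟩ := h.exists_lastIndex
  obtain rfl := h.eq_of_extEdge hβ he
  have hum := (mem_vs_of_adj (show (C.pg m).Adj _ _ from hm)).1
  obtain ⟨z, hz, hzp⟩ := hgl
  have hrp := h.le_right.trans hq
  have hzr : z ∈ C.vs r := sep (hg.le_left.trans hgr) (fun h' => h'.antisymm hrp) hz hzp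
  have hzq : z ∈ C.vs q := sep (hg.le_left.trans (hgr.trans h.le_right)) (fun h' => h'.antisymm hq)
    hz hzp
  have hug : C.f r β ∈ C.vs gr := sep hmg
    (fun h' => absurd (hgr.trans h') hg.not_le_right) hum (f_mem hβ.1)
  have hug' : C.f r β ∈ C.vs g := sep hg.le_right (fun h' => h'.antisymm hgr) hug (f_mem hβ.1)
  have hzg : z ∈ C.vs g := sep hg.le_left (fun h' => h'.antisymm hgr) hz hzr
  obtain ⟨k, hk, rfl⟩ := hzr
  obtain ⟨i, hi, ei⟩ := id hug'
  obtain ⟨j, hj, ej⟩ := id hzg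
  -- On `g` the right child comes first, so on `r` the contact `z` would come after `β`; but `z` is
  -- on `q`, against the choice of `β`.
  have h₁ : i < j := index_lt_upper hg.le_right hg.le_left hg.disj (fun _ => hg.no_common) hi hj
    (by rwa [ei]) (by rwa [ej])
  have h₂ := index_lt_of_le hgr hj hβ.1 hk ei ej h₁
  have h₃ := hβ.2.2 k hk hzq
  omega

lemma not_le_of_extEdge_left (h : C.Trio q r l) (hq : C.Le q p) (he : C.ExtEdge q l r e)
    (hm : e ∈ (C.pg m).edgeSet) (hg : C.Trio g gr gl) (hgl : C.Le g l) (hgr : C.Meet gr p) :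
    ¬ C.Le m gl := by
  rw [← mirror_le]
  exact h.mirror.not_le_of_extEdge_right (mirror_le.2 hq) (extEdge_mirror.2 he)
    (by rwa [mirror_pg]) hg.mirror (mirror_le.2 hgl) (mirror_meet.2 hgr)

/-- The children of a path are determined by it. -/
lemma unique {r' l' : ι} (h : C.Trio q r l) (h' : C.Trio q r' l') : r' = r ∧ l' = l := by
  have h₁ := h.cover r' h'.le_right h'.right_ne
  have h₂ := h.cover l' h'.le_left h'.left_ne
  have h₃ := h'.cover r h.le_right h.right_ne
  have h₄ := h'.cover l h.le_left h.left_ne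
  have d := h.disj
  have d' := h'.disj
  have := C.lt r
  have := C.lt l
  have := C.lt r'
  have := C.lt l'
  unfold Le at h₁ h₂ h₃ h₄
  constructor
  · exact C.ext _ _ (by omega) (by omega)
  · exact C.ext _ _ (by omega) (by omega)

end Trio

/-! ### Maximal and minimal paths, parents -/

section Tree

variable [Finite ι]

lemma exists_maximal (S : Set ι) {i : ι} (hi : i ∈ S) :
    ∃ m ∈ S, C.Le i m ∧ ∀ k ∈ S, C.Le m k → k = m := by
  obtain ⟨m, hm, hmax⟩ := Set.exists_max_image {k ∈ S | C.Le i k} (fun k => C.b k - C.a k)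
    (Set.toFinite _) ⟨i, hi, Le.refl i⟩
  refine ⟨m, hm.1, hm.2, fun k hk hmk => ?_⟩
  have := hmax k ⟨hk, hm.2.trans hmk⟩
  unfold Le at hmk
  exact C.ext k m (by omega) (by omega)

lemma exists_minimal (S : Set ι) {i : ι} (hi : i ∈ S) :
    ∃ m ∈ S, C.Le m i ∧ ∀ k ∈ S, C.Le k m → k = m := by
  obtain ⟨m, hm, hmin⟩ := Set.exists_min_image {k ∈ S | C.Le k i} (fun k => C.b k - C.a k)
    (Set.toFinite _) ⟨i, hi, Le.refl i⟩
  refine ⟨m, hm.1, hm.2, fun k hk hmk => ?_⟩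
  have := hmin k ⟨hk, hmk.trans hm.2⟩
  unfold Le at hmk
  exact C.ext k m (by omega) (by omega)

/-- Every path that is not above all others is a child. -/
lemma exists_parent (hC : C.Binary) {m p : ι} (hmp : C.Le m p) (hne : m ≠ p) :
    ∃ q r l, C.Trio q r l ∧ C.Le q p ∧ (m = r ∨ m = l) := by
  obtain ⟨q, ⟨hmq, hqm⟩, hqp, hmin⟩ :=
    exists_minimal (C := C) {k | C.Le m k ∧ k ≠ m} (i := p) ⟨hmp, hne.symm⟩
  rcases hC q with hq | ⟨r, l, h⟩
  · exact absurd (hq m hmq).symm hqm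
  · refine ⟨q, r, l, h, hqp, ?_⟩
    by_contra! hcon
    rcases h.cover m hmq hqm.symm with h' | h'
    · exact h.right_ne (hmin r ⟨h', hcon.1.symm⟩ h.le_right)
    · exact h.left_ne (hmin l ⟨h', hcon.2.symm⟩ h.le_left)

end Tree

end ChordSystem

/-! ### The genealogy tree as a system of chords -/

namespace Genealogy

variable {V : Type*} [Fintype V] {G : PlaneGraph V} {ι : Type*} {P : PathFamily G.graph ι}
  {T : Genealogy G P} {C : ChordSystem G.graph ι}

/-- The system of chords `C` consists of the paths of `P` and of the arcs of `T`. -/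
structure IsModel (T : Genealogy G P) (C : ChordSystem G.graph ι) : Prop where
  a : ∀ i, C.a i = T.a i
  b : ∀ i, C.b i = T.b i
  vs : ∀ i v, v ∈ C.vs i ↔ v ∈ (P.path i).support
  adj : ∀ i u v, (C.pg i).Adj u v ↔ s(u, v) ∈ (P.path i).edges

lemma exists_isModel (T : Genealogy G P) (hP : IsNCS G P) : ∃ C, T.IsModel C := by
  obtain ⟨C, h₁, h₂, h₃, h₄⟩ := T.exists_chordSystem hP (T.base T.root) (σ := fun i => i)
    (fun _ _ h => h) T.base_root
  exact ⟨C, h₁, h₂, h₃, h₄⟩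

namespace IsModel

open ChordSystem

variable (hC : T.IsModel C)

include hC

lemma mem_edges {i : ι} {e : Sym2 V} : e ∈ (P.path i).edges ↔ e ∈ (C.pg i).edgeSet := by
  induction e with
  | h u v => exact (hC.adj i u v).symm

lemma a_lt_b (i : ι) : T.a i < T.b i := by
  have := C.lt i
  rw [hC.a, hC.b] at this
  exact_mod_cast this

lemma le_iff {i j : ι} : T.Le i j ↔ C.Le i j := by
  unfold Genealogy.Le Genealogy.arc
  rw [Finset.Ico_subset_Ico_iff (hC.a_lt_b i), ChordSystem.Le, hC.a, hC.a, hC.b, hC.b]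
  norm_cast

lemma le_root (i : ι) : C.Le i T.root := hC.le_iff.1 (T.le_root i)

lemma ssubset_iff {i j : ι} : T.arc i ⊂ T.arc j ↔ C.Le i j ∧ i ≠ j := by
  rw [ssubset_iff_subset_not_subset]
  change T.Le i j ∧ ¬ T.Le j i ↔ _
  rw [hC.le_iff, hC.le_iff]
  refine and_congr_right fun h => not_congr ⟨fun h' => h.antisymm h', ?_⟩
  rintro rfl
  exact Le.refl _

lemma touch_iff {p q : ι} : T.Touch p q ↔ C.Le q p ∧ C.Meet q p := by
  simp only [Genealogy.Touch, hC.le_iff, Meet, hC.vs]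

lemma isChild_iff {c p : ι} :
    T.IsChild c p ↔ C.Le c p ∧ c ≠ p ∧ ∀ k, C.Le c k → C.Le k p → k = c ∨ k = p := by
  simp only [Genealogy.IsChild, hC.ssubset_iff, and_assoc]
  refine and_congr_right fun _ => and_congr_right fun _ => forall_congr' fun k => ?_
  constructor
  · intro h h₁ h₂
    by_contra! hcon
    exact h ⟨h₁, hcon.1.symm, h₂, hcon.2⟩
  · rintro h ⟨h₁, h₂, h₃, h₄⟩
    rcases h h₁ h₃ with rfl | rfl
    · exact h₂ rfl
    · exact h₄ rfl

lemma exists_child [Finite ι] {m p : ι} (h : C.Le m p) (hne : m ≠ p) :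
    ∃ c, T.IsChild c p ∧ C.Le m c := by
  obtain ⟨c, ⟨hcp, hc⟩, hmc, hmax⟩ :=
    exists_maximal (C := C) {k | C.Le k p ∧ k ≠ p} (i := m) ⟨h, hne⟩
  refine ⟨c, hC.isChild_iff.2 ⟨hcp, hc, fun k hk hkp => ?_⟩, hmc⟩
  by_cases hkp' : k = p
  · exact Or.inr hkp'
  · exact Or.inl (hmax k ⟨hkp, hkp'⟩ hk)

lemma edges_subset {p r l : ι} {v : V} {c : G.graph.Walk v v} (hf : FormFace G P p r l c) :
    ∀ e ∈ c.edges, e ∈ (C.trio p r l).edgeSet := by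
  intro e he
  have := hf.2.1 e he
  rw [hC.mem_edges, hC.mem_edges, hC.mem_edges] at this
  induction e with
  | h x y => exact or_assoc.2 this

lemma trio_of_formFace [Finite ι] {p r l : ι} (h : T.Children p r l) {v : V}
    {c : G.graph.Walk v v} (hf : FormFace G P p r l c) : C.Trio p r l where
  le_right := (hC.isChild_iff.1 h.1).1
  le_left := (hC.isChild_iff.1 h.2.1).1
  right_ne := (hC.isChild_iff.1 h.1).2.1
  left_ne := (hC.isChild_iff.1 h.2.1).2.1
  disj := by
    rw [hC.b, hC.a]
    exact_mod_cast h.2.2.1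
  cover m hm hne := by
    obtain ⟨c, hc, hmc⟩ := hC.exists_child hm hne
    rcases h.2.2.2 c hc with rfl | rfl
    · exact Or.inl hmc
    · exact Or.inr hmc
  cyclic hac := not_isCycle_of_edges_subset hac (hC.edges_subset hf) hf.1

variable [Finite ι]

lemma binary (hT : T.IsBinary) : C.Binary := by
  intro q
  rcases hT q with h | ⟨r, l, h, v, c, hf⟩
  · left
    intro m hm
    by_contra hne
    obtain ⟨c, hc, -⟩ := hC.exists_child hm hne
    exact h c hc
  · exact Or.inr ⟨r, l, hC.trio_of_formFace h hf⟩

lemma exists_formFace (hT : T.IsBinary) {p c : ι} (h : T.IsChild c p) :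
    ∃ r l, T.Children p r l ∧ C.Trio p r l ∧
      ∃ (v : V) (c : G.graph.Walk v v), FormFace G P p r l c := by
  rcases hT p with h' | ⟨r, l, h', v, c, hf⟩
  · exact absurd h (h' _)
  · exact ⟨r, l, h', hC.trio_of_formFace h' hf, v, c, hf⟩

lemma isChild_right {p r l : ι} (h : C.Trio p r l) : T.IsChild r p := by
  obtain ⟨c, hc, hrc⟩ := hC.exists_child h.le_right h.right_ne
  have hc' := hC.isChild_iff.1 hc
  rcases h.cover c hc'.1 hc'.2.1 with h' | h'
  · rwa [hrc.antisymm h']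
  · exact absurd (hrc.trans h') (h.not_le (Le.refl _) (Le.refl _))

lemma isChild_left {p r l : ι} (h : C.Trio p r l) : T.IsChild l p := by
  obtain ⟨c, hc, hrc⟩ := hC.exists_child h.le_left h.left_ne
  have hc' := hC.isChild_iff.1 hc
  rcases h.cover c hc'.1 hc'.2.1 with h' | h'
  · exact absurd (hrc.trans h') (h.not_ge (Le.refl _) (Le.refl _))
  · rwa [hrc.antisymm h']

lemma children_of_trio {p r l : ι} (h : C.Trio p r l) : T.Children p r l := by
  refine ⟨hC.isChild_right h, hC.isChild_left h, ?_, fun c hc => ?_⟩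
  · have := h.disj
    rw [hC.b, hC.a] at this
    exact_mod_cast this
  · have hc' := hC.isChild_iff.1 hc
    rcases h.cover c hc'.1 hc'.2.1 with h' | h'
    · rcases hc'.2.2 r h' h.le_right with h'' | h''
      · exact Or.inl h''.symm
      · exact absurd h'' h.right_ne
    · rcases hc'.2.2 l h' h.le_left with h'' | h''
      · exact Or.inr h''.symm
      · exact absurd h'' h.left_ne

lemma children_iff (hT : T.IsBinary) {p r l : ι} : T.Children p r l ↔ C.Trio p r l := by
  refine ⟨fun h => ?_, hC.children_of_trio⟩
  obtain ⟨r', l', h', ht, -⟩ := hC.exists_formFace hT h.1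
  have h₁ := h'.2.2.2 r h.1
  have h₂ := h'.2.2.2 l h.2.1
  have h₃ := h.2.2.1
  have h₄ := h'.2.2.1
  have := hC.a_lt_b r
  have := hC.a_lt_b l
  rcases h₁ with rfl | rfl
  · rcases h₂ with rfl | rfl
    · omega
    · exact ht
  · rcases h₂ with rfl | rfl <;> omega

/-- The choice of the face cycle is immaterial: every cycle of the trio contains both extremal
edges, so the one given by `IsBinary` can serve. -/
lemma extremalEdge_iff (hT : T.IsBinary) {q c : ι} {e : Sym2 V} :
    T.ExtremalEdge q c e ↔ ∃ r l, C.Trio q r l ∧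
      ((c = r ∧ C.ExtEdge q r l e) ∨ (c = l ∧ C.ExtEdge q l r e)) := by
  constructor
  · rintro ⟨r, l, h, hc, v, w, hf, hew, hec, heq, u, hu, huq⟩
    rw [hC.mem_edges] at hec heq
    rw [← hC.vs] at huq
    have ht := (hC.children_iff hT).1 h
    refine ⟨r, l, ht, ?_⟩
    have hcyc := hC.edges_subset hf
    rcases hc with rfl | rfl
    · exact Or.inl ⟨rfl, hec, heq, ⟨u, hu, huq⟩, v, w.transfer _ hcyc, hf.1.transfer hcyc,
        by rwa [Walk.edges_transfer]⟩
    · rw [trio_comm] at hcyc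
      exact Or.inr ⟨rfl, hec, heq, ⟨u, hu, huq⟩, v, w.transfer _ hcyc, hf.1.transfer hcyc,
        by rwa [Walk.edges_transfer]⟩
  · rintro ⟨r, l, ht, he⟩
    have h := hC.children_of_trio ht
    obtain ⟨r', l', -, ht', v, w, hf⟩ := hC.exists_formFace hT h.1
    obtain ⟨rfl, rfl⟩ := ht.unique ht'
    have hsub := hC.edges_subset hf
    rcases he with ⟨rfl, he⟩ | ⟨rfl, he⟩
    · obtain ⟨u, hu, huq⟩ := he.touch
      exact ⟨_, _, h, Or.inl rfl, v, w, hf, ht.mem_edges_right he hf.1 hsub, hC.mem_edges.2 he.mem,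
        fun h' => he.notMem (hC.mem_edges.1 h'), u, hu, (hC.vs _ _).1 huq⟩
    · obtain ⟨u, hu, huq⟩ := he.touch
      exact ⟨_, _, h, Or.inr rfl, v, w, hf, ht.mem_edges_left he hf.1 hsub, hC.mem_edges.2 he.mem,
        fun h' => he.notMem (hC.mem_edges.1 h'), u, hu, (hC.vs _ _).1 huq⟩

end IsModel

end Genealogy

/-! ### The labelings computed by `FifteenForests` -/

namespace Genealogy

variable {V : Type*} [Fintype V] {G : PlaneGraph V} {ι : Type*} {P : PathFamily G.graph ι}
  {T : Genealogy G P} {C : ChordSystem G.graph ι}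

namespace IsModel

open ChordSystem

variable (hC : T.IsModel C)

include hC

lemma max_iff {p m : ι} : T.Max p m ↔ C.Le m p ∧ ¬ C.Meet m p ∧
    ∀ k, C.Le k p → ¬ C.Meet k p → C.Le m k → k = m := by
  simp only [Genealogy.Max, hC.touch_iff, hC.le_iff, not_and]
  constructor
  · rintro ⟨⟨h₁, h₂⟩, h₃⟩
    exact ⟨h₁, h₂ h₁, fun k hk hkp hmk => (h₃ k hk (fun _ => hkp) hmk).antisymm hmk⟩
  · rintro ⟨h₁, h₂, h₃⟩
    exact ⟨⟨h₁, fun _ => h₂⟩, fun k hk hkp hmk => h₃ k hk (hkp hk) hmk ▸ Le.refl _⟩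

lemma max_ne {p m : ι} (h : T.Max p m) : m ≠ p := by
  rintro rfl
  exact (hC.max_iff.1 h).2.1 (Meet.refl m)

/-- A path strictly above `c` and below `p` is at or above `q`, so it meets `p` by `Meet.up`. -/
lemma max_of_isChild {p q c : ι} (h : T.IsChild c q) (hq : C.Le q p) (hqp : C.Meet q p)
    (hc : ¬ C.Meet c p) : T.Max p c := by
  have h' := hC.isChild_iff.1 h
  refine hC.max_iff.2 ⟨h'.1.trans hq, hc, fun k hk hkp hck => ?_⟩
  rcases le_total_of_le hck h'.1 with hkq | hkq
  · rcases h'.2.2 k hck hkq with rfl | rfl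
    · rfl
    · exact absurd hqp hkp
  · exact absurd (hqp.up hkq hk) hkp

variable [Finite ι]

lemma exists_max {p i : ι} (h : C.Le i p) (hi : ¬ C.Meet i p) : ∃ m, T.Max p m ∧ C.Le i m := by
  obtain ⟨m, ⟨hm, hmp⟩, him, hmax⟩ :=
    exists_maximal (C := C) {k | C.Le k p ∧ ¬ C.Meet k p} (i := i) ⟨h, hi⟩
  exact ⟨m, hC.max_iff.2 ⟨hm, hmp, fun k hk hkp hmk => hmax k ⟨hk, hkp⟩ hmk⟩, him⟩

/-- The main loop treats every path. -/
lemma exists_inMAX (q : ι) : ∃ p, T.InMAX p ∧ C.Le q p ∧ C.Meet q p := by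
  obtain ⟨p, ⟨hp, hqp⟩, -, hmin⟩ :=
    exists_minimal (C := C) {p | T.InMAX p ∧ C.Le q p} (i := T.root) ⟨.root, hC.le_root q⟩
  refine ⟨p, hp, hqp, ?_⟩
  -- Otherwise the member of `Max_p` above `q` would be a lower element of `MAX`.
  by_contra hcon
  obtain ⟨m, hm, hqm⟩ := hC.exists_max hqp hcon
  exact hC.max_ne hm (hmin m ⟨.step hp hm, hqm⟩ (hC.max_iff.1 hm).1)

/-- A path of the main loop touches no larger path of the main loop. -/
lemma not_meet_of_inMAX {p p' : ι} (hp : T.InMAX p) (hp' : T.InMAX p') (h : C.Le p' p)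
    (hne : p' ≠ p) : ¬ C.Meet p' p := by
  intro hm
  -- A highest counterexample `p'` is compared with the path `k` that put it into `MAX`. If `p` is
  -- strictly below `k`, it misses `k`, against the maximality of `p'`; if it is strictly above, `k`
  -- is a higher counterexample.
  obtain ⟨p', ⟨hp', p, hp, h, hne, hm⟩, -, hmax⟩ := exists_maximal (C := C)
    {p' | T.InMAX p' ∧ ∃ p, T.InMAX p ∧ C.Le p' p ∧ p' ≠ p ∧ C.Meet p' p} ⟨hp', p, hp, h, hne, hm⟩
  have ih : ∀ k, T.InMAX k → C.Le p' k → k ≠ p' → ∀ p, T.InMAX p → C.Le k p → k ≠ p →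
      ¬ C.Meet k p := fun k hk hk' hne p hp hkp hkne hm =>
    hne (hmax k ⟨hk, p, hp, hkp, hkne, hm⟩ hk')
  cases hp' with
  | root => exact hne (h.antisymm (hC.le_root p))
  | @step k _ hk hmx =>
    obtain ⟨h₁, h₂, h₃⟩ := hC.max_iff.1 hmx
    by_cases hpk : p = k
    · exact h₂ (hpk ▸ hm)
    rcases le_total_of_le h h₁ with hle | hle
    · exact hne (h₃ p hle (ih p hp h hne.symm k hk hle hpk) h).symm
    · exact ih k hk h₁ (hC.max_ne hmx).symm p hp hle (Ne.symm hpk) (hm.up h₁ hle)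

/-- With `exists_inMAX`, this makes `ColorTouch` treat each path for exactly one `p`. -/
lemma inMAX_unique {p p' q : ι} (hp : T.InMAX p) (hp' : T.InMAX p') (hq : C.Le q p)
    (hq' : C.Le q p') (hm : C.Meet q p) (hm' : C.Meet q p') : p = p' := by
  by_contra hne
  rcases le_total_of_le hq hq' with h | h
  · exact hC.not_meet_of_inMAX hp' hp h hne (hm'.up hq h)
  · exact hC.not_meet_of_inMAX hp hp' h (Ne.symm hne) (hm.up hq' h)

omit [Finite ι] in
lemma le_meet_of_rightColor {p q : ι} {σ₀ σ : Fin 15 × Fin 15 × Fin 15}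
    (h : T.RightColor p σ₀ q σ) : C.Le q p ∧ C.Meet q p := by
  cases h with
  | start => exact ⟨Le.refl _, Meet.refl p⟩
  | one _ _ h => exact hC.touch_iff.1 h
  | right _ _ h _ => exact hC.touch_iff.1 h
  | left _ _ _ h => exact hC.touch_iff.1 h

variable (hT : T.IsBinary)

include hT

omit hT in
/-- The recursive calls of `RightColor` for a child of `g` in `Touch_p`. -/
lemma rightColor_child {p g r l : ι} {σ₀ : Fin 15 × Fin 15 × Fin 15} {c₁ c₂ c₃ : Fin 15}
    (h : C.Trio g r l) (hg : C.Le g p) (hσ : T.RightColor p σ₀ g (c₁, c₂, c₃)) :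
    (C.Meet r p → C.Meet l p → T.RightColor p σ₀ r (c₁, c₃, c₂) ∧
      T.RightColor p σ₀ l (c₂, c₁, c₃)) ∧
    (C.Meet r p → ¬ C.Meet l p → T.RightColor p σ₀ r (c₁, c₂, c₃)) ∧
    (¬ C.Meet r p → C.Meet l p → T.RightColor p σ₀ l (c₁, c₂, c₃)) := by
  have hch := hC.children_of_trio h
  have hr : C.Meet r p → T.Touch p r := fun h' => hC.touch_iff.2 ⟨h.le_right.trans hg, h'⟩
  have hl : C.Meet l p → T.Touch p l := fun h' => hC.touch_iff.2 ⟨h.le_left.trans hg, h'⟩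
  refine ⟨fun h₁ h₂ => ⟨.right hσ hch (hr h₁) (hl h₂), .left hσ hch (hr h₁) (hl h₂)⟩,
    fun h₁ h₂ => .one hσ hch.1 (hr h₁) fun k hk hkp => ?_,
    fun h₁ h₂ => .one hσ hch.2.1 (hl h₂) fun k hk hkp => ?_⟩
  · rcases hch.2.2.2 k hk with rfl | rfl
    · rfl
    · exact absurd (hC.touch_iff.1 hkp).2 h₂
  · rcases hch.2.2.2 k hk with rfl | rfl
    · exact absurd (hC.touch_iff.1 hkp).2 h₁
    · rfl

lemma exists_rightColor {p q : ι} (σ₀ : Fin 15 × Fin 15 × Fin 15) (hq : C.Le q p)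
    (hqp : C.Meet q p) : ∃ σ, T.RightColor p σ₀ q σ := by
  by_contra hcon
  obtain ⟨q, ⟨hq, hqp, hcon⟩, -, hmax⟩ := exists_maximal (C := C)
    {q | C.Le q p ∧ C.Meet q p ∧ ¬ ∃ σ, T.RightColor p σ₀ q σ} ⟨hq, hqp, hcon⟩
  have hne : q ≠ p := by
    rintro rfl
    exact hcon ⟨_, .start⟩
  obtain ⟨g, r, l, h, hg, hqc⟩ := exists_parent (hC.binary hT) hq hne
  have hqg : C.Le q g ∧ q ≠ g := by
    rcases hqc with rfl | rfl
    · exact ⟨h.le_right, h.right_ne⟩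
    · exact ⟨h.le_left, h.left_ne⟩
  have : ∃ σ, T.RightColor p σ₀ g σ := by
    by_contra hg'
    exact hqg.2 (hmax g ⟨hg, hqp.up hqg.1 hg, hg'⟩ hqg.1).symm
  obtain ⟨⟨c₁, c₂, c₃⟩, hσ⟩ := this
  obtain ⟨h₁, h₂, h₃⟩ := hC.rightColor_child h hg hσ
  rcases hqc with rfl | rfl
  · by_cases hl : C.Meet l p
    · exact hcon ⟨_, (h₁ hqp hl).1⟩
    · exact hcon ⟨_, h₂ hqp hl⟩
  · by_cases hr : C.Meet r p
    · exact hcon ⟨_, (h₁ hr hqp).2⟩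
    · exact hcon ⟨_, h₃ hr hqp⟩

/-- The colors of a path below the right child `r` which is reached without turning right. -/
lemma rightColor_turn_left {p r m : ι} {σ₀ : Fin 15 × Fin 15 × Fin 15} {c₁ c₂ c₃ : Fin 15}
    (hr : C.Le r p) (hσ : T.RightColor p σ₀ r (c₁, c₃, c₂)) (hmr : C.Le m r) (hm : C.Meet m p)
    (hno : ∀ g gr gl, C.Trio g gr gl → C.Le g r → C.Meet gl p → ¬ C.Le m gr) :
    T.RightColor p σ₀ m (c₁, c₃, c₂) ∨ T.RightColor p σ₀ m (c₃, c₁, c₂) := by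
  -- Where both children touch `p` only left turns occur, and they exchange the first two entries;
  -- all other steps keep the permutation. The third entry, `c₂`, never comes first.
  by_contra hcon
  obtain ⟨k, ⟨hmk, hkr, hcon⟩, -, hmax⟩ := exists_maximal (C := C)
    {k | C.Le m k ∧ C.Le k r ∧ ¬ (T.RightColor p σ₀ k (c₁, c₃, c₂) ∨
      T.RightColor p σ₀ k (c₃, c₁, c₂))} ⟨Le.refl m, hmr, hcon⟩
  have hne : k ≠ r := by
    rintro rfl
    exact hcon (Or.inl hσ)
  obtain ⟨g, gr, gl, h, hg, hkc⟩ := exists_parent (hC.binary hT) hkr hne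
  have hkg : C.Le k g ∧ k ≠ g := by
    rcases hkc with rfl | rfl
    · exact ⟨h.le_right, h.right_ne⟩
    · exact ⟨h.le_left, h.left_ne⟩
  have hgσ : T.RightColor p σ₀ g (c₁, c₃, c₂) ∨ T.RightColor p σ₀ g (c₃, c₁, c₂) := by
    by_contra hg'
    exact hkg.2 (hmax g ⟨hmk.trans hkg.1, hg, hg'⟩ hkg.1).symm
  have hkp := hm.up hmk (hkr.trans hr)
  rcases hkc with rfl | rfl
  · have hl : ¬ C.Meet gl p := fun hl => hno g _ gl h hg hl hmk
    exact hcon (hgσ.imp (fun h' => (hC.rightColor_child h (hg.trans hr) h').2.1 hkp hl)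
      fun h' => (hC.rightColor_child h (hg.trans hr) h').2.1 hkp hl)
  · by_cases hgr : C.Meet gr p
    · exact hcon (hgσ.symm.imp
        (fun h' => ((hC.rightColor_child h (hg.trans hr) h').1 hgr hkp).2)
        fun h' => ((hC.rightColor_child h (hg.trans hr) h').1 hgr hkp).2)
    · exact hcon (hgσ.imp (fun h' => (hC.rightColor_child h (hg.trans hr) h').2.2 hgr hkp)
        fun h' => (hC.rightColor_child h (hg.trans hr) h').2.2 hgr hkp)

/-- The first color of a path below the left child `l` which is reached without turning left. -/
lemma rightColor_turn_right {p l m : ι} {σ₀ σ : Fin 15 × Fin 15 × Fin 15}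
    (hl : C.Le l p) (hσ : T.RightColor p σ₀ l σ) (hml : C.Le m l) (hm : C.Meet m p)
    (hno : ∀ g gr gl, C.Trio g gr gl → C.Le g l → C.Meet gr p → ¬ C.Le m gl) :
    ∃ σ', T.RightColor p σ₀ m σ' ∧ σ'.1 = σ.1 := by
  -- Right turns and forced steps preserve the first entry.
  by_contra hcon
  obtain ⟨k, ⟨hmk, hkl, hcon⟩, -, hmax⟩ := exists_maximal (C := C)
    {k | C.Le m k ∧ C.Le k l ∧ ¬ ∃ σ', T.RightColor p σ₀ k σ' ∧ σ'.1 = σ.1}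
    ⟨Le.refl m, hml, hcon⟩
  have hne : k ≠ l := by
    rintro rfl
    exact hcon ⟨σ, hσ, rfl⟩
  obtain ⟨g, gr, gl, h, hg, hkc⟩ := exists_parent (hC.binary hT) hkl hne
  have hkg : C.Le k g ∧ k ≠ g := by
    rcases hkc with rfl | rfl
    · exact ⟨h.le_right, h.right_ne⟩
    · exact ⟨h.le_left, h.left_ne⟩
  have hgσ : ∃ σ', T.RightColor p σ₀ g σ' ∧ σ'.1 = σ.1 := by
    by_contra hg'
    exact hkg.2 (hmax g ⟨hmk.trans hkg.1, hg, hg'⟩ hkg.1).symm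
  obtain ⟨⟨c₁, c₂, c₃⟩, hgσ, e⟩ := hgσ
  have hkp := hm.up hmk (hkl.trans hl)
  obtain ⟨h₁, h₂, h₃⟩ := hC.rightColor_child h (hg.trans hl) hgσ
  rcases hkc with rfl | rfl
  · by_cases hgl : C.Meet gl p
    · exact hcon ⟨_, (h₁ hkp hgl).1, e⟩
    · exact hcon ⟨_, h₂ hkp hgl, e⟩
  · exact hcon ⟨_, h₃ (fun hgr => hno g gr _ h hg hgr hmk) hkp, e⟩

omit hC hT [Finite ι] in
lemma inTriple_of_rightColor {p q : ι} {c₁ c₂ c₃ : Fin 15} {σ : Fin 15 × Fin 15 × Fin 15}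
    {t : Fin 5} (h : T.RightColor p (c₁, c₂, c₃) q σ) (hnd : [c₁, c₂, c₃].Nodup)
    (h₁ : InTriple c₁ t) (h₂ : InTriple c₂ t) (h₃ : InTriple c₃ t) :
    [σ.1, σ.2.1, σ.2.2].Nodup ∧ InTriple σ.1 t ∧ InTriple σ.2.1 t ∧ InTriple σ.2.2 t := by
  induction h with
  | start => exact ⟨hnd, h₁, h₂, h₃⟩
  | one _ _ _ _ ih => exact ih
  | right _ _ _ _ ih =>
    refine ⟨?_, ih.2.1, ih.2.2.2, ih.2.2.1⟩
    have := ih.1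
    simp only [List.nodup_cons, List.mem_cons, List.not_mem_nil, or_false, not_or] at this ⊢
    exact ⟨⟨this.1.2, this.1.1⟩, Ne.symm this.2.1, this.2.2⟩
  | left _ _ _ _ ih =>
    refine ⟨?_, ih.2.2.1, ih.2.1, ih.2.2.2⟩
    have := ih.1
    simp only [List.nodup_cons, List.mem_cons, List.not_mem_nil, or_false, not_or] at this ⊢
    exact ⟨⟨Ne.symm this.1.1, this.2.1⟩, this.1.2, this.2.2⟩

omit hC hT [Finite ι] in
lemma inTriple_unique {c : Fin 15} {s t : Fin 5} (hs : InTriple c s) (ht : InTriple c t) :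
    s = t :=
  Fin.ext (hs.symm.trans ht)

lemma inTriple_of_meet {triple : ι → Fin 5} {L : ι → Fin 15} {p q : ι}
    (h : T.ColorTouch triple L p) (hq : C.Le q p) (hqp : C.Meet q p) :
    InTriple (L q) (triple p) := by
  obtain ⟨c₁, c₂, c₃, hnd, h₁, h₂, h₃, hL⟩ := h
  obtain ⟨σ, hσ⟩ := hC.exists_rightColor hT (c₁, c₂, c₃) hq hqp
  rw [hL q σ hσ]
  exact (inTriple_of_rightColor hσ hnd h₁ h₂ h₃).2.1

/-- If both children of `q` touch `p`, then paths through the two extremal edges have different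
labels. -/
lemma ne_of_both_meet {triple : ι → Fin 5} {L : ι → Fin 15} {p q r l i j : ι} {e e' : Sym2 V}
    (hL : T.ColorTouch triple L p) (h : C.Trio q r l) (hq : C.Le q p) (hr : C.Meet r p)
    (hl : C.Meet l p) (he : C.ExtEdge q r l e) (he' : C.ExtEdge q l r e')
    (hi : e ∈ (C.pg i).edgeSet) (hj : e' ∈ (C.pg j).edgeSet) : L i ≠ L j := by
  obtain ⟨c₁, c₂, c₃, hnd, h₁, h₂, h₃, hL⟩ := hL
  obtain ⟨⟨d₁, d₂, d₃⟩, hσ⟩ := hC.exists_rightColor hT (c₁, c₂, c₃) hq (hr.up h.le_right hq)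
  have hnd' := (inTriple_of_rightColor hσ hnd h₁ h₂ h₃).1
  obtain ⟨hσr, hσl⟩ := (hC.rightColor_child h hq hσ).1 hr hl
  -- The path through the edge of `r` has label `d₁` or `d₃`, while the path through the edge of `l`
  -- keeps `d₂`.
  have hi' := hC.rightColor_turn_left hT (h.le_right.trans hq) hσr (h.le_of_extEdge_right he hi)
    (h.meet_of_extEdge_right hq hr hl he hi)
    fun g gr gl hg hgr hgl => h.not_le_of_extEdge_right hq he hi hg hgr hgl
  obtain ⟨σ', hσ', e'⟩ := hC.rightColor_turn_right hT (h.le_left.trans hq) hσl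
    (h.le_of_extEdge_left he' hj) (h.meet_of_extEdge_left hq hr hl he' hj)
    fun g gr gl hg hgl hgr => h.not_le_of_extEdge_left hq he' hj hg hgl hgr
  rw [hL j σ' hσ', e']
  simp only [List.nodup_cons, List.mem_cons, List.not_mem_nil, or_false, not_or] at hnd'
  rcases hi' with hi' | hi'
  · rw [hL i _ hi']
    exact hnd'.1.1
  · rw [hL i _ hi']
    exact Ne.symm hnd'.2.1

/-- If the child `c` of `q` touches `p` and its sibling `o` does not, then a path through the extremal
edge of `c` has its label in a triple different from that of `o`. -/
lemma exists_inTriple_ne {triple : ι → Fin 5} {L : ι → Fin 15}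
    (hL : ∀ p, T.InMAX p → T.ColorTouch triple L p ∧ T.TripleMax triple p) {p q c o i : ι}
    {e : Sym2 V} (hp : T.InMAX p) (ho : T.MaxIII p o) (hoq : T.IsChild o q) (hcp : C.Le c p)
    (hc : C.Meet c p) (hoc : ¬ C.Le o c) (hce : T.ExtremalEdge q c e)
    (he : e ∈ (C.pg c).edgeSet) (hi : e ∈ (C.pg i).edgeSet) (hic : C.Le i c) :
    ∃ t, InTriple (L i) t ∧ t ≠ triple o := by
  obtain ⟨hLp, X, Y, W, Z, hnd, hII, A, hA, hIII⟩ := hL p hp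
  simp only [List.nodup_cons, List.mem_cons, List.not_mem_nil, or_false, not_or] at hnd
  obtain ⟨⟨hpX, hpY, hpW, hpZ⟩, ⟨hXY, hXW, hXZ⟩, ⟨hYW, hYZ⟩, hWZ, -⟩ := hnd
  have hoWZ : triple o = W ∨ triple o = Z := by
    by_cases hoA : o ∈ A
    · exact Or.inl ((hIII o ho).1 hoA)
    · exact Or.inr ((hIII o ho).2 hoA)
  -- If `i` touches `p`, its label is in the triple of `p`. Otherwise the member `m` of `Max_p`
  -- above `i` also contains the edge, and the label of `i` is in the triple of `m`.
  by_cases hip : C.Meet i p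
  · refine ⟨_, hC.inTriple_of_meet hT hLp (hic.trans hcp) hip, ?_⟩
    rcases hoWZ with h | h <;> rw [h] <;> assumption
  obtain ⟨m, hm, him⟩ := hC.exists_max (hic.trans hcp) hip
  obtain ⟨hmp, hmp', hmx⟩ := hC.max_iff.1 hm
  have hcm : ¬ C.Le c m := fun h => hmp' (hc.up h hmp)
  have hmc : C.Le m c := (le_total_of_le him hic).resolve_right hcm
  have hme : e ∈ (C.pg m).edgeSet := by
    induction e with
    | h x y =>
      have hxy := mem_vs_of_adj (show (C.pg c).Adj x y from he)
      have hxy' := mem_vs_of_adj (show (C.pg i).Adj x y from hi)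
      exact adj_of_mem (show (C.pg c).Adj x y from he)
        (sep him (fun h => absurd h hcm) hxy'.1 hxy.1) (sep him (fun h => absurd h hcm) hxy'.2 hxy.2)
  have him' : C.Meet i m := by
    induction e with
    | h x y =>
      exact ⟨x, (mem_vs_of_adj (show (C.pg i).Adj x y from hi)).1,
        (mem_vs_of_adj (show (C.pg m).Adj x y from hme)).1⟩
  refine ⟨triple m, hC.inTriple_of_meet hT (hL m (.step hp hm)).1 him him', ?_⟩
  obtain ⟨g, r, l, h, hg, hmg⟩ := exists_parent (hC.binary hT) hmp (hC.max_ne hm)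
  have hmg' : C.Le m g ∧ m ≠ g := by
    rcases hmg with rfl | rfl
    · exact ⟨h.le_right, h.right_ne⟩
    · exact ⟨h.le_left, h.left_ne⟩
  have hgp : C.Meet g p := by
    by_contra hgp
    exact hmg'.2 (hmx g hg hgp hmg'.1).symm
  have hch := hC.children_of_trio h
  have htr : T.Touch p r ↔ C.Meet r p := by
    rw [hC.touch_iff]
    exact and_iff_right (h.le_right.trans hg)
  have htl : T.Touch p l ↔ C.Meet l p := by
    rw [hC.touch_iff]
    exact and_iff_right (h.le_left.trans hg)
  -- Type II gives `X` or `Y`, which differ from `W` and `Z`. In `Max_p^III`, the shared edge gives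
  -- an arrow from `m` to `o`, which forces different classes.
  have hcase : (triple m = X ∨ triple m = Y) ∨ T.MaxIII p m := by
    rcases hmg with rfl | rfl
    · by_cases hl : C.Meet l p
      · exact Or.inr ⟨hm, g, _, l, hch, Or.inl ⟨rfl, htl.2 hl⟩⟩
      · exact Or.inl (Or.inl (hII g _ l ⟨hch, hm, hC.max_of_isChild hch.2.1 hg hgp hl⟩).1)
    · by_cases hr : C.Meet r p
      · exact Or.inr ⟨hm, g, r, _, hch, Or.inr ⟨rfl, htr.2 hr⟩⟩
      · exact Or.inl (Or.inr (hII g r _ ⟨hch, hC.max_of_isChild hch.1 hg hgp hr, hm⟩).2)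
  rcases hcase with hm' | hm'
  · rcases hm' with h₁ | h₁ <;> rcases hoWZ with h₂ | h₂ <;> rw [h₁, h₂] <;> assumption
  · have hne : m ≠ o := by
      rintro rfl
      exact hoc hmc
    have harr : T.Arrow m o := ⟨hne, q, hoq, c, e, hce, hC.mem_edges.2 hme⟩
    have hiff : ¬ (m ∈ A ↔ o ∈ A) := fun h' => hA m o hm' ho h' harr
    by_cases hmA : m ∈ A <;> by_cases hoA : o ∈ A
    · exact absurd (iff_of_true hmA hoA) hiff
    · rw [(hIII m hm').1 hmA, (hIII o ho).2 hoA]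
      exact hWZ
    · rw [(hIII m hm').2 hmA, (hIII o ho).1 hoA]
      exact Ne.symm hWZ
    · exact absurd (iff_of_false hmA hoA) hiff

omit [Finite ι] hC hT in
lemma meet_of_edge {i j : ι} {e : Sym2 V} (hi : e ∈ (C.pg i).edgeSet)
    (hj : e ∈ (C.pg j).edgeSet) : C.Meet i j := by
  induction e with
  | h x y =>
    exact ⟨x, (mem_vs_of_adj (show (C.pg i).Adj x y from hi)).1,
      (mem_vs_of_adj (show (C.pg j).Adj x y from hj)).1⟩

/-- Paths through the two extremal edges of a face have different labels. -/
theorem ne_of_extEdge {L : ι → Fin 15} (hF : T.FifteenForests L) {q r l i j : ι} {e e' : Sym2 V}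
    (h : C.Trio q r l) (he : C.ExtEdge q r l e) (he' : C.ExtEdge q l r e')
    (hi : e ∈ (C.pg i).edgeSet) (hj : e' ∈ (C.pg j).edgeSet) : L i ≠ L j := by
  obtain ⟨triple, -, hL⟩ := hF
  obtain ⟨p, hp, hq, hqp⟩ := hC.exists_inMAX q
  have hch := hC.children_of_trio h
  have hir := h.le_of_extEdge_right he hi
  have hjl := h.le_of_extEdge_left he' hj
  -- When only one child touches `p`, one label lies in the triple of the missing child and the
  -- other avoids it; when neither does, the triples are `X` and `Y`.
  by_cases hr : C.Meet r p <;> by_cases hl : C.Meet l p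
  · exact hC.ne_of_both_meet hT (hL p hp).1 h hq hr hl he he' hi hj
  · have hM := hC.max_of_isChild hch.2.1 hq hqp hl
    obtain ⟨t, ht, hne⟩ := hC.exists_inTriple_ne hT hL (c := r) (i := i) hp
      ⟨hM, q, r, l, hch, Or.inr ⟨rfl, hC.touch_iff.2 ⟨h.le_right.trans hq, hr⟩⟩⟩ hch.2.1
      (h.le_right.trans hq) hr (h.not_ge (Le.refl _) (Le.refl _))
      ((hC.extremalEdge_iff hT).2 ⟨r, l, h, Or.inl ⟨rfl, he⟩⟩) he.mem hi hir
    intro hij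
    rw [hij] at ht
    exact hne (inTriple_unique ht (hC.inTriple_of_meet hT (hL l (.step hp hM)).1 hjl
      (meet_of_edge hj he'.mem)))
  · have hM := hC.max_of_isChild hch.1 hq hqp hr
    obtain ⟨t, ht, hne⟩ := hC.exists_inTriple_ne hT hL (c := l) (i := j) hp
      ⟨hM, q, r, l, hch, Or.inl ⟨rfl, hC.touch_iff.2 ⟨h.le_left.trans hq, hl⟩⟩⟩ hch.1
      (h.le_left.trans hq) hl (h.not_le (Le.refl _) (Le.refl _))
      ((hC.extremalEdge_iff hT).2 ⟨r, l, h, Or.inr ⟨rfl, he'⟩⟩) he'.mem hj hjl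
    intro hij
    rw [← hij] at ht
    exact hne (inTriple_unique ht (hC.inTriple_of_meet hT (hL r (.step hp hM)).1 hir
      (meet_of_edge hi he.mem)))
  · have hMr := hC.max_of_isChild hch.1 hq hqp hr
    have hMl := hC.max_of_isChild hch.2.1 hq hqp hl
    obtain ⟨-, X, Y, W, Z, hnd, hII, -⟩ := hL p hp
    obtain ⟨h₁, h₂⟩ := hII q r l ⟨hch, hMr, hMl⟩
    simp only [List.nodup_cons, List.mem_cons, List.not_mem_nil, or_false, not_or] at hnd
    intro hij
    have ht₁ := hC.inTriple_of_meet hT (hL r (.step hp hMr)).1 hir (meet_of_edge hi he.mem)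
    have ht₂ := hC.inTriple_of_meet hT (hL l (.step hp hMl)).1 hjl (meet_of_edge hj he'.mem)
    rw [hij] at ht₁
    have := inTriple_unique ht₁ ht₂
    rw [h₁, h₂] at this
    exact hnd.2.1.1 this

/-- The paths with a given label form no cycle. -/
theorem isAcyclic {L : ι → Fin 15} (hF : T.FifteenForests L) (c : Fin 15) :
    (P.unionGraph {i | L i = c}).IsAcyclic := by
  refine (isAcyclic_of_extEdge (hC.binary hT) (S := {i | L i = c}) hC.le_root
    fun q r l h e e' he he' i hi j hj hei hej =>
      hC.ne_of_extEdge hT hF h he he' hei hej (hi.trans hj.symm)).anti ?_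
  rintro u v ⟨i, hi, h⟩
  simp only [iSup_adj]
  exact ⟨i, hi, (hC.adj i u v).2 h⟩

end IsModel

end Genealogy

/-! ### Execution of the algorithm -/

/-- A relation on a finite set without cycles, and with at most one arrow into each point, is
bipartite. -/
lemma exists_two_classes {α : Type*} [Finite α] {R : α → α → Prop} (μ : α → ℕ)
    (hμ : ∀ u v, R u v → μ v < μ u) (hR : ∀ u u' v, R u v → R u' v → u = u') :
    ∃ A : Set α, ∀ u v, R u v → ¬ (u ∈ A ↔ v ∈ A) := by
  -- The parity of the number of ancestors: the ancestors of `v` are `u` and those of `u`, and `μ`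
  -- excludes that `u` is its own ancestor.
  refine ⟨{v | Even {w | Relation.TransGen R w v}.ncard}, fun u v huv => ?_⟩
  have hμ' : ∀ w, Relation.TransGen R w u → μ u < μ w := by
    intro w hw
    induction hw using Relation.TransGen.head_induction_on with
    | single h => exact hμ _ _ h
    | head h _ ih => exact ih.trans (hμ _ _ h)
  have e : {w | Relation.TransGen R w v} = insert u {w | Relation.TransGen R w u} := by
    ext w
    constructor
    · intro h
      obtain ⟨x, hwx, hxv⟩ := Relation.TransGen.tail'_iff.1 h
      obtain rfl := hR _ _ _ huv hxv
      rcases Relation.reflTransGen_iff_eq_or_transGen.1 hwx with rfl | h'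
      · exact Set.mem_insert _ _
      · exact Set.mem_insert_of_mem _ h'
    · rintro (rfl | h)
      · exact .single huv
      · exact .tail h huv
  have hc : {w | Relation.TransGen R w v}.ncard = {w | Relation.TransGen R w u}.ncard + 1 := by
    rw [e]
    exact Set.ncard_insert_of_notMem fun h => (hμ' u h).false
  simp only [Set.mem_ofPred_eq, hc, Nat.even_add_one]
  tauto

namespace Genealogy

variable {V : Type*} [Fintype V] {G : PlaneGraph V} {ι : Type*} {P : PathFamily G.graph ι}
  {T : Genealogy G P} {C : ChordSystem G.graph ι}

namespace IsModel

open ChordSystem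

variable (hC : T.IsModel C)

include hC

lemma parent_unique {c q q' : ι} (h : T.IsChild c q) (h' : T.IsChild c q') : q = q' := by
  rw [hC.isChild_iff] at h h'
  rcases le_total_of_le h.1 h'.1 with hle | hle
  · exact (h'.2.2 q h.1 hle).resolve_left h.2.1.symm
  · exact ((h.2.2 q' h'.1 hle).resolve_left h'.2.1.symm).symm

variable [Finite ι]

/-- If `p` is strictly below `p'`, it misses `p'`, so `m` is not maximal for `p'`. Hence no triple
is assigned by two different `p`. -/
lemma max_unique {p p' m : ι} (hp : T.InMAX p) (hp' : T.InMAX p') (h : T.Max p m)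
    (h' : T.Max p' m) : p = p' := by
  have key : ∀ {p p'}, T.InMAX p → T.InMAX p' → T.Max p m → T.Max p' m → C.Le p p' → p = p' := by
    intro p p' hp hp' h h' hle
    by_contra hne
    exact hC.max_ne h ((hC.max_iff.1 h').2.2 p hle (hC.not_meet_of_inMAX hp' hp hle hne)
      (hC.max_iff.1 h).1).symm
  rcases le_total_of_le (hC.max_iff.1 h).1 (hC.max_iff.1 h').1 with hle | hle
  · exact key hp hp' h h' hle
  · exact (key hp' hp h' h hle).symm

variable (hT : T.IsBinary)

include hT

lemma children_unique {c q r l q' r' l' : ι} (h : T.Children q r l) (h' : T.Children q' r' l')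
    (hc : T.IsChild c q) (hc' : T.IsChild c q') : r' = r ∧ l' = l ∧ r ≠ l := by
  obtain rfl := hC.parent_unique hc hc'
  have ht := (hC.children_iff hT).1 h
  obtain ⟨h₁, h₂⟩ := ht.unique ((hC.children_iff hT).1 h')
  refine ⟨h₁, h₂, ?_⟩
  rintro rfl
  exact ht.not_le (Le.refl _) (Le.refl _) (Le.refl _)

/-- The parent is unique, and which children touch `p` decides the recursive call, so every path is
reached once. -/
lemma rightColor_unique {p q : ι} {σ₀ σ σ' : Fin 15 × Fin 15 × Fin 15}
    (h : T.RightColor p σ₀ q σ) (h' : T.RightColor p σ₀ q σ') : σ = σ' := by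
  have hroot : ∀ {g σ}, T.RightColor p σ₀ g σ → ¬ T.IsChild p g := fun hg hch =>
    (hC.isChild_iff.1 hch).2.1 ((hC.isChild_iff.1 hch).1.antisymm (hC.le_meet_of_rightColor hg).1)
  induction h generalizing σ' with
  | start =>
    cases h' with
    | start => rfl
    | one hg hch _ _ => exact absurd hch (hroot hg)
    | right hg hch _ _ => exact absurd hch.1 (hroot hg)
    | left hg hch _ _ => exact absurd hch.2.1 (hroot hg)
  | one hg hch _ hu ih =>
    cases h' with
    | start => exact absurd hch (hroot hg)
    | one hg' hch' _ _ =>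
      obtain rfl := hC.parent_unique hch hch'
      exact ih hg'
    | right hg' hch' h₁ h₂ =>
      obtain rfl := hC.parent_unique hch hch'.1
      exact absurd (hu _ hch'.2.1 h₂).symm (hC.children_unique hT hch' hch' hch hch).2.2
    | left hg' hch' h₁ h₂ =>
      obtain rfl := hC.parent_unique hch hch'.2.1
      exact absurd (hu _ hch'.1 h₁) (hC.children_unique hT hch' hch' hch hch).2.2
  | right hg hch h₁ h₂ ih =>
    cases h' with
    | start => exact absurd hch.1 (hroot hg)
    | one hg' hch' _ hu =>
      obtain rfl := hC.parent_unique hch.1 hch'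
      exact absurd (hu _ hch.2.1 h₂).symm (hC.children_unique hT hch hch hch' hch').2.2
    | right hg' hch' _ _ =>
      obtain rfl := hC.parent_unique hch.1 hch'.1
      have := ih hg'
      simp only [Prod.mk.injEq] at this ⊢
      exact ⟨this.1, this.2.2, this.2.1⟩
    | left hg' hch' _ _ =>
      obtain ⟨e, -, hne⟩ := hC.children_unique hT hch hch' hch.1 hch'.2.1
      obtain ⟨-, e', -⟩ := hC.children_unique hT hch hch' hch.1 hch'.2.1
      exact absurd e' hne
  | left hg hch h₁ h₂ ih =>
    cases h' with
    | start => exact absurd hch.2.1 (hroot hg)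
    | one hg' hch' _ hu =>
      obtain rfl := hC.parent_unique hch.2.1 hch'
      exact absurd (hu _ hch.1 h₁) (hC.children_unique hT hch hch hch' hch').2.2
    | right hg' hch' _ _ =>
      obtain ⟨e, -, hne⟩ := hC.children_unique hT hch hch' hch.2.1 hch'.1
      exact absurd e.symm hne
    | left hg' hch' _ _ =>
      obtain rfl := hC.parent_unique hch.2.1 hch'.2.1
      have := ih hg'
      simp only [Prod.mk.injEq] at this ⊢
      exact ⟨this.2.1, this.1, this.2.2⟩

/-- Two paths below `r` with a common edge of `r` are nested. -/
lemma le_total_of_edge {r u u' : ι} {e : Sym2 V} (hu : C.Le u r) (hu' : C.Le u' r)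
    (her : e ∈ (C.pg r).edgeSet) (he : e ∈ (C.pg u).edgeSet) (he' : e ∈ (C.pg u').edgeSet) :
    C.Le u u' ∨ C.Le u' u := by
  by_contra! hcon
  obtain ⟨g, ⟨hug, hug'⟩, hgr, hmin⟩ :=
    exists_minimal (C := C) {k | C.Le u k ∧ C.Le u' k} (i := r) ⟨hu, hu'⟩
  have hv : ∃ x, x ∈ C.vs r ∧ x ∈ C.vs u ∧ x ∈ C.vs u' := by
    induction e with
    | h x y =>
      exact ⟨x, (mem_vs_of_adj (show (C.pg r).Adj x y from her)).1,
        (mem_vs_of_adj (show (C.pg u).Adj x y from he)).1,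
        (mem_vs_of_adj (show (C.pg u').Adj x y from he')).1⟩
  obtain ⟨x, hxr, hxu, hxu'⟩ := hv
  have hxg : x ∈ C.vs g := sep hug (fun h => h.antisymm hgr) hxu hxr
  rcases hC.binary hT g with hg | ⟨gr, gl, h⟩
  · rw [hg u hug, hg u' hug'] at hcon
    exact hcon.1 (Le.refl _)
  have hne : u ≠ g ∧ u' ≠ g := by
    constructor
    · rintro rfl
      exact hcon.2 hug'
    · rintro rfl
      exact hcon.1 hug
  -- Under different children of the lowest common ancestor `g`, a vertex shared with `r` would lie
  -- on `g` and on both its children.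
  have key : ∀ {u u'}, C.Le u gr → C.Le u' gl → x ∈ C.vs u → x ∈ C.vs u' → False := by
    intro u u' hr hl hx hx'
    exact h.no_common hxg (sep hr (fun h' => absurd (Le.refl u') (h.not_le h' hl)) hx hx')
      (sep hl (fun h' => absurd (Le.refl u) (h.not_le hr h')) hx' hx)
  rcases h.cover u hug hne.1 with h₁ | h₁ <;> rcases h.cover u' hug' hne.2 with h₂ | h₂
  · exact h.right_ne (hmin gr ⟨h₁, h₂⟩ h.le_right)
  · exact key h₁ h₂ hxu hxu'
  · exact key h₂ h₁ hxu' hxu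
  · exact h.left_ne (hmin gl ⟨h₁, h₂⟩ h.le_left)

/-- An arrow into the path `v` comes from below its sibling. -/
lemma exists_of_arrow {p u v : ι} (hu : T.MaxIII p u) (hv : T.MaxIII p v) (h : T.Arrow u v) :
    ∃ q c e, T.IsChild v q ∧ T.IsChild c q ∧ c ≠ v ∧ T.ExtremalEdge q c e ∧
      e ∈ (C.pg c).edgeSet ∧ e ∈ (C.pg u).edgeSet ∧ C.Le u c ∧ u ≠ c := by
  obtain ⟨hne, q, hvq, c, e, hce, hue⟩ := h
  rw [hC.mem_edges] at hue
  obtain ⟨r, l, ht, hcase⟩ := (hC.extremalEdge_iff hT).1 hce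
  have hcc : T.IsChild c q ∧ C.Le u c ∧ e ∈ (C.pg c).edgeSet := by
    rcases hcase with ⟨rfl, he⟩ | ⟨rfl, he⟩
    · exact ⟨hC.isChild_right ht, ht.le_of_extEdge_right he hue, he.mem⟩
    · exact ⟨hC.isChild_left ht, ht.le_of_extEdge_left he hue, he.mem⟩
  obtain ⟨hcq, huc, hec⟩ := hcc
  have hu' := hC.max_iff.1 hu.1
  have hv' := hC.max_iff.1 hv.1
  -- `u` is not strictly below `v`, as both are maximal among the paths missing `p`. So the edge
  -- belongs to the sibling of `v`, which touches `p` and hence is not `u`.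
  have hcv : c ≠ v := by
    rintro rfl
    exact hne (hu'.2.2 _ hv'.1 hv'.2.1 huc).symm
  refine ⟨q, c, e, hvq, hcq, hcv, hce, hec, hue, huc, ?_⟩
  rintro rfl
  obtain ⟨q', r', l', hch, hs⟩ := hv.2
  have ht' := (hC.children_iff hT).1 hch
  have hvq' : T.IsChild v q' := by
    rcases hs with ⟨rfl, -⟩ | ⟨rfl, -⟩
    · exact hch.1
    · exact hch.2.1
  obtain rfl := hC.parent_unique hvq hvq'
  have hcl := hch.2.2.2 u hcq
  rcases hs with ⟨rfl, hs⟩ | ⟨rfl, hs⟩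
  · rw [← hcl.resolve_left hcv] at hs
    exact hu'.2.1 (hC.touch_iff.1 hs).2
  · rw [← hcl.resolve_right hcv] at hs
    exact hu'.2.1 (hC.touch_iff.1 hs).2

/-- The paths of `Max_p^III` can be split into two classes. -/
lemma exists_classes (p : ι) : ∃ A : Set ι, ∀ u v, T.MaxIII p u → T.MaxIII p v →
    (u ∈ A ↔ v ∈ A) → ¬ T.Arrow u v := by
  obtain ⟨A, hA⟩ : ∃ A : Set ι, ∀ u v, T.MaxIII p u ∧ T.MaxIII p v ∧ T.Arrow u v →
      ¬ (u ∈ A ↔ v ∈ A) := by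
    -- The source of an arrow is strictly below the sibling of the target, so it has more paths
    -- above it. All sources of arrows into `v` contain the one extremal edge of the sibling; they
    -- are nested and, by maximality, equal.
    refine exists_two_classes (fun u => {k | C.Le u k}.ncard) ?_ ?_
    · rintro u v ⟨hu, hv, h⟩
      obtain ⟨q, c, e, hvq, hcq, hcv, -, -, -, huc, hne⟩ := hC.exists_of_arrow hT hu hv h
      rw [hC.isChild_iff] at hvq hcq
      have hsub : {k | C.Le v k} ⊆ insert v {k | C.Le q k} := by
        intro k hk
        rcases le_total_of_le hk hvq.1 with hkq | hkq
        · rcases hvq.2.2 k hk hkq with rfl | rfl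
          · exact Set.mem_insert _ _
          · exact Set.mem_insert_of_mem _ (Le.refl _)
        · exact Set.mem_insert_of_mem _ hkq
      have hsup : insert u (insert c {k | C.Le q k}) ⊆ {k | C.Le u k} := by
        rintro k (rfl | rfl | hk)
        · exact Le.refl _
        · exact huc
        · exact huc.trans (hcq.1.trans hk)
      have h₁ := (Set.ncard_le_ncard hsub (Set.toFinite _)).trans (Set.ncard_insert_le _ _)
      have h₂ := Set.ncard_le_ncard hsup (Set.toFinite _)
      have hqc : ¬ C.Le q c := fun h => hcq.2.1 (hcq.1.antisymm h)
      have hqu : ¬ C.Le q u := fun h => hqc (h.trans huc)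
      rw [Set.ncard_insert_of_notMem (by
        rintro (h | h)
        · exact hne h
        · exact hqu h), Set.ncard_insert_of_notMem (s := {k | C.Le q k}) hqc] at h₂
      omega
    · rintro u u' v ⟨hu, hv, h⟩ ⟨hu', -, h'⟩
      obtain ⟨q, c, e, hvq, hcq, hcv, hce, hec, hue, huc, -⟩ := hC.exists_of_arrow hT hu hv h
      obtain ⟨q', c', e', hvq', hcq', hcv', hce', -, hue', huc', -⟩ :=
        hC.exists_of_arrow hT hu' hv h'
      obtain rfl := hC.parent_unique hvq hvq'
      obtain ⟨r, l, ht, hcase⟩ := (hC.extremalEdge_iff hT).1 hce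
      obtain ⟨r', l', ht', hcase'⟩ := (hC.extremalEdge_iff hT).1 hce'
      obtain ⟨rfl, rfl⟩ := ht.unique ht'
      have hvc := (hC.children_of_trio ht).2.2.2 v hvq
      have hcc : c' = c ∧ e' = e := by
        rcases hcase with ⟨rfl, he⟩ | ⟨rfl, he⟩ <;> rcases hcase' with ⟨rfl, he'⟩ | ⟨rfl, he'⟩
        · exact ⟨rfl, ht.extEdge_right_unique he' he⟩
        · rcases hvc with rfl | rfl
          · exact absurd rfl hcv
          · exact absurd rfl hcv'
        · rcases hvc with rfl | rfl
          · exact absurd rfl hcv'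
          · exact absurd rfl hcv
        · exact ⟨rfl, ht.extEdge_left_unique he' he⟩
      obtain ⟨rfl, rfl⟩ := hcc
      have hm := hC.max_iff.1 hu.1
      have hm' := hC.max_iff.1 hu'.1
      rcases hC.le_total_of_edge hT huc huc' hec hue hue' with hle | hle
      · exact (hm.2.2 u' hm'.1 hm'.2.1 hle).symm
      · exact hm'.2.2 u hm.1 hm.2.1 hle
  exact ⟨A, fun u v hu hv h ha => hA u v ⟨hu, hv, ha⟩ h⟩

/-- The offsets of the triples: `1`, `2` for the faces of type II, `3`, `4` for type III. -/
lemma exists_offset (A : ι → Set ι) (k : ι) : ∃ o : Fin 5,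
    (∀ p q r l, T.InMAX p → T.TypeII p q r l → (k = r → o = 1) ∧ (k = l → o = 2)) ∧
    ∀ p, T.InMAX p → T.MaxIII p k → (k ∈ A p → o = 3) ∧ (k ∉ A p → o = 4) := by
  have hII : ∀ {p q r l p' q' r' l'}, T.TypeII p q r l → T.TypeII p' q' r' l' →
      k = r → k = l' → False := by
    rintro p q r l p' q' r' l' h h' rfl rfl
    obtain ⟨-, e, hne⟩ := hC.children_unique hT h.1 h'.1 h.1.1 h'.1.2.1
    exact hne e
  have hIII : ∀ {p q r l p'}, T.InMAX p → T.TypeII p q r l → T.InMAX p' → T.MaxIII p' k →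
      (k = r ∨ k = l) → False := by
    rintro p q r l p' hp h hp' ⟨hk, q', r', l', hch, hs⟩ hkc
    have hpp : p = p' := by
      rcases hkc with rfl | rfl
      · exact hC.max_unique hp hp' h.2.1 hk
      · exact hC.max_unique hp hp' h.2.2 hk
    subst hpp
    have hkq : T.IsChild k q := by
      rcases hkc with rfl | rfl
      · exact h.1.1
      · exact h.1.2.1
    have hkq' : T.IsChild k q' := by
      rcases hs with ⟨rfl, -⟩ | ⟨rfl, -⟩
      · exact hch.1
      · exact hch.2.1
    obtain ⟨rfl, rfl, -⟩ := hC.children_unique hT h.1 hch hkq hkq'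
    rcases hs with ⟨-, hs⟩ | ⟨-, hs⟩
    · exact h.2.2.1.2 hs
    · exact h.2.1.1.2 hs
  by_cases h₁ : ∃ p q r l, T.InMAX p ∧ T.TypeII p q r l ∧ k = r
  · obtain ⟨p, q, r, l, hp, h, hk⟩ := h₁
    exact ⟨1, fun p' q' r' l' _ h' => ⟨fun _ => rfl, fun hk' => (hII h h' hk hk').elim⟩,
      fun p' hp' h' => (hIII hp h hp' h' (Or.inl hk)).elim⟩
  by_cases h₂ : ∃ p q r l, T.InMAX p ∧ T.TypeII p q r l ∧ k = l
  · obtain ⟨p, q, r, l, hp, h, hk⟩ := h₂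
    exact ⟨2, fun p' q' r' l' _ h' => ⟨fun hk' => (hII h' h hk' hk).elim, fun _ => rfl⟩,
      fun p' hp' h' => (hIII hp h hp' h' (Or.inr hk)).elim⟩
  have h₃ : ∀ o : Fin 5, ∀ p q r l, T.InMAX p → T.TypeII p q r l →
      (k = r → o = 1) ∧ (k = l → o = 2) := fun o p q r l hp h =>
    ⟨fun hk => absurd ⟨p, q, r, l, hp, h, hk⟩ h₁, fun hk => absurd ⟨p, q, r, l, hp, h, hk⟩ h₂⟩
  by_cases h₄ : ∃ p, T.InMAX p ∧ T.MaxIII p k ∧ k ∈ A p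
  · obtain ⟨p, hp, h, hk⟩ := h₄
    refine ⟨3, h₃ 3, fun p' hp' h' => ⟨fun _ => rfl, fun hk' => ?_⟩⟩
    obtain rfl := hC.max_unique hp hp' h.1 h'.1
    exact absurd hk hk'
  · exact ⟨4, h₃ 4, fun p hp h => ⟨fun hk => absurd ⟨p, hp, h, hk⟩ h₄, fun _ => rfl⟩⟩

omit hT in
/-- The triples can be prescribed by their differences. -/
lemma exists_triple (o : ι → Fin 5) : ∃ triple : ι → Fin 5, triple T.root = 0 ∧
    ∀ p m, T.InMAX p → T.Max p m → triple m = triple p + o m := by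
  classical
  have := Fintype.ofFinite ι
  -- The sum in `Fin 5` of the offsets of the elements of `MAX` at or above `m`, except the root.
  -- Passing from `p` to a member `m` of `Max_p` adds exactly the term of `m`.
  refine ⟨fun m => ∑ k with T.InMAX k ∧ C.Le m k ∧ k ≠ T.root, o k, ?_, fun p m hp h => ?_⟩
  · refine Finset.sum_eq_zero fun k hk => ?_
    simp only [Finset.mem_filter, Finset.mem_univ, true_and] at hk
    exact absurd ((hC.le_root k).antisymm hk.2.1) hk.2.2
  · obtain ⟨h₁, h₂, h₃⟩ := hC.max_iff.1 h
    have hne := hC.max_ne h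
    have e : (Finset.univ.filter fun k => T.InMAX k ∧ C.Le m k ∧ k ≠ T.root) =
        insert m (Finset.univ.filter fun k => T.InMAX k ∧ C.Le p k ∧ k ≠ T.root) := by
      ext k
      simp only [Finset.mem_filter, Finset.mem_univ, true_and, Finset.mem_insert]
      constructor
      · rintro ⟨hk, hmk, hkr⟩
        by_cases hpk : C.Le p k
        · exact Or.inr ⟨hk, hpk, hkr⟩
        · left
          have hkp := (le_total_of_le hmk h₁).resolve_right hpk
          refine h₃ k hkp (hC.not_meet_of_inMAX hp hk hkp ?_) hmk
          rintro rfl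
          exact hpk (Le.refl _)
      · rintro (rfl | ⟨hk, hpk, hkr⟩)
        · refine ⟨.step hp h, Le.refl _, ?_⟩
          rintro rfl
          exact hne (h₁.antisymm (hC.le_root p))
        · exact ⟨hk, h₁.trans hpk, hkr⟩
    beta_reduce
    rw [e, Finset.sum_insert, add_comm]
    simp only [Finset.mem_filter, Finset.mem_univ, true_and, not_and]
    exact fun _ hpm => absurd (h₁.antisymm hpm) hne

/-- The algorithm can be executed. -/
theorem exists_fifteenForests : ∃ L : ι → Fin 15, T.FifteenForests L := by
  choose A hA using hC.exists_classes hT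
  choose o ho ho' using hC.exists_offset hT A
  obtain ⟨triple, h₀, ht⟩ := hC.exists_triple o
  have hc : ∀ t : Fin 5, ∃ c₁ c₂ c₃ : Fin 15, [c₁, c₂, c₃].Nodup ∧ InTriple c₁ t ∧
      InTriple c₂ t ∧ InTriple c₃ t := by
    unfold InTriple
    decide
  choose c₁ c₂ c₃ hnd h₁ h₂ h₃ using hc
  -- The label is well defined: only one `p ∈ MAX` has `q` in `Touch_p`, and only one call reaches
  -- `q`.
  have hL : ∀ q, ∃ c : Fin 15, ∀ p σ, T.InMAX p →
      T.RightColor p (c₁ (triple p), c₂ (triple p), c₃ (triple p)) q σ → c = σ.1 := by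
    intro q
    obtain ⟨p, hp, hq, hqp⟩ := hC.exists_inMAX q
    obtain ⟨σ, hσ⟩ :=
      hC.exists_rightColor hT (c₁ (triple p), c₂ (triple p), c₃ (triple p)) hq hqp
    refine ⟨σ.1, fun p' σ' hp' hσ' => ?_⟩
    obtain ⟨hq', hqp'⟩ := hC.le_meet_of_rightColor hσ'
    obtain rfl := hC.inMAX_unique hp hp' hq hq' hqp hqp'
    rw [hC.rightColor_unique hT hσ hσ']
  choose L hL using hL
  refine ⟨L, triple, h₀, fun p hp => ⟨⟨_, _, _, hnd (triple p), h₁ _, h₂ _, h₃ _,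
    fun q σ hσ => hL q p σ hp hσ⟩, triple p + 1, triple p + 2, triple p + 3, triple p + 4, ?_,
    fun q r l h => ?_, A p, hA p, fun m hm => ?_⟩⟩
  · generalize triple p = t
    revert t
    decide
  · rw [ht p r hp h.2.1, ht p l hp h.2.2, (ho r p q r l hp h).1 rfl, (ho l p q r l hp h).2 rfl]
    exact ⟨rfl, rfl⟩
  · rw [ht p m hp hm.1]
    exact ⟨fun h => by rw [(ho' m p hp hm).1 h], fun h => by rw [(ho' m p hp hm).2 h]⟩

end IsModel

end Genealogy

/-! ### Families carried by other families -/

/-- An acyclic graph has no nontrivial closed trail. -/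
lemma nil_of_isTrail_of_isAcyclic {V : Type*} {K : SimpleGraph V} (hK : K.IsAcyclic) {v : V}
    {c : K.Walk v v} (hc : c.IsTrail) : c.Nil :=
  Walk.isPath_iff_nil.1 ((hK.isPath_iff_isTrail c).2 hc)

/-- The image of a cycle may revisit vertices, but it is a trail since no two edges are identified;
a closed trail in a forest is trivial. -/
lemma Carries.isAcyclic {V W : Type*} {G : SimpleGraph V} {H : SimpleGraph W} {ι κ : Type*}
    {Q : PathFamily H κ} {P : PathFamily G ι} (j : Carries Q P) {S : Set κ}
    (hS : (Q.unionGraph S).IsAcyclic) : (P.unionGraph (j.toFun ⁻¹' S)).IsAcyclic := by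
  intro v c hc
  let φ : P.unionGraph (j.toFun ⁻¹' S) →g Q.unionGraph S :=
    ⟨j.vert, fun {a b} ⟨i, hi, h⟩ => ⟨j.toFun i, hi, j.map_edge i _ h⟩⟩
  have htr : (c.map φ).IsTrail := by
    rw [Walk.isTrail_def, Walk.edges_map]
    refine hc.isTrail.edges_nodup.map_on fun e he e' he' h => ?_
    have hmem : ∀ e ∈ c.edges, e ∈ P.unionEdges := by
      intro e he
      have := c.edges_subset_edgeSet he
      induction e with
      | h a b =>
        obtain ⟨i, -, h⟩ := this
        exact ⟨i, h⟩
    exact j.edge_injOn (hmem e he) (hmem e' he') h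
  have := Walk.length_eq_zero_iff.2 (nil_of_isTrail_of_isAcyclic hS htr)
  rw [Walk.length_map] at this
  have := hc.three_le_length
  omega

/-! ### Forest labelings, the covering number and the theorem -/

lemma PathFamily.isForestLabeling_of_isAcyclic {V : Type*} {G : SimpleGraph V} {ι : Type*}
    {P : PathFamily G ι} {k : ℕ} {L : ι → Fin k}
    (hL : ∀ c, (P.unionGraph {i | L i = c}).IsAcyclic) : P.IsForestLabeling L :=
  fun c => PathFamily.isForest_of_isAcyclic (hL c)

lemma pcfn_le_of_isForestLabeling {V : Type*} {G : SimpleGraph V} {ι : Type*}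
    {P : PathFamily G ι} {k : ℕ} {L : ι → Fin k} (hL : P.IsForestLabeling L) :
    pcfn P.paths ≤ k := by
  have hF : (∀ H ∈ Set.range fun c => ⨆ i ∈ {i | L i = c}, P.sub i, IsForest H) ∧
      ∀ p ∈ P.paths, ∃ H ∈ Set.range fun c => ⨆ i ∈ {i | L i = c}, P.sub i, p ≤ H := by
    constructor
    · rintro _ ⟨c, rfl⟩
      exact hL c
    · rintro _ ⟨i, rfl⟩
      exact ⟨_, ⟨L i, rfl⟩, le_iSup₂_of_le (f := fun i _ => P.sub i) i rfl le_rfl⟩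
  refine (iInf₂_le (f := fun (F : Set G.Subgraph) _ => F.encard) _ hF).trans ?_
  rw [← Set.image_univ]
  exact (Set.encard_image_le _ _).trans (by simp)

theorem mainTheorem3 {V : Type*} [Fintype V] (G : PlaneGraph V) {ι : Type*} [Fintype ι]
    (P : PathFamily G.graph ι) (hP : IsNCS G P) :
    (∀ {W : Type*} [Fintype W] (H : PlaneGraph W) {κ : Type*} [Fintype κ]
        (B : PathFamily H.graph κ) (T : Genealogy H B) (j : Carries B P),
        IsNCS H B → T.IsBinary →
        (∃ L : κ → Fin 15, T.FifteenForests L) ∧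
        ∀ L : κ → Fin 15, T.FifteenForests L →
          B.IsForestLabeling L ∧ P.IsForestLabeling (fun i => L (j.toFun i))) ∧
    (∃ L : ι → Fin 15, P.IsForestLabeling L) ∧
    pcfn P.paths ≤ 15 := by
  refine ⟨fun {W} _ H {κ} _ B T j hB hT => ?_, ?_⟩
  · obtain ⟨C, hC⟩ := T.exists_isModel hB
    refine ⟨hC.exists_fifteenForests hT, fun L hL => ⟨?_, ?_⟩⟩
    · exact PathFamily.isForestLabeling_of_isAcyclic (hC.isAcyclic hT hL)
    · exact PathFamily.isForestLabeling_of_isAcyclic fun c => j.isAcyclic (hC.isAcyclic hT hL c)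
  -- `P` is labeled directly here, without passing to a BNCS.
  · obtain ⟨L, hL⟩ := hP.exists_labeling
    have hL' := PathFamily.isForestLabeling_of_isAcyclic hL
    exact ⟨⟨L, hL'⟩, pcfn_le_of_isForestLabeling hL'⟩
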